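/- Let $n\ge 2$, $I_0=\{1,\dots,n-1\}$, $\alpha_i=\epsilon_i-\epsilon_{i+1}$, $\mathrm{wt}_i(b)=\mu_i-\mu_{i+1}$ if $\mathrm{wt}(b)=\mu\in\mathbf Z^n$. An *abstract $\mathfrak q(n)$-crystal* (with weights in $\mathbf Z^n$) is a set $\mathcal B$ with maps $\mathrm{wt}:\mathcal B\to\mathbf Z^n$, $\varepsilon_i,\varphi_i:\mathcal B\to\mathbf Z\sqcup\{-\infty\}$ $(i\in I_0)$ and $e_i,f_i:\mathcal B\to\mathcal B\sqcup\{\mathbf 0\}$ $(i\in I_0\sqcup\{\overline 1\})$ such that, with $\alpha_{\overline 1}=\alpha_1$: $\mathrm{wt}(e_ib)=\mathrm{wt}(b)+\alpha_i$ if $e_ib\ne\mathbf 0$ and $\mathrm{wt}(f_ib)=\mathrm{wt}(b)-\alpha_i$ if $f_ib\neq\mathbf 0$; $f_ib=b'\iff b=e_ib'$; for $i\in I_0$, $\varphi_i=\varepsilon_i+\mathrm{wt}_i$, $\varepsilon_i$ and $\varphi_i$ change by $-1,+1$ under $e_i$ and by $+1,-1$ under $f_i$ (when the result is not $\mathbf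 0$), and $\varphi_i(b)=-\infty$ implies $e_ib=f_ib=\mathbf 0$; for $3\le i\le n-1$, $e_{\overline 1},f_{\overline 1}$ commute with $e_i,f_i$, and $\varepsilon_i,\varphi_i$ are unchanged by $e_{\overline 1}$. *Shapes.* Let $\Lambda^-$ be the set of $\lambda=-\lambda_1\epsilon_1-\dots-\lambda_n\epsilon_n$ with integers $\lambda_1\ge\dots\ge\lambda_n\ge0$ such that $\lambda_i=\lambda_{i+1}$ implies $\lambda_i=0$, ordered by $\lambda\le\mu\iff\mu-\lambda\in\Lambda^-$. A word $u_1\cdots u_N$ is a *hook word* if $u_1\ge\dots\ge u_k<u_{k+1}<\dots<u_N$ for some $1\le k\le N$. $\mathrm{SDT}(\lambda)$ is the set of fillings with letters $1,\dots,n$ of the shifted diagram whose $k$-th row (from the top) has $\lambda_k$ boxes, such that each nonempty row $v_k$ is a hook word and, if $v_{k+1}$ is nonempty, $v_k$ is a hook subword (subsequence) of maximal length of $v_{k+1}v_k$. The reading word reads the rows from right to left, starting with the top row; $\mathrm{rd}_i(T)$ is its subword of letters $i,i+1$, and $\mathrm{red}_i(T)$ is obtained from it by successively removing pairs $(i+1,i)$.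 For $i\in I_0$, $e_i$ changes the leftmost $i+1$ in $\mathrm{red}_i(T)$ to $i$, and $f_i$ changes the rightmost $i$ in $\mathrm{red}_i(T)$ to $i+1$ ($\mathbf 0$ if there is none); $e_{\overline 1}$ changes the first letter of $\mathrm{rd}_1(T)$ from $2$ to $1$ ($\mathbf 0$ if it is not $2$), and $f_{\overline 1}$ changes it from $1$ to $2$ ($\mathbf 0$ if it is not $1$); $\mathrm{wt}(T)$ is the content, and $\varepsilon_i(T)$, $\varphi_i(T)$ are the numbers of letters $i+1$, $i$ in $\mathrm{red}_i(T)$. Let $L^\lambda\in\mathrm{SDT}(\lambda)$ be the tableau whose $k$-th row contains only $n+1-k$. Write $\mathrm{SDT}(\lambda)\otimes\mathcal T_{-\lambda}$ for the tensor product with the one-element crystal $\{t_{-\lambda}\}$ of weight $-\mathrm{wt}(L^\lambda)=-\sum_k\lambda_k\epsilon_{n+1-k}$, on which all $e_i,f_i$ vanish and $\varepsilon_i=\varphi_i=-\infty$; thus $L^\lambda\otimes t_{-\lambda}$ has weight $0$, and $x(T\otimes t_{-\lambda})=xT\otimes t_{-\lambda}$ for every operator $x$, $\varphi_i(T\otimes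 t_{-\lambda})=\varphi_i(T)$, $\varepsilon_i(T\otimes t_{-\lambda})=\varepsilon_i(T)+\mathrm{wt}_i(L^\lambda)$. *The set $\mathrm{SDT}(-\infty)$.* It consists of the dual marginally large tableaux: semistandard decomposition tableaux $T$ with $n$ nonempty rows such that for all $1\le k\le n$ the number of leftmost boxes of row $k$ containing $n+1-k$ (the length of the initial run) is exactly one more than the number of boxes of row $k+1$ (row $n+1$ being empty). For $i\in I_0\sqcup\{\overline1\}$, let $T'$ be the filling obtained from $T$ by the rule for $e_i$ (resp. $f_i$) above; if there is none, then $e_iT=\mathbf 0$ (resp. $f_iT=\mathbf 0$). If $T'$ is dual marginally large, it is the value of the operator; otherwise the value is obtained from $T'$ by adding (resp. removing) a box $n-k+1$ on the left of row $k$ for each $1\le k\le n-i$ (for $1\le k\le n-1$ if $i=\overline 1$). The values of $\mathrm{wt},\varepsilon_i,\varphi_i$ at $T$ of shape $\lambda$ are those of $T\otimes t_{-\lambda}$. **Theorem.** The operators above are well defined on $\mathrm{SDT}(\lambda)$ and on $\mathrm{SDT}(-\infty)$, i.e. their nonzero values lie in the same set, and $e_iT\neq\mathbf 0$ for $T\in\mathrm{SDT}(-\infty)$,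 $i\in I_0$. The set $\mathrm{SDT}(-\infty)$ is an abstract $\mathfrak q(n)$-crystal. The crystals $\mathrm{SDT}(\lambda)\otimes\mathcal T_{-\lambda}$, $\lambda\in\Lambda^-$, are abstract $\mathfrak q(n)$-crystals and form a directed system under the crystal embeddings, for $\lambda\le\mu$, that add $\mu_k-\lambda_k$ boxes $n+1-k$ on the left of row $k$ for every $k$; these commute with each operator wherever its value is nonzero on the smaller crystal. There is an isomorphism of crystals $$\mathrm{SDT}(-\infty)\;\cong\;\varinjlim_{\lambda\in\Lambda^-}\mathrm{SDT}(\lambda)\otimes\mathcal T_{-\lambda},\qquad T\mapsto[T\otimes t_{-\lambda}]\quad(T\text{ of shape }\lambda),$$ that is, a bijection preserving $\mathrm{wt},\varepsilon_i,\varphi_i$ and commuting with all operators. Here an operator $x$ on the direct limit is given by $x[b]=[xb]$ for a representative $b$ with $xb\ne\mathbf 0$, and by $\mathbf 0$ if there is no such representative. -/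

import Mathlib

/-!  Crystals for the queer Lie superalgebra `q(n)`, with `n = m + 2 ≥ 2` throughout.

Conventions.  The letter `a ∈ {1, …, n}` is `a - 1 : Fin (m + 2)`, the index `i ∈ I₀ = {1, …, n - 1}`
is `i - 1 : Fin (m + 1)`.  So for `i : Fin (m + 1)` the letters usually called `i` and `i + 1` are
`i.castSucc` and `i.succ`; the odd index uses the letters `1` and `2`, i.e. `Fin.castSucc 0`
and `Fin.succ 0`.  Weights are elements of `ℤⁿ`, and `none` plays the role of the symbol `0`. -/

namespace QueerCrystal

/-! ### Abstract crystals -/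

abbrev Weight (m : ℕ) : Type := Fin (m + 2) → ℤ

/-- `α_i = ε_i - ε_{i+1}`. -/
def simpleRoot {m : ℕ} (i : Fin (m + 1)) : Weight m :=
  Pi.single i.castSucc 1 - Pi.single i.succ 1

/-- `wt_i = μ_i - μ_{i+1}`. -/
def wtDiff {m : ℕ} (i : Fin (m + 1)) (μ : Weight m) : ℤ := μ i.castSucc - μ i.succ

/-- The data of a crystal: a set with a weight map, `ε_i`, `φ_i` (with values in `ℤ ∪ {-∞}`),
and the operators `e_i`, `f_i` (`i ∈ I₀`) and the odd operators `eBar`, `fBar`. -/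
structure CrystalData (m : ℕ) where
  carrier : Type
  wt : carrier → Weight m
  eps : Fin (m + 1) → carrier → WithBot ℤ
  phi : Fin (m + 1) → carrier → WithBot ℤ
  e : Fin (m + 1) → carrier → Option carrier
  f : Fin (m + 1) → carrier → Option carrier
  eBar : carrier → Option carrier
  fBar : carrier → Option carrier

/-- The axioms of an abstract `gl(n)`-crystal. -/
structure IsGLCrystal {m : ℕ} (B : CrystalData m) : Prop where
  wt_e : ∀ i b b', B.e i b = some b' → B.wt b' = B.wt b + simpleRoot i
  wt_f : ∀ i b b', B.f i b = some b' → B.wt b' = B.wt b - simpleRoot i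
  phi_eq : ∀ i b, B.phi i b = B.eps i b + ((wtDiff i (B.wt b) : ℤ) : WithBot ℤ)
  f_iff_e : ∀ i b b', B.f i b = some b' ↔ B.e i b' = some b
  eps_e : ∀ i b b', B.e i b = some b' → B.eps i b' = B.eps i b + ((-1 : ℤ) : WithBot ℤ)
  phi_e : ∀ i b b', B.e i b = some b' → B.phi i b' = B.phi i b + ((1 : ℤ) : WithBot ℤ)
  eps_f : ∀ i b b', B.f i b = some b' → B.eps i b' = B.eps i b + ((1 : ℤ) : WithBot ℤ)
  phi_f : ∀ i b b', B.f i b = some b' → B.phi i b' = B.phi i b + ((-1 : ℤ) : WithBot ℤ)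
  of_phi_bot : ∀ i b, B.phi i b = ⊥ → B.e i b = none ∧ B.f i b = none

/-- The axioms of an abstract `q(n)`-crystal with weights in `ℤⁿ`.
The hypothesis `2 ≤ i.val` says `3 ≤ i` for the usual numbering of `I₀`. -/
structure IsQCrystal {m : ℕ} (B : CrystalData m) : Prop extends IsGLCrystal B where
  wt_eBar : ∀ b b', B.eBar b = some b' → B.wt b' = B.wt b + simpleRoot 0
  wt_fBar : ∀ b b', B.fBar b = some b' → B.wt b' = B.wt b - simpleRoot 0
  fBar_iff_eBar : ∀ b b', B.fBar b = some b' ↔ B.eBar b' = some b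
  eBar_e_comm : ∀ i : Fin (m + 1), 2 ≤ i.val → ∀ b,
    (B.eBar b).bind (B.e i) = (B.e i b).bind B.eBar
  eBar_f_comm : ∀ i : Fin (m + 1), 2 ≤ i.val → ∀ b,
    (B.eBar b).bind (B.f i) = (B.f i b).bind B.eBar
  fBar_e_comm : ∀ i : Fin (m + 1), 2 ≤ i.val → ∀ b,
    (B.fBar b).bind (B.e i) = (B.e i b).bind B.fBar
  fBar_f_comm : ∀ i : Fin (m + 1), 2 ≤ i.val → ∀ b,
    (B.fBar b).bind (B.f i) = (B.f i b).bind B.fBar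
  eps_eBar : ∀ i : Fin (m + 1), 2 ≤ i.val → ∀ b b', B.eBar b = some b' → B.eps i b' = B.eps i b
  phi_eBar : ∀ i : Fin (m + 1), 2 ≤ i.val → ∀ b b', B.eBar b = some b' → B.phi i b' = B.phi i b

/-- A crystal embedding `g : B → C` (no element is sent to `0`): an injective map preserving
`wt`, `ε_i`, `φ_i`, with `g (x b) = x (g b)` for every operator `x` and every `b` with `x b ≠ 0`.
(In particular `g` is a morphism of crystals, for which this equation is only required
when moreover `x (g b) ≠ 0`.) -/
structure IsEmbedding {m : ℕ} {B C : CrystalData m} (g : B.carrier → C.carrier) : Prop where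
  injective : Function.Injective g
  wt : ∀ b, C.wt (g b) = B.wt b
  eps : ∀ i b, C.eps i (g b) = B.eps i b
  phi : ∀ i b, C.phi i (g b) = B.phi i b
  e : ∀ i b b', B.e i b = some b' → C.e i (g b) = some (g b')
  f : ∀ i b b', B.f i b = some b' → C.f i (g b) = some (g b')
  eBar : ∀ b b', B.eBar b = some b' → C.eBar (g b) = some (g b')
  fBar : ∀ b b', B.fBar b = some b' → C.fBar (g b) = some (g b')

/-- An isomorphism of crystals: a bijection that preserves `wt`, `ε_i`, `φ_i` and commutes with
all the operators (a strict bijective morphism). -/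
structure CrystalIso {m : ℕ} (B C : CrystalData m) where
  toEquiv : B.carrier ≃ C.carrier
  wt : ∀ b, C.wt (toEquiv b) = B.wt b
  eps : ∀ i b, C.eps i (toEquiv b) = B.eps i b
  phi : ∀ i b, C.phi i (toEquiv b) = B.phi i b
  e : ∀ i b, C.e i (toEquiv b) = (B.e i b).map toEquiv
  f : ∀ i b, C.f i (toEquiv b) = (B.f i b).map toEquiv
  eBar : ∀ b, C.eBar (toEquiv b) = (B.eBar b).map toEquiv
  fBar : ∀ b, C.fBar (toEquiv b) = (B.fBar b).map toEquiv

/-! ### Tensor products and the one-element crystals `T_μ` -/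

noncomputable def tensor {m : ℕ} (B C : CrystalData m) : CrystalData m where
  carrier := B.carrier × C.carrier
  wt p := B.wt p.1 + C.wt p.2
  eps i p := max (C.eps i p.2) (B.eps i p.1 + ((-wtDiff i (C.wt p.2) : ℤ) : WithBot ℤ))
  phi i p := max (B.phi i p.1) (C.phi i p.2 + ((wtDiff i (B.wt p.1) : ℤ) : WithBot ℤ))
  e i p := if C.phi i p.2 < B.eps i p.1 then (B.e i p.1).map (fun b => (b, p.2))
    else (C.e i p.2).map (fun c => (p.1, c))
  f i p := if C.phi i p.2 ≤ B.eps i p.1 then (B.f i p.1).map (fun b => (b, p.2))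
    else (C.f i p.2).map (fun c => (p.1, c))
  eBar p := if B.eBar p.1 = none ∧ B.fBar p.1 = none then (C.eBar p.2).map (fun c => (p.1, c))
    else (B.eBar p.1).map (fun b => (b, p.2))
  fBar p := if B.eBar p.1 = none ∧ B.fBar p.1 = none then (C.fBar p.2).map (fun c => (p.1, c))
    else (B.fBar p.1).map (fun b => (b, p.2))

/-- The crystal `T_μ = {t_μ}`. -/
def tCrystal {m : ℕ} (μ : Weight m) : CrystalData m where
  carrier := Unit
  wt _ := μ
  eps _ _ := ⊥
  phi _ _ := ⊥
  e _ _ := none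
  f _ _ := none
  eBar _ := none
  fBar _ := none

/-! ### Direct limits of crystals -/

/-- A directed system of abstract `q(n)`-crystals on the family `B`. -/
structure CrystalSystem {m : ℕ} {J : Type} [Preorder J] (B : J → CrystalData m) where
  map : ∀ ⦃j k : J⦄, j ≤ k → ((B j).carrier ↪ (B k).carrier)
  isQCrystal : ∀ j, IsQCrystal (B j)
  isEmbedding : ∀ ⦃j k : J⦄ (h : j ≤ k), IsEmbedding (B := B j) (C := B k) (map h)
  map_self : ∀ (j : J) (b : (B j).carrier), map (le_refl j) b = b
  map_map : ∀ ⦃j k l : J⦄ (h : j ≤ k) (h' : k ≤ l) (b : (B j).carrier),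
    map h' (map h b) = map (h.trans h') b

namespace CrystalSystem

variable {m : ℕ} {J : Type} [Preorder J] {B : J → CrystalData m}

instance directedSystem (S : CrystalSystem B) :
    DirectedSystem (fun j => (B j).carrier) (fun _ _ h => S.map h) where
  map_self j := S.map_self j
  map_map _ _ _ h h' b := S.map_map h h' b

variable [IsDirectedOrder J]

/-- The underlying set of the direct limit. -/
def LimitCarrier (S : CrystalSystem B) : Type :=
  DirectLimit (fun j => (B j).carrier) (fun _ _ h => S.map h)

/-- The canonical map `ψ_j : B_j → lim B`. -/
def toLimit (S : CrystalSystem B) (j : J) (b : (B j).carrier) : S.LimitCarrier :=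
  (Quotient.mk _ ⟨j, b⟩ : DirectLimit (fun j => (B j).carrier) (fun _ _ h => S.map h))

/-- A function compatible with the maps of the system extends to the limit. -/
def liftLimit (S : CrystalSystem B) {X : Type} (u : ∀ j, (B j).carrier → X)
    (hu : ∀ ⦃j k : J⦄ (h : j ≤ k) (b : (B j).carrier), u k (S.map h b) = u j b) :
    S.LimitCarrier → X :=
  DirectLimit.lift (F := fun j => (B j).carrier) (fun _ _ h => S.map h) u
    (fun _ _ h b => (hu h b).symm)

open Classical in
/-- The operator induced on the limit: it sends `x` to `ψ_j (op_j b)` if there are `j` and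
`b ∈ B_j` with `ψ_j b = x` and `op_j b ≠ 0`, and to `0` if there are none. -/
noncomputable def limitOp (S : CrystalSystem B)
    (op : ∀ j, (B j).carrier → Option (B j).carrier) (x : S.LimitCarrier) :
    Option S.LimitCarrier :=
  if h : ∃ y : S.LimitCarrier, ∃ (j : J) (b b' : (B j).carrier),
      S.toLimit j b = x ∧ op j b = some b' ∧ S.toLimit j b' = y
  then some h.choose else none

/-- The direct limit of a directed system of crystals. -/
noncomputable def limit (S : CrystalSystem B) : CrystalData m where
  carrier := S.LimitCarrier
  wt := S.liftLimit (fun j => (B j).wt) (fun _ _ h b => (S.isEmbedding h).wt b)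
  eps i := S.liftLimit (fun j => (B j).eps i) (fun _ _ h b => (S.isEmbedding h).eps i b)
  phi i := S.liftLimit (fun j => (B j).phi i) (fun _ _ h b => (S.isEmbedding h).phi i b)
  e i := S.limitOp (fun j => (B j).e i)
  f i := S.limitOp (fun j => (B j).f i)
  eBar := S.limitOp (fun j => (B j).eBar)
  fBar := S.limitOp (fun j => (B j).fBar)

theorem toLimit_map (S : CrystalSystem B) {j k : J} (h : j ≤ k) (b : (B j).carrier) :
    S.toLimit k (S.map h b) = S.toLimit j b :=
  (DirectLimit.eq_of_le (F := fun j => (B j).carrier) (f := fun _ _ h => S.map h)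
    ⟨j, b⟩ k h).symm

/-- The induced operator does not depend on the choice of the representative. -/
theorem limitOp_toLimit (S : CrystalSystem B)
    (op : ∀ j, (B j).carrier → Option (B j).carrier)
    (hop : ∀ ⦃j k : J⦄ (h : j ≤ k) (b b' : (B j).carrier),
      op j b = some b' → op k (S.map h b) = some (S.map h b'))
    (j : J) (b b' : (B j).carrier) (hb : op j b = some b') :
    S.limitOp op (S.toLimit j b) = some (S.toLimit j b') := by
  have hex : ∃ y : S.LimitCarrier, ∃ (k : J) (c c' : (B k).carrier),
      S.toLimit k c = S.toLimit j b ∧ op k c = some c' ∧ S.toLimit k c' = y :=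
    ⟨_, j, b, b', rfl, hb, rfl⟩
  unfold limitOp
  rw [dif_pos hex]
  obtain ⟨k, c, c', h1, h2, h3⟩ := hex.choose_spec
  rw [← h3]
  obtain ⟨l, hk, hj, hl⟩ := Quotient.exact h1
  have h4 := hop hk c c' h2
  have h5 := hop hj b b' hb
  have hl' : S.map hk c = S.map hj b := hl
  rw [hl', h5] at h4
  rw [← S.toLimit_map hk c', ← S.toLimit_map hj b', Option.some.inj h4]

end CrystalSystem

/-! ### Shapes -/

/-- A strict partition with at most `n` parts, `λ_1 ≥ λ_2 ≥ ⋯ ≥ λ_n ≥ 0`, where equal consecutive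
parts are zero.  It stands for the element `-λ_1 ε_1 - ⋯ - λ_n ε_n` of `Λ⁻`. -/
@[ext] structure StrictShape (m : ℕ) where
  parts : Fin (m + 2) → ℕ
  anti : ∀ i : Fin (m + 1), parts i.succ ≤ parts i.castSucc
  strict : ∀ i : Fin (m + 1), parts i.castSucc = parts i.succ → parts i.castSucc = 0

/-- The (componentwise) sum in `Λ⁻`. -/
def StrictShape.add {m : ℕ} (lam mu : StrictShape m) : StrictShape m where
  parts k := lam.parts k + mu.parts k
  anti i := Nat.add_le_add (lam.anti i) (mu.anti i)
  strict i h := by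
    have h1 := lam.anti i
    have h2 := mu.anti i
    have h3 := lam.strict i (by omega)
    have h4 := mu.strict i (by omega)
    omega

/-- `λ ≤ μ` if and only if `μ - λ ∈ Λ⁻`. -/
instance StrictShape.partialOrder {m : ℕ} : PartialOrder (StrictShape m) where
  le lam mu := ∃ nu : StrictShape m, ∀ k, mu.parts k = lam.parts k + nu.parts k
  le_refl lam := ⟨⟨fun _ => 0, fun _ => le_rfl, fun _ _ => rfl⟩, fun _ => rfl⟩
  le_trans := by
    rintro a b c ⟨u, hu⟩ ⟨v, hv⟩
    refine ⟨u.add v, fun k => ?_⟩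
    rw [hv, hu]
    exact Nat.add_assoc _ _ _
  le_antisymm := by
    rintro a b ⟨u, hu⟩ ⟨v, hv⟩
    ext k
    have h1 := hu k
    have h2 := hv k
    omega

instance StrictShape.isDirectedOrder {m : ℕ} : IsDirectedOrder (StrictShape m) where
  directed lam mu := ⟨lam.add mu, ⟨mu, fun _ => rfl⟩, ⟨lam, fun _ => Nat.add_comm _ _⟩⟩

/-! ### Semistandard decomposition tableaux -/

/-- A filling with `n` (possibly empty) rows, listed from top (`0`) to bottom; each row is read
from left to right, and row `k` is shifted `k` units to the right. -/
abbrev Tableau (m : ℕ) : Type := Fin (m + 2) → List (Fin (m + 2))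

/-- Hook words `u_1 ≥ ⋯ ≥ u_k < u_{k+1} < ⋯ < u_N` with `1 ≤ k ≤ N`. -/
def IsHookWord {m : ℕ} (u : List (Fin (m + 2))) : Prop :=
  ∃ k, 1 ≤ k ∧ k ≤ u.length ∧
    (u.take k).Pairwise (fun a b => b ≤ a) ∧ (u.drop (k - 1)).Pairwise (fun a b => a < b)

/-- `T` is a semistandard decomposition tableau whose row `k` has length `λ_{k+1}`: every
(nonempty) row is a hook word, and every row is a hook subword of maximal length in the
concatenation of the (nonempty) row below it and itself. -/
structure IsSDT {m : ℕ} (lam : StrictShape m) (T : Tableau m) : Prop where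
  shape : ∀ k, (T k).length = lam.parts k
  hook : ∀ k, T k ≠ [] → IsHookWord (T k)
  maximal : ∀ i : Fin (m + 1), T i.succ ≠ [] → ∀ w : List (Fin (m + 2)),
    w.Sublist (T i.succ ++ T i.castSucc) → IsHookWord w → w.length ≤ (T i.castSucc).length

/-- A box `(k, j)`: row `k`, `j`-th position of that row, both from `0`. -/
abbrev Box (m : ℕ) : Type := Fin (m + 2) × ℕ

/-- The boxes of `T` with their letters in the order of the reading word: rows from top to bottom,
each from right to left. -/
def reading {m : ℕ} (T : Tableau m) : List (Box m × Fin (m + 2)) :=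
  (List.finRange (m + 2)).flatMap fun k => ((T k).mapIdx fun j x => ((k, j), x)).reverse

/-- One step of the bracketing that removes pairs `(i+1, i)`; the list is a stack of the letters
`i`, `i+1` read so far and not yet removed, the last one first. -/
def bracketStep {m : ℕ} (i : Fin (m + 1)) (st : List (Box m × Fin (m + 2)))
    (p : Box m × Fin (m + 2)) : List (Box m × Fin (m + 2)) :=
  if p.2 = i.succ then p :: st
  else if p.2 = i.castSucc then
    match st with
    | [] => [p]
    | q :: st' => if q.2 = i.succ then st' else p :: q :: st'
  else st

/-- `red_i(T)`: what remains of the subword of letters `i`, `i+1` of the reading word after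
successively removing all pairs `(i+1, i)`, together with the boxes of its letters. -/
def red {m : ℕ} (i : Fin (m + 1)) (T : Tableau m) : List (Box m × Fin (m + 2)) :=
  ((reading T).foldl (bracketStep i) []).reverse

/-- Change the letter of one box. -/
def setBox {m : ℕ} (T : Tableau m) (c : Box m) (x : Fin (m + 2)) : Tableau m :=
  Function.update T c.1 ((T c.1).set c.2 x)

/-- Change the leftmost `i+1` of `red_i(T)` to `i`. -/
def rawE {m : ℕ} (i : Fin (m + 1)) (T : Tableau m) : Option (Tableau m) :=
  ((red i T).find? (fun p => p.2 = i.succ)).map (fun p => setBox T p.1 i.castSucc)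

/-- Change the rightmost `i` of `red_i(T)` to `i+1`. -/
def rawF {m : ℕ} (i : Fin (m + 1)) (T : Tableau m) : Option (Tableau m) :=
  ((red i T).reverse.find? (fun p => p.2 = i.castSucc)).map (fun p => setBox T p.1 i.succ)

/-- The first box of the reading word that contains one of the letters `1`, `2`. -/
def firstOneTwo {m : ℕ} (T : Tableau m) : Option (Box m × Fin (m + 2)) :=
  (reading T).find? (fun p => p.2 = Fin.castSucc 0 ∨ p.2 = Fin.succ 0)

/-- If the first letter among the `1`s and `2`s of the reading word is a `2`, change it to `1`. -/
def rawEBar {m : ℕ} (T : Tableau m) : Option (Tableau m) :=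
  (firstOneTwo T).bind fun p =>
    if p.2 = Fin.succ 0 then some (setBox T p.1 (Fin.castSucc 0)) else none

/-- If the first letter among the `1`s and `2`s of the reading word is a `1`, change it to `2`. -/
def rawFBar {m : ℕ} (T : Tableau m) : Option (Tableau m) :=
  (firstOneTwo T).bind fun p =>
    if p.2 = Fin.castSucc 0 then some (setBox T p.1 (Fin.succ 0)) else none

/-- The content of `T`: the number of boxes with letter `a`, for each `a`. -/
def content {m : ℕ} (T : Tableau m) : Weight m := fun a => ∑ k, ((T k).count a : ℤ)

/-- The number of letters `x` in `red_i(T)`. -/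
def redCount {m : ℕ} (i : Fin (m + 1)) (x : Fin (m + 2)) (T : Tableau m) : ℤ :=
  ((red i T).countP (fun p => p.2 = x) : ℤ)

open Classical in
/-- Regard a filling as an element of a set of tableaux. -/
noncomputable def restrict {m : ℕ} (P : Tableau m → Prop) (o : Option (Tableau m)) :
    Option {T : Tableau m // P T} :=
  o.bind fun T => if h : P T then some ⟨T, h⟩ else none

/-- The crystal `SDT(λ)`. -/
noncomputable def sdt {m : ℕ} (lam : StrictShape m) : CrystalData m where
  carrier := {T : Tableau m // IsSDT lam T}
  wt T := content T.1
  eps i T := (redCount i i.succ T.1 : WithBot ℤ)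
  phi i T := (redCount i i.castSucc T.1 : WithBot ℤ)
  e i T := restrict (IsSDT lam) (rawE i T.1)
  f i T := restrict (IsSDT lam) (rawF i T.1)
  eBar T := restrict (IsSDT lam) (rawEBar T.1)
  fBar T := restrict (IsSDT lam) (rawFBar T.1)

/-- The content `λ_1 ε_n + λ_2 ε_{n-1} + ⋯ + λ_n ε_1` of the lowest weight tableau `L^λ`, whose
top row contains only the letter `n`, the second row only `n - 1`, and so on. -/
def lowestWeight {m : ℕ} (parts : Fin (m + 2) → ℕ) : Weight m := fun a => (parts a.rev : ℤ)

/-- The crystal `SDT(λ) ⊗ T_{-λ}`, where `-λ` is the weight that gives the lowest weight element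
`L^λ ⊗ t_{-λ}` weight zero. -/
noncomputable def shiftedSDT {m : ℕ} (lam : StrictShape m) : CrystalData m :=
  tensor (sdt lam) (tCrystal (-lowestWeight lam.parts))

/-- `T ⊗ t_{-λ}`. -/
def mkShifted {m : ℕ} {lam : StrictShape m} (T : Tableau m) (h : IsSDT lam T) :
    (shiftedSDT lam).carrier :=
  ((⟨T, h⟩, ()) : {T : Tableau m // IsSDT lam T} × Unit)

/-- The tableau `T` of an element `T ⊗ t_{-λ}`. -/
def tableauOf {m : ℕ} {lam : StrictShape m} (b : (shiftedSDT lam).carrier) : Tableau m :=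
  (show {T : Tableau m // IsSDT lam T} × Unit from b).1.1

/-- Enlarging the shape from `λ` to `μ`: on the left of the first row add boxes `n`, of the second
row boxes `n - 1`, and so on. -/
def enlarge {m : ℕ} (lam mu : StrictShape m) (T : Tableau m) : Tableau m :=
  fun k => List.replicate (mu.parts k - lam.parts k) k.rev ++ T k

/-! ### Dual marginally large tableaux -/

/-- The number of boxes in the row below row `k` (zero below the last row). -/
def lengthBelow {m : ℕ} (T : Tableau m) (k : Fin (m + 2)) : ℕ :=
  if h : k.val + 1 < m + 2 then (T ⟨k.val + 1, h⟩).length else 0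

/-- All `n` rows are nonempty, and the number of leftmost boxes in a row that contain the letter
of that row (`n` in the first row, …, `1` in the last) exceeds the length of the next row
by exactly one. -/
def IsDualMarginallyLarge {m : ℕ} (T : Tableau m) : Prop :=
  (∀ k, T k ≠ []) ∧
  ∀ k, ((T k).takeWhile (fun x => x = k.rev)).length = lengthBelow T k + 1

/-- Membership in `SDT(-∞)`. -/
def InSDTInf {m : ℕ} (T : Tableau m) : Prop :=
  (∃ lam : StrictShape m, IsSDT lam T) ∧ IsDualMarginallyLarge T

/-- Push in a trivial column of height `h`: for `1 ≤ k ≤ h` add a box `n - k + 1` on the left of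
the `k`-th row. -/
def pushIn {m : ℕ} (h : ℕ) (T : Tableau m) : Tableau m :=
  fun k => if k.val < h then k.rev :: T k else T k

/-- Push out a trivial column of height `h`: for `1 ≤ k ≤ h` remove a box `n - k + 1` on the left
of the `k`-th row. -/
def pushOut {m : ℕ} (h : ℕ) (T : Tableau m) : Tableau m :=
  fun k => if k.val < h then (T k).tail else T k

/-- The height `n - i` of the trivial column whose last letter is `i + 1`. -/
def columnHeight {m : ℕ} (i : Fin (m + 1)) : ℕ := m + 1 - i.val

open Classical in
noncomputable def fixE {m : ℕ} (i : Fin (m + 1)) (T : Tableau m) : Tableau m :=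
  if IsDualMarginallyLarge T then T else pushIn (columnHeight i) T

open Classical in
noncomputable def fixF {m : ℕ} (i : Fin (m + 1)) (T : Tableau m) : Tableau m :=
  if IsDualMarginallyLarge T then T else pushOut (columnHeight i) T

/-! The modified operators. -/

noncomputable def infE {m : ℕ} (i : Fin (m + 1)) (T : Tableau m) : Option (Tableau m) :=
  (rawE i T).map (fixE i)

noncomputable def infF {m : ℕ} (i : Fin (m + 1)) (T : Tableau m) : Option (Tableau m) :=
  (rawF i T).map (fixF i)

noncomputable def infEBar {m : ℕ} (T : Tableau m) : Option (Tableau m) :=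
  (rawEBar T).map (fixE 0)

noncomputable def infFBar {m : ℕ} (T : Tableau m) : Option (Tableau m) :=
  (rawFBar T).map (fixF 0)

/-- The weight in `SDT(-∞)`: the content of `T` minus that of the lowest weight tableau of the
same shape. -/
def infWt {m : ℕ} (T : Tableau m) : Weight m :=
  content T - lowestWeight (fun k => (T k).length)

/-- The crystal `SDT(-∞)`: `wt`, `ε_i`, `φ_i` of `T` are those of `T ⊗ t_{-λ}` in
`SDT(λ) ⊗ T_{-λ}`, where `λ` is the shape of `T`. -/
noncomputable def sdtInf (m : ℕ) : CrystalData m where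
  carrier := {T : Tableau m // InSDTInf T}
  wt T := infWt T.1
  eps i T := ((redCount i i.succ T.1 + wtDiff i (lowestWeight (fun k => (T.1 k).length)) : ℤ) :
    WithBot ℤ)
  phi i T := (redCount i i.castSucc T.1 : WithBot ℤ)
  e i T := restrict InSDTInf (infE i T.1)
  f i T := restrict InSDTInf (infF i T.1)
  eBar T := restrict InSDTInf (infEBar T.1)
  fBar T := restrict InSDTInf (infFBar T.1)

/-- The set `P` of tableaux is stable under the (partially defined) operator `op`. -/
def StableUnder {m : ℕ} (P : Tableau m → Prop) (op : Tableau m → Option (Tableau m)) : Prop :=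
  ∀ T T', P T → op T = some T' → P T'

end QueerCrystal

/-! Signatures. Read a word as a lattice path in which a letter i is a step +1 and a letter i+1 a
step -1. For the reading word, the maximum of the path (`height`) is φ_i and its end point (`total`)
is wt_i of the content. The operator f_i changes the step by which the path first reaches its
maximum, and e_i the step by which it leaves the maximum for the last time. Both positions are
described by the same two conditions: the word before the letter has height equal to total, and the
word after it has height 0. Hence e_i and f_i are mutually inverse. The first condition passes to
suffixes and the second to prefixes, so on every factor of the reading word f_i acts either as f_i
or as the identity.

Stability. A reversed hook word is a strictly decreasing word followed by a weakly increasing one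
(`IsValley`). By the two conditions, f_i preserves the lengths available to weakly increasing and to
strictly decreasing subwords (`Raises.exists_sorted`, `Raises.exists_strictAnti`), hence the lengths
of valleys. Rows, and pairs of consecutive rows, are factors of the reading word, so the tableau
conditions survive (`IsSDT.of_letters`). The odd operators change the first letter 1 or 2, and
valleys through that letter are easily repaired.

Cores. The first letters of the rows strictly decrease from top to bottom and dominate the rows
below, so row k only contains letters up to n+1-k. Remove from every row its initial run of the
letter n+1-k; what remains is the `core`. Shape and core determine the tableau, and enlarging the
shape changes the shape but not the core. Therefore two elements have the same class in the direct
limit exactly when their cores agree (`toLimit_eq_iff`). Each core belongs to exactly one dual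
marginally large tableau, because that condition computes the row lengths from the core, beginning
with the last row (`IsDualMarginallyLarge.eq_of_core`). This gives the bijection.

Operators. The letters i in the row of i are at most as many as the initial letters i+1 in the row
above (`IsSDT.count_le_run`), and are cancelled by them. So φ_i depends on the core alone, f_i acts
in the row of i+1 or higher, and enlarging commutes with the operators wherever they do not vanish.
An operator changes the length of the core by at most one, and only in the row of i+1
(`IsMove.length_core`); pushing a trivial column in or out restores marginality without touching the
core. It remains to see that an operator vanishing on the dual marginally large tableau vanishes on
every representative. For e_i the case is void; for f_i it follows from the invariance of φ_i; in
the odd case exactly one of the two operators is nonzero on a dual marginally large tableau, and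
this persists under enlargement.

The crystal axioms are checked on each SDT(λ) ⊗ T_{-λ}, pass to the limit, and are carried back
along the isomorphism. -/

namespace QueerCrystal

variable {m : ℕ}

/-! ### Signatures of words -/

/-- The contribution of a letter to the `i`-signature: `i ↦ 1`, `i + 1 ↦ -1`. -/
def sgn (i : Fin (m + 1)) (x : Fin (m + 2)) : ℤ :=
  if x = i.castSucc then 1 else if x = i.succ then -1 else 0

/-- The sum of the signature. -/
def total (i : Fin (m + 1)) (w : List (Fin (m + 2))) : ℤ := (w.map (sgn i)).sum

/-- The maximum of the partial sums of the signature over all prefixes. -/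
def height (i : Fin (m + 1)) : List (Fin (m + 2)) → ℤ
  | [] => 0
  | x :: w => max 0 (sgn i x + height i w)

theorem succ_ne_castSucc (i : Fin (m + 1)) : i.succ ≠ i.castSucc :=
  (Fin.castSucc_lt_succ (i := i)).ne'

@[simp] theorem sgn_castSucc (i : Fin (m + 1)) : sgn i i.castSucc = 1 := by simp [sgn]

@[simp] theorem sgn_succ (i : Fin (m + 1)) : sgn i i.succ = -1 := by
  simp [sgn, succ_ne_castSucc]

theorem sgn_eq_zero {i : Fin (m + 1)} {x : Fin (m + 2)} (h : x ≠ i.castSucc) (h' : x ≠ i.succ) :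
    sgn i x = 0 := by simp [sgn, h, h']

theorem sgn_cases (i : Fin (m + 1)) (x : Fin (m + 2)) :
    (x = i.castSucc ∧ sgn i x = 1) ∨ (x = i.succ ∧ sgn i x = -1) ∨
      (x ≠ i.castSucc ∧ x ≠ i.succ ∧ sgn i x = 0) := by
  by_cases h : x = i.castSucc
  · simp [h]
  by_cases h' : x = i.succ
  · simp [h']
  exact Or.inr (Or.inr ⟨h, h', sgn_eq_zero h h'⟩)

section Height

variable (i : Fin (m + 1))

@[simp] theorem total_nil : total i [] = 0 := rfl

@[simp] theorem total_cons (x : Fin (m + 2)) (w) : total i (x :: w) = sgn i x + total i w := by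
  simp [total]

@[simp] theorem total_append (a b) : total i (a ++ b) = total i a + total i b := by
  simp [total]

@[simp] theorem total_reverse (a) : total i a.reverse = total i a := by
  simp [total, List.sum_reverse]

@[simp] theorem height_nil : height i [] = 0 := rfl

theorem height_cons (x : Fin (m + 2)) (w) :
    height i (x :: w) = max 0 (sgn i x + height i w) := rfl

theorem height_nonneg (w) : 0 ≤ height i w := by
  cases w with
  | nil => exact le_rfl
  | cons x w => exact le_max_left _ _

theorem total_le_height (w) : total i w ≤ height i w := by
  induction w with
  | nil => exact le_rfl
  | cons x w ih => rw [total_cons, height_cons]; exact le_max_of_le_right (by linarith)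

/-- A partial sum of the concatenation ends either inside the first word or inside the second, in
which case the whole first word contributes. -/
theorem height_append (a b) :
    height i (a ++ b) = max (height i a) (total i a + height i b) := by
  induction a with
  | nil => simp [height_nonneg]
  | cons x a ih =>
    rw [List.cons_append, height_cons, ih, height_cons, total_cons]
    have := height_nonneg i a
    have := height_nonneg i b
    omega

theorem height_replicate_succ_append (q : ℕ) (w) :
    height i (List.replicate q i.succ ++ w) = max 0 (height i w - q) := by
  induction q with
  | zero => simp [height_nonneg]
  | succ q ih =>
    rw [List.replicate_succ, List.cons_append, height_cons, ih, sgn_succ]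
    push_cast
    omega

theorem height_le_count (w : List (Fin (m + 2))) : height i w ≤ w.count i.castSucc := by
  induction w with
  | nil => simp
  | cons x w ih =>
    rw [height_cons]
    rcases sgn_cases i x with ⟨h, h'⟩ | ⟨h, h'⟩ | ⟨h, -, h'⟩
    · rw [h', h, List.count_cons_self]; push_cast; omega
    · rw [h', h, List.count_cons_of_ne (succ_ne_castSucc i)]; omega
    · rw [h', List.count_cons_of_ne h]; omega

theorem total_eq_count (w : List (Fin (m + 2))) :
    total i w = w.count i.castSucc - w.count i.succ := by
  induction w with
  | nil => simp
  | cons x w ih =>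
    rw [total_cons, ih]
    rcases sgn_cases i x with ⟨h, h'⟩ | ⟨h, h'⟩ | ⟨h, h2, h'⟩
    · rw [h', h, List.count_cons_self, List.count_cons_of_ne (succ_ne_castSucc i).symm]
      push_cast; ring
    · rw [h', h, List.count_cons_self, List.count_cons_of_ne (succ_ne_castSucc i)]
      push_cast; ring
    · rw [h', List.count_cons_of_ne h, List.count_cons_of_ne h2]; ring

theorem height_eq_zero_of_sgn {w : List (Fin (m + 2))} (h : ∀ x ∈ w, sgn i x = 0) :
    height i w = 0 := by
  induction w with
  | nil => rfl
  | cons x w ih =>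
    rw [height_cons, h x (by simp), ih fun y hy => h y (by simp [hy])]; simp

theorem total_eq_zero_of_sgn {w : List (Fin (m + 2))} (h : ∀ x ∈ w, sgn i x = 0) :
    total i w = 0 := by
  induction w with
  | nil => rfl
  | cons x w ih =>
    rw [total_cons, h x (by simp), ih fun y hy => h y (by simp [hy])]; simp

variable {i}

/-- Height equal to total means that the path ends at its maximum, that is, every i+1 is cancelled
by a later i. This is inherited by suffixes; the dual condition, height 0, is inherited by prefixes.
-/
theorem height_eq_total_of_append {a b : List (Fin (m + 2))}
    (h : height i (a ++ b) = total i (a ++ b)) : height i b = total i b := by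
  rw [height_append, total_append] at h
  have := total_le_height i b
  omega

theorem height_eq_zero_of_append {a b : List (Fin (m + 2))} (h : height i (a ++ b) = 0) :
    height i a = 0 := by
  rw [height_append] at h
  have := height_nonneg i a
  omega

/-- The letter is the step at which the path first reaches its maximum, that is, the rightmost
uncancelled i. The labelling `g` lets the words carry boxes along with their letters. -/
theorem exists_raisable {β : Type*} (g : β → Fin (m + 2)) (w : List β) :
    height i (w.map g) = 0 ∨ ∃ a x b, w = a ++ x :: b ∧ g x = i.castSucc ∧
      height i (a.map g) = total i (a.map g) ∧ height i (b.map g) = 0 := by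
  induction w with
  | nil => exact Or.inl rfl
  | cons y w ih =>
    rcases ih with h | ⟨a, x, b, rfl, hx, ha, hb⟩
    · rcases sgn_cases i (g y) with ⟨h1, h2⟩ | ⟨h1, h2⟩ | ⟨h1, h3, h2⟩
      · exact Or.inr ⟨[], y, w, rfl, h1, rfl, h⟩
      · left; rw [List.map_cons, height_cons, h, h2]; simp
      · left; rw [List.map_cons, height_cons, h, h2]; simp
    · have h0 := height_nonneg i (a.map g)
      -- If this fails, y is an i+1 and a has total 0; then y cancels x and no uncancelled i
      -- remains.
      by_cases hs : 0 ≤ sgn i (g y) + total i (a.map g)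
      · refine Or.inr ⟨y :: a, x, b, rfl, hx, ?_, hb⟩
        rw [List.map_cons, height_cons, total_cons, ha]; omega
      · left
        have : -1 ≤ sgn i (g y) := by rcases sgn_cases i (g y) with h | h | h <;> omega
        rw [List.map_cons, height_cons, List.map_append, height_append, List.map_cons,
          height_cons, hb, hx, sgn_castSucc]
        omega

/-- The letter is the step at which the path leaves its maximum for the last time, that is, the
leftmost uncancelled i+1. The conditions on both sides are those of `exists_raisable`, which is what
makes e_i and f_i inverse to each other. -/
theorem exists_lowerable {β : Type*} (g : β → Fin (m + 2)) (w : List β) :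
    height i (w.map g) = total i (w.map g) ∨ ∃ a x b, w = a ++ x :: b ∧ g x = i.succ ∧
      height i (a.map g) = total i (a.map g) ∧ height i (b.map g) = 0 := by
  induction w with
  | nil => exact Or.inl rfl
  | cons y w ih =>
    have hy := sgn_cases i (g y)
    rcases ih with h | ⟨a, x, b, rfl, hx, ha, hb⟩
    · have h0 := height_nonneg i (w.map g)
      by_cases hs : 0 ≤ sgn i (g y) + total i (w.map g)
      · left
        rw [List.map_cons, height_cons, total_cons, h]; omega
      · refine Or.inr ⟨[], y, w, rfl, ?_, rfl, ?_⟩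
        · rcases hy with h | h | h
          · omega
          · exact h.1
          · omega
        · omega
    · have h0 := height_nonneg i (a.map g)
      right
      by_cases hs : 0 ≤ sgn i (g y) + total i (a.map g)
      · refine ⟨y :: a, x, b, rfl, hx, ?_, hb⟩
        rw [List.map_cons, height_cons, total_cons, ha]; omega
      · refine ⟨[], y, a ++ x :: b, rfl, ?_, rfl, ?_⟩
        · rcases hy with h | h | h
          · omega
          · exact h.1
          · omega
        · rw [List.map_append, height_append, List.map_cons, height_cons, hb, hx, sgn_succ]
          omega

end Height

/-! ### Changing one letter of a word -/

/-- `w'` arises from `w` by changing one letter `x` to `y`, where the part of `w` before this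
letter satisfies `P` and the part after it satisfies `Q`. -/
def ChangesTo {A : Type*} (P Q : List A → Prop) (x y : A) (w w' : List A) : Prop :=
  ∃ a b, w = a ++ x :: b ∧ w' = a ++ y :: b ∧ P a ∧ Q b

/-- The changed letter lies in one of the two factors. If it lies in the second, the part before it
loses a prefix, which `P` must tolerate; if it lies in the first, the part after it loses a suffix,
which `Q` must tolerate. -/
theorem ChangesTo.append {A : Type*} {P Q : List A → Prop} {x y : A} {u v u' v' : List A}
    (hP : ∀ a b, P (a ++ b) → P b) (hQ : ∀ a b, Q (a ++ b) → Q a)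
    (h : ChangesTo P Q x y (u ++ v) (u' ++ v')) (hl : u.length = u'.length) :
    (ChangesTo P Q x y u u' ∧ v = v') ∨ (u = u' ∧ ChangesTo P Q x y v v') := by
  obtain ⟨a, b, h1, h2, ha, hb⟩ := h
  rcases List.append_eq_append_iff.1 h1 with ⟨c, rfl, rfl⟩ | ⟨c, rfl, hc⟩
  · rw [List.append_assoc] at h2
    obtain ⟨rfl, rfl⟩ := List.append_inj h2 hl.symm
    exact Or.inr ⟨rfl, c, b, rfl, rfl, hP _ _ ha, hb⟩
  · cases c with
    | nil =>
      simp only [List.append_nil, List.nil_append] at hl hc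
      subst hc
      obtain ⟨rfl, rfl⟩ := List.append_inj h2 hl.symm
      exact Or.inr ⟨by simp, [], b, rfl, rfl, hP u' [] (by simpa using ha), hb⟩
    | cons z c =>
      obtain ⟨rfl, rfl⟩ : x = z ∧ b = c ++ v := by simpa using hc
      have h3 : u' ++ v' = (a ++ y :: c) ++ v := by simpa using h2
      obtain ⟨rfl, rfl⟩ := List.append_inj h3 (by simpa using hl.symm)
      exact Or.inl ⟨⟨a, c, rfl, rfl, ha, hQ _ _ hb⟩, rfl⟩

/-- The relation `w' = f_i w` between words. -/
def Raises (i : Fin (m + 1)) : List (Fin (m + 2)) → List (Fin (m + 2)) → Prop :=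
  ChangesTo (fun a => height i a = total i a) (fun b => height i b = 0) i.castSucc i.succ

/-- A word without the letters `1` and `2`. -/
def NoOneTwo (a : List (Fin (m + 2))) : Prop :=
  ∀ x ∈ a, x ≠ Fin.castSucc 0 ∧ x ≠ Fin.succ 0

/-- The relation `w' = f_{\bar 1} w` between words. -/
def BarRaises : List (Fin (m + 2)) → List (Fin (m + 2)) → Prop :=
  ChangesTo NoOneTwo (fun _ => True) (Fin.castSucc 0) (Fin.succ 0)

/-- A relation between words that restricts to corresponding factors of the words. -/
def RestrictsToFactors {A : Type*} (R : List A → List A → Prop) : Prop :=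
  ∀ u v u' v' : List A, u.length = u'.length → R (u ++ v) (u' ++ v') →
    (R u u' ∨ u = u') ∧ (R v v' ∨ v = v')

theorem ChangesTo.restrictsToFactors {A : Type*} {P Q : List A → Prop} {x y : A}
    (hP : ∀ a b, P (a ++ b) → P b) (hQ : ∀ a b, Q (a ++ b) → Q a) :
    RestrictsToFactors (ChangesTo P Q x y) := by
  intro u v u' v' hl h
  rcases h.append hP hQ hl with ⟨h1, h2⟩ | ⟨h1, h2⟩
  · exact ⟨Or.inl h1, Or.inr h2⟩
  · exact ⟨Or.inr h1, Or.inl h2⟩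

theorem RestrictsToFactors.swap {A : Type*} {R : List A → List A → Prop}
    (h : RestrictsToFactors R) : RestrictsToFactors fun w w' => R w' w := by
  intro u v u' v' hl hR
  have := h u' v' u v hl.symm hR
  exact ⟨this.1.imp_right Eq.symm, this.2.imp_right Eq.symm⟩

theorem raises_restrictsToFactors (i : Fin (m + 1)) : RestrictsToFactors (Raises i) :=
  ChangesTo.restrictsToFactors (fun _ _ => height_eq_total_of_append)
    (fun _ _ => height_eq_zero_of_append)

theorem barRaises_restrictsToFactors : RestrictsToFactors (BarRaises (m := m)) :=
  ChangesTo.restrictsToFactors (fun _ _ h x hx => h x (by simp [hx])) (fun _ _ _ => trivial)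

/-! ### Hook subwords -/

/-- The reversal of a hook word (or the empty word): a strictly decreasing word followed by a
weakly increasing one. -/
def IsValley (u : List (Fin (m + 2))) : Prop :=
  ∃ p q, u = p ++ q ∧ p.Pairwise (fun a b => b < a) ∧ q.Pairwise (fun a b => a ≤ b)

theorem isHookWord_of_pairwise {a b : List (Fin (m + 2))} {x : Fin (m + 2)}
    (h1 : (a ++ [x]).Pairwise (fun a b => b ≤ a)) (h2 : (x :: b).Pairwise (fun a b => a < b)) :
    IsHookWord (a ++ x :: b) := by
  refine ⟨a.length + 1, by omega, by simp, ?_, ?_⟩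
  · have : (a ++ x :: b).take (a.length + 1) = a ++ [x] := by
      rw [List.append_cons, List.take_left' (by simp)]
    rwa [this]
  · rw [Nat.add_sub_cancel, List.drop_left' rfl]
    exact h2

/-- In the definition of a hook word the two monotone parts share the minimal letter. Comparing the
last letter of `a` with the first of `b` shows which of the two can be shared, so the overlap may be
dropped. -/
theorem isHookWord_append {a b : List (Fin (m + 2))} (h0 : a ++ b ≠ [])
    (ha : a.Pairwise (fun a b => b ≤ a)) (hb : b.Pairwise (fun a b => a < b)) :
    IsHookWord (a ++ b) := by
  rcases b with - | ⟨y, b⟩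
  · rcases a.eq_nil_or_concat' with rfl | ⟨a, x, rfl⟩
    · exact absurd rfl h0
    · simpa using isHookWord_of_pairwise ha (List.pairwise_singleton _ x)
  · rcases a.eq_nil_or_concat' with rfl | ⟨a, x, rfl⟩
    · exact isHookWord_of_pairwise (a := []) (by simp) hb
    · rcases lt_or_ge x y with hxy | hxy
      · rw [List.append_assoc]
        refine isHookWord_of_pairwise (b := y :: b) ha ?_
        rw [List.pairwise_cons]
        refine ⟨fun z hz => ?_, hb⟩
        rcases List.mem_cons.1 hz with rfl | hz
        · exact hxy
        · exact hxy.trans ((List.pairwise_cons.1 hb).1 z hz)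
      · refine isHookWord_of_pairwise ?_ hb
        rw [List.pairwise_append]
        refine ⟨ha, by simp, fun z hz z' hz' => ?_⟩
        obtain rfl : z' = y := by simpa using hz'
        rcases List.mem_append.1 hz with hz | hz
        · exact hxy.trans ((List.pairwise_append.1 ha).2.2 z hz x (by simp))
        · obtain rfl : z = x := by simpa using hz
          exact hxy

theorem isHookWord_iff (u : List (Fin (m + 2))) :
    IsHookWord u ↔ u ≠ [] ∧ IsValley u.reverse := by
  constructor
  · rintro ⟨k, hk, hku, h1, h2⟩
    refine ⟨by rintro rfl; simp at hku; omega, (u.drop k).reverse, (u.take k).reverse, ?_, ?_, ?_⟩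
    · rw [← List.reverse_append, List.take_append_drop]
    · rw [List.pairwise_reverse]
      refine List.Pairwise.sublist ?_ h2
      have : k = (k - 1) + 1 := by omega
      conv_lhs => rw [this, ← List.drop_drop]
      exact List.drop_sublist _ _
    · rw [List.pairwise_reverse]; exact h1
  · rintro ⟨h0, p, q, hu, hp, hq⟩
    have hu' : u = q.reverse ++ p.reverse := by rw [← List.reverse_append, ← hu]; simp
    subst hu'
    exact isHookWord_append h0 (List.pairwise_reverse.2 hq) (List.pairwise_reverse.2 hp)

theorem IsValley.sublist {u v : List (Fin (m + 2))} (h : IsValley v) (huv : u.Sublist v) :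
    IsValley u := by
  obtain ⟨p, q, rfl, hp, hq⟩ := h
  obtain ⟨p', q', rfl, h1, h2⟩ := List.sublist_append_iff.1 huv
  exact ⟨p', q', rfl, hp.sublist h1, hq.sublist h2⟩

theorem IsHookWord.sublist {u v : List (Fin (m + 2))} (h : IsHookWord v) (huv : u.Sublist v)
    (hu : u ≠ []) : IsHookWord u :=
  (isHookWord_iff u).2 ⟨hu, ((isHookWord_iff v).1 h).2.sublist (List.reverse_sublist.2 huv)⟩

/-- A subword that avoids the distinguished letter survives any change of it, so only subwords
passing through that letter need repair. -/
theorem sublist_append_cons_cases {A : Type*} {u a b : List A} {x : A}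
    (h : u.Sublist (a ++ x :: b)) :
    (∀ y, u.Sublist (a ++ y :: b)) ∨
      ∃ c d, u = c ++ x :: d ∧ c.Sublist a ∧ d.Sublist b := by
  obtain ⟨c, d, rfl, hc, hd⟩ := List.sublist_append_iff.1 h
  rcases List.sublist_cons_iff.1 hd with hd | ⟨r, rfl, hr⟩
  · exact Or.inl fun y => hc.append (hd.cons y)
  · exact Or.inr ⟨c, r, rfl, hc, hr⟩

theorem pairwise_le_eq_filter_append {A : Type*} [LinearOrder A] (t : A) :
    ∀ {q : List A}, q.Pairwise (fun a b => a ≤ b) →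
      q = q.filter (fun z => z ≤ t) ++ q.filter (fun z => t < z)
  | [], _ => rfl
  | x :: q, h => by
    rw [List.pairwise_cons] at h
    have ih := pairwise_le_eq_filter_append t h.2
    by_cases hx : x ≤ t
    · rw [List.filter_cons_of_pos (by simpa using hx),
        List.filter_cons_of_neg (by simpa using hx), List.cons_append, ← ih]
    · have hx' := not_le.1 hx
      have : q.filter (fun z => z ≤ t) = [] := by
        rw [List.filter_eq_nil_iff]
        intro z hz
        simpa using hx'.trans_le (h.1 z hz)
      rw [List.filter_cons_of_neg (by simpa using hx), this,
        List.filter_cons_of_pos (by simpa using hx), List.nil_append]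
      rw [this, List.nil_append] at ih
      rw [← ih]

theorem castSucc_lt_iff_succ_le {i : Fin (m + 1)} {x : Fin (m + 2)} :
    i.castSucc < x ↔ i.succ ≤ x := by
  rw [Fin.lt_def, Fin.le_def]; simp

theorem lt_succ_iff_le_castSucc {i : Fin (m + 1)} {x : Fin (m + 2)} :
    x < i.succ ↔ x ≤ i.castSucc := by
  rw [Fin.lt_def, Fin.le_def]; simp

/-- Suppose the subword passes through the changed letter. Going forward, its remaining letters i
lie in a prefix of the part after that letter, where i+1 occurs at least as often as i; trade them
for letters i+1. Going back, its earlier letters i+1 lie in a suffix of the part before, where i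
occurs at least as often as i+1. -/
theorem Raises.exists_sorted {i : Fin (m + 1)} {w w' q : List (Fin (m + 2))}
    (h : Raises i w w') (hq : q.Pairwise (fun a b => a ≤ b)) :
    (q.Sublist w → ∃ q' : List (Fin (m + 2)), q'.Sublist w' ∧ q'.Pairwise (fun a b => a ≤ b) ∧
      q'.length = q.length) ∧
    (q.Sublist w' → ∃ q' : List (Fin (m + 2)), q'.Sublist w ∧ q'.Pairwise (fun a b => a ≤ b) ∧
      q'.length = q.length) := by
  obtain ⟨a, b, rfl, rfl, ha, hb⟩ := h
  have hi : i.castSucc < i.succ := Fin.castSucc_lt_succ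
  constructor
  · intro hs
    rcases sublist_append_cons_cases hs with hs | ⟨c, d, rfl, hc, hd⟩
    · exact ⟨q, hs _, hq, rfl⟩
    rw [List.pairwise_append, List.pairwise_cons] at hq
    obtain ⟨hqc, ⟨hd1, hqd⟩, hcd⟩ := hq
    have hsplit := pairwise_le_eq_filter_append i.castSucc hqd
    set d1 := d.filter (fun z => z ≤ i.castSucc) with hd1def
    set d2 := d.filter (fun z => i.castSucc < z) with hd2def
    have hrep : d1 = List.replicate d1.length i.castSucc := by
      rw [List.eq_replicate_iff]
      refine ⟨rfl, fun z hz => ?_⟩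
      rw [hd1def, List.mem_filter] at hz
      exact le_antisymm (by simpa using hz.2) (hd1 z hz.1)
    rw [hsplit] at hd
    obtain ⟨b1, b2, rfl, hb1, hb2⟩ := List.append_sublist_iff.1 hd
    -- The prefix b1 has height 0, so its total is at most 0: it has no fewer letters i+1 than i.
    have hb3 := total_le_height i b1
    rw [height_eq_zero_of_append hb, total_eq_count] at hb3
    have hcount : d1.length ≤ b1.count i.castSucc := by
      rw [← List.replicate_sublist_iff, ← hrep]; exact hb1
    refine ⟨c ++ i.succ :: (List.replicate d1.length i.succ ++ d2), ?_, ?_, ?_⟩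
    · refine hc.append (List.Sublist.cons_cons _ (List.Sublist.append ?_ hb2))
      rw [List.replicate_sublist_iff]; omega
    · have hd2 : ∀ z ∈ d2, i.succ ≤ z := fun z hz => by
        rw [hd2def, List.mem_filter] at hz
        exact castSucc_lt_iff_succ_le.1 (by simpa using hz.2)
      have hc1 : ∀ z ∈ c, z ≤ i.succ := fun z hz =>
        (hcd z hz _ (by simp)).trans hi.le
      have hd2' : d2.Pairwise (fun a b => a ≤ b) := hqd.sublist List.filter_sublist
      rw [← List.cons_append, ← List.replicate_succ, List.pairwise_append, List.pairwise_append]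
      refine ⟨hqc, ⟨List.pairwise_replicate.2 (Or.inr le_rfl), hd2', ?_⟩, ?_⟩
      · intro z hz z' hz'
        rw [List.eq_of_mem_replicate hz]; exact hd2 z' hz'
      · intro z hz z' hz'
        rcases List.mem_append.1 hz' with hz' | hz'
        · rw [List.eq_of_mem_replicate hz']; exact hc1 z hz
        · exact (hc1 z hz).trans (hd2 z' hz')
    · have := congrArg List.length hsplit
      simp only [List.length_append] at this
      simp; omega
  · intro hs
    rcases sublist_append_cons_cases hs with hs | ⟨c, d, rfl, hc, hd⟩
    · exact ⟨q, hs _, hq, rfl⟩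
    rw [List.pairwise_append, List.pairwise_cons] at hq
    obtain ⟨hqc, ⟨hd1, hqd⟩, hcd⟩ := hq
    have hsplit := pairwise_le_eq_filter_append i.castSucc hqc
    set c1 := c.filter (fun z => z ≤ i.castSucc) with hc1def
    set c2 := c.filter (fun z => i.castSucc < z) with hc2def
    have hrep : c2 = List.replicate c2.length i.succ := by
      rw [List.eq_replicate_iff]
      refine ⟨rfl, fun z hz => ?_⟩
      rw [hc2def, List.mem_filter] at hz
      exact le_antisymm (hcd z hz.1 _ (by simp))
        (castSucc_lt_iff_succ_le.1 (by simpa using hz.2))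
    rw [hsplit] at hc
    obtain ⟨a1, a2, rfl, ha1, ha2⟩ := List.append_sublist_iff.1 hc
    -- The suffix a2 has total equal to its height, hence nonnegative: it has no fewer letters i
    -- than i+1.
    have ha3 := height_nonneg i a2
    rw [height_eq_total_of_append ha, total_eq_count] at ha3
    have hcount : c2.length ≤ a2.count i.succ := by
      rw [← List.replicate_sublist_iff, ← hrep]; exact ha2
    refine ⟨(c1 ++ List.replicate c2.length i.castSucc) ++ i.castSucc :: d, ?_, ?_, ?_⟩
    · refine List.Sublist.append (List.Sublist.append ha1 ?_) (List.Sublist.cons_cons _ hd)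
      rw [List.replicate_sublist_iff]; omega
    · have hc1 : ∀ z ∈ c1, z ≤ i.castSucc := fun z hz => by
        rw [hc1def, List.mem_filter] at hz
        simpa using hz.2
      have hd2 : ∀ z ∈ d, i.castSucc ≤ z := fun z hz => hi.le.trans (hd1 z hz)
      have hc1' : c1.Pairwise (fun a b => a ≤ b) := hqc.sublist List.filter_sublist
      rw [List.append_assoc, List.append_cons, ← List.append_assoc, ← List.replicate_succ',
        List.append_assoc, List.pairwise_append, List.pairwise_append]
      refine ⟨hc1', ⟨List.pairwise_replicate.2 (Or.inr le_rfl), hqd, ?_⟩, ?_⟩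
      · intro z hz z' hz'
        rw [List.eq_of_mem_replicate hz]; exact hd2 z' hz'
      · intro z hz z' hz'
        rcases List.mem_append.1 hz' with hz' | hz'
        · rw [List.eq_of_mem_replicate hz']; exact hc1 z hz
        · exact (hc1 z hz).trans (hd2 z' hz')
    · have := congrArg List.length hsplit
      simp only [List.length_append] at this
      simp; omega

/-- The change can be made in the subword itself unless the subword also uses the other letter of
the pair i, i+1, which is then adjacent to the changed one. In that case the same subword is found
elsewhere: between the two positions the signature conditions force another copy of the letter that
was lost. -/
theorem Raises.exists_strictAnti {i : Fin (m + 1)} {w w' q : List (Fin (m + 2))}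
    (h : Raises i w w') (hq : q.Pairwise (fun a b => b < a)) :
    (q.Sublist w → ∃ q' : List (Fin (m + 2)), q'.Sublist w' ∧ q'.Pairwise (fun a b => b < a) ∧
      q'.length = q.length) ∧
    (q.Sublist w' → ∃ q' : List (Fin (m + 2)), q'.Sublist w ∧ q'.Pairwise (fun a b => b < a) ∧
      q'.length = q.length) := by
  obtain ⟨a, b, rfl, rfl, ha, hb⟩ := h
  have hi : i.castSucc < i.succ := Fin.castSucc_lt_succ
  constructor
  · intro hs
    rcases sublist_append_cons_cases hs with hs | ⟨c, d, rfl, hc, hd⟩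
    · exact ⟨q, hs _, hq, rfl⟩
    have hq0 := hq
    rw [List.pairwise_append, List.pairwise_cons] at hq
    obtain ⟨hqc, ⟨hd1, hqd⟩, hcd⟩ := hq
    by_cases hmem : i.succ ∈ c
    · obtain ⟨c, e, rfl⟩ := List.append_of_mem hmem
      obtain rfl : e = [] := by
        cases e with
        | nil => rfl
        | cons z e =>
          have h1 : z < i.succ := by
            have := (List.pairwise_append.1 hqc).2.1
            exact (List.pairwise_cons.1 this).1 z (by simp)
          have h2 := hcd z (by simp) i.castSucc (by simp)
          exact absurd (lt_succ_iff_le_castSucc.1 h1) (not_le.2 h2)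
      obtain ⟨a1, a2, rfl, ha1, ha2⟩ := List.append_sublist_iff.1 hc
      obtain ⟨s, t, rfl⟩ := List.append_of_mem (List.singleton_sublist.1 ha2)
      -- The suffix of `a` that begins with the chosen i+1 has nonnegative total, so an i follows
      -- this i+1 inside `a`; it replaces the i that was changed.
      have h1 := height_eq_total_of_append (height_eq_total_of_append ha)
      have h2 := height_nonneg i (i.succ :: t)
      rw [h1, total_cons, sgn_succ, total_eq_count] at h2
      have h3 : i.castSucc ∈ t := by
        rw [← List.count_pos_iff]; omega
      refine ⟨_, ?_, hq0, rfl⟩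
      rw [List.append_assoc, List.append_assoc]
      refine ha1.append ?_
      rw [List.append_assoc]
      refine List.Sublist.trans ?_ (List.sublist_append_right _ _)
      refine List.Sublist.cons_cons _ ?_
      exact List.Sublist.append (l₁ := [i.castSucc]) (List.singleton_sublist.2 h3)
        (hd.trans (List.sublist_cons_self _ _))
    · refine ⟨c ++ i.succ :: d, hc.append (hd.cons_cons _), ?_, by simp⟩
      rw [List.pairwise_append, List.pairwise_cons]
      refine ⟨hqc, ⟨fun z hz => (hd1 z hz).trans hi, hqd⟩, fun z hz z' hz' => ?_⟩
      have h1 : i.succ < z := by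
        refine lt_of_le_of_ne (castSucc_lt_iff_succ_le.1 (hcd z hz _ (by simp))) ?_
        rintro rfl; exact hmem hz
      rcases List.mem_cons.1 hz' with rfl | hz'
      · exact h1
      · exact hcd z hz z' (by simp [hz'])
  · intro hs
    rcases sublist_append_cons_cases hs with hs | ⟨c, d, rfl, hc, hd⟩
    · exact ⟨q, hs _, hq, rfl⟩
    have hq0 := hq
    rw [List.pairwise_append, List.pairwise_cons] at hq
    obtain ⟨hqc, ⟨hd1, hqd⟩, hcd⟩ := hq
    by_cases hmem : i.castSucc ∈ d
    · obtain ⟨e, d, rfl⟩ := List.append_of_mem hmem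
      obtain rfl : e = [] := by
        cases e with
        | nil => rfl
        | cons z e =>
          have h1 : i.castSucc < z :=
            (List.pairwise_append.1 hqd).2.2 z (by simp) _ (by simp)
          have h2 := hd1 z (by simp)
          exact absurd (castSucc_lt_iff_succ_le.1 h1) (not_le.2 h2)
      rw [List.nil_append] at hd
      obtain ⟨b1, b2, rfl, hb1, hb2⟩ := List.append_sublist_iff.1
        (show ([i.castSucc] ++ d).Sublist b from hd)
      obtain ⟨s, t, rfl⟩ := List.append_of_mem (List.singleton_sublist.1 hb1)
      -- The prefix of `b` that ends with the chosen i has height 0, so it contains an i+1 before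
      -- this i; it replaces the i+1 that was changed back.
      have h1 : height i (s ++ [i.castSucc]) = 0 := by
        have := height_eq_zero_of_append hb
        rw [List.append_cons] at this
        exact height_eq_zero_of_append this
      have h2 := total_le_height i (s ++ [i.castSucc])
      rw [h1, total_append, total_cons, sgn_castSucc, total_eq_count, total_nil] at h2
      have h3 : i.succ ∈ s := by
        rw [← List.count_pos_iff]; omega
      refine ⟨_, ?_, hq0, rfl⟩
      refine hc.append (List.Sublist.cons _ ?_)
      rw [List.append_assoc]
      exact List.Sublist.append (l₁ := [i.succ]) (List.singleton_sublist.2 h3)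
        (List.Sublist.cons_cons _ (hb2.trans (List.sublist_append_right _ _)))
    · refine ⟨c ++ i.castSucc :: d, hc.append (hd.cons_cons _), ?_, by simp⟩
      rw [List.pairwise_append, List.pairwise_cons]
      have h1 : ∀ z ∈ d, z < i.castSucc := fun z hz => by
        refine lt_of_le_of_ne (lt_succ_iff_le_castSucc.1 (hd1 z hz)) ?_
        rintro rfl; exact hmem hz
      refine ⟨hqc, ⟨h1, hqd⟩, fun z hz z' hz' => ?_⟩
      have h2 := hcd z hz i.succ (by simp)
      rcases List.mem_cons.1 hz' with rfl | hz'
      · exact hi.trans h2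
      · exact hcd z hz z' (by simp [hz'])

/-- A relation between words under which subwords that are valleys can be carried along. -/
def PreservesValleys (R : List (Fin (m + 2)) → List (Fin (m + 2)) → Prop) : Prop :=
  ∀ w w' u, R w w' → u.Sublist w' → IsValley u →
    ∃ u', u'.Sublist w ∧ IsValley u' ∧ u'.length = u.length

/-- Cut the word at the turning point of the valley. The changed letter lies on one side only, so
only the strictly decreasing half or only the weakly increasing half has to be replaced. -/
theorem raises_preservesValleys (i : Fin (m + 1)) : PreservesValleys (Raises i) := by
  rintro w w' u hR hu ⟨p, q, rfl, hp, hq⟩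
  obtain ⟨v1, v2, rfl, h1, h2⟩ := List.append_sublist_iff.1 hu
  obtain ⟨a, b, hw, hv, ha, hb⟩ := id hR
  have hlen : w.length = v1.length + v2.length := by
    have := congrArg List.length hv
    subst hw; simp at this ⊢; omega
  rw [← List.take_append_drop v1.length w] at hR ⊢
  rcases hR.append (fun _ _ => height_eq_total_of_append)
    (fun _ _ => height_eq_zero_of_append) (by simp; omega) with ⟨h, h'⟩ | ⟨h, h'⟩
  · obtain ⟨p', hp1, hp2, hp3⟩ := (Raises.exists_strictAnti h hp).2 h1
    exact ⟨p' ++ q, hp1.append (h' ▸ h2), ⟨p', q, rfl, hp2, hq⟩, by simp [hp3]⟩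
  · obtain ⟨q', hp1, hp2, hp3⟩ := (Raises.exists_sorted h' hq).2 h2
    exact ⟨p ++ q', (h ▸ h1).append hp1, ⟨p, q', rfl, hp, hp2⟩, by simp [hp3]⟩

theorem raises_swap_preservesValleys (i : Fin (m + 1)) :
    PreservesValleys fun w w' => Raises i w' w := by
  rintro w w' u hR hu ⟨p, q, rfl, hp, hq⟩
  obtain ⟨v1, v2, rfl, h1, h2⟩ := List.append_sublist_iff.1 hu
  obtain ⟨a, b, hv, hw, ha, hb⟩ := id hR
  have hlen : w.length = v1.length + v2.length := by
    have := congrArg List.length hv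
    subst hw; simp at this ⊢; omega
  rw [← List.take_append_drop v1.length w] at hR ⊢
  rcases hR.append (fun _ _ => height_eq_total_of_append)
    (fun _ _ => height_eq_zero_of_append) (by simp; omega) with ⟨h, h'⟩ | ⟨h, h'⟩
  · obtain ⟨p', hp1, hp2, hp3⟩ := (Raises.exists_strictAnti h hp).1 h1
    exact ⟨p' ++ q, hp1.append (h' ▸ h2), ⟨p', q, rfl, hp2, hq⟩, by simp [hp3]⟩
  · obtain ⟨q', hp1, hp2, hp3⟩ := (Raises.exists_sorted h' hq).1 h2
    exact ⟨p ++ q', (h ▸ h1).append hp1, ⟨p, q', rfl, hp, hp2⟩, by simp [hp3]⟩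

theorem lt_one_two_of_noOneTwo {a c : List (Fin (m + 2))} (ha : NoOneTwo a) (hc : c.Sublist a) :
    ∀ z ∈ c, Fin.succ 0 < z := by
  intro z hz
  have h := ha z (hc.subset hz)
  refine lt_of_le_of_ne (castSucc_lt_iff_succ_le.1 ?_) h.2.symm
  exact lt_of_le_of_ne (Fin.zero_le _) h.1.symm

/-- When all letters before x exceed 2 and x is 1 or 2, the valley may be regarded as turning at x,
so x can be exchanged between 1 and 2: a 1 begins the increasing part, a 2 ends the decreasing part.
-/
theorem IsValley.pairwise_of_noOneTwo {c d : List (Fin (m + 2))} {x : Fin (m + 2)}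
    (h : IsValley (c ++ x :: d)) (hx : x ≤ Fin.succ 0) (hc : ∀ z ∈ c, Fin.succ 0 < z) :
    c.Pairwise (fun a b => b < a) ∧ d.Pairwise (fun a b => a ≤ b) := by
  obtain ⟨p, q, hu, hp, hq⟩ := h
  rcases List.append_eq_append_iff.1 hu with ⟨e, rfl, he⟩ | ⟨e, rfl, rfl⟩
  · cases e with
    | nil =>
      obtain rfl : x :: d = q := by simpa using he
      exact ⟨by simpa using hp, (List.pairwise_cons.1 hq).2⟩
    | cons y e =>
      obtain ⟨rfl, rfl⟩ : x = y ∧ d = e ++ q := by simpa using he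
      rw [List.pairwise_append, List.pairwise_cons] at hp
      refine ⟨hp.1, ?_⟩
      -- A strict descent from x ≤ 2 only leaves the letter 1, which may be counted with the
      -- increasing part.
      have he0 : ∀ z ∈ e, z = Fin.castSucc 0 := fun z hz =>
        le_antisymm (lt_succ_iff_le_castSucc.1 ((hp.2.1.1 z hz).trans_le hx)) (Fin.zero_le _)
      rw [List.pairwise_append, List.eq_replicate_of_mem he0]
      refine ⟨List.pairwise_replicate.2 (Or.inr le_rfl), hq, fun z hz z' _ => ?_⟩
      rw [List.eq_of_mem_replicate hz]
      exact Fin.zero_le _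
  · cases e with
    | nil => exact ⟨by simpa using hp, (List.pairwise_cons.1 hq).2⟩
    | cons y e =>
      have h1 := (List.pairwise_append.1 hq).2.2 y (by simp) x (by simp)
      exact absurd (h1.trans hx) (not_le.2 (hc y (by simp)))

theorem barRaises_preservesValleys : PreservesValleys (BarRaises (m := m)) := by
  rintro w w' u ⟨a, b, rfl, rfl, ha, -⟩ hu hV
  rcases sublist_append_cons_cases hu with hu | ⟨c, d, rfl, hc, hd⟩
  · exact ⟨u, hu _, hV, rfl⟩
  obtain ⟨h1, h2⟩ := hV.pairwise_of_noOneTwo le_rfl (lt_one_two_of_noOneTwo ha hc)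
  refine ⟨c ++ Fin.castSucc 0 :: d, hc.append (hd.cons_cons _), ⟨c, _, rfl, h1, ?_⟩, by simp⟩
  exact List.pairwise_cons.2 ⟨fun z _ => Fin.zero_le z, h2⟩

theorem barRaises_swap_preservesValleys :
    PreservesValleys fun w w' : List (Fin (m + 2)) => BarRaises w' w := by
  rintro w w' u ⟨a, b, rfl, rfl, ha, -⟩ hu hV
  rcases sublist_append_cons_cases hu with hu | ⟨c, d, rfl, hc, hd⟩
  · exact ⟨u, hu _, hV, rfl⟩
  have hc' := lt_one_two_of_noOneTwo ha hc
  obtain ⟨h1, h2⟩ := hV.pairwise_of_noOneTwo (Fin.zero_le _) hc'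
  refine ⟨c ++ Fin.succ 0 :: d, hc.append (hd.cons_cons _),
    ⟨c ++ [Fin.succ 0], d, by simp, ?_, h2⟩, by simp⟩
  rw [List.pairwise_append]
  refine ⟨h1, by simp, fun z hz z' hz' => ?_⟩
  obtain rfl : z' = Fin.succ 0 := by simpa using hz'
  exact hc' z hz

/-! ### Reading words -/

/-- The letters of the reading word. -/
def letters (T : Tableau m) : List (Fin (m + 2)) :=
  (List.finRange (m + 2)).flatMap fun k => (T k).reverse

/-- The letters of the rows above row `k`. -/
def above (T : Tableau m) (k : Fin (m + 2)) : List (Fin (m + 2)) :=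
  ((List.finRange (m + 2)).take k).flatMap fun k => (T k).reverse

/-- The letters of the rows below row `k`. -/
def below (T : Tableau m) (k : Fin (m + 2)) : List (Fin (m + 2)) :=
  ((List.finRange (m + 2)).drop (k + 1)).flatMap fun k => (T k).reverse

theorem finRange_split (k : Fin (m + 2)) : List.finRange (m + 2) =
    (List.finRange (m + 2)).take k ++ k :: (List.finRange (m + 2)).drop (k + 1) := by
  have h : (k : ℕ) < (List.finRange (m + 2)).length := by simp
  conv_lhs => rw [← List.take_append_drop k (List.finRange (m + 2)), List.drop_eq_getElem_cons h]
  simp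

theorem mem_take_finRange {k l : Fin (m + 2)} :
    l ∈ (List.finRange (m + 2)).take k ↔ l < k := by
  rw [List.mem_take_iff_getElem]
  constructor
  · rintro ⟨j, hj, rfl⟩
    rw [Fin.lt_def]; simp at hj ⊢; exact hj
  · intro h
    exact ⟨l, by simpa using h, by simp⟩

theorem mem_drop_finRange {k l : Fin (m + 2)} :
    l ∈ (List.finRange (m + 2)).drop (k + 1) ↔ k < l := by
  rw [List.mem_drop_iff_getElem]
  constructor
  · rintro ⟨j, hj, rfl⟩
    rw [Fin.lt_def]; simp; omega
  · intro h
    rw [Fin.lt_def] at h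
    refine ⟨l - (k + 1), by simp; omega, ?_⟩
    ext; simp; omega

theorem letters_eq (T : Tableau m) (k : Fin (m + 2)) :
    letters T = above T k ++ ((T k).reverse ++ below T k) := by
  rw [letters, finRange_split k, List.flatMap_append, List.flatMap_cons]
  rfl

theorem map_mapIdx {A B C : Type*} (l : List A) (f : ℕ → A → B) (g : B → C) :
    (l.mapIdx f).map g = l.mapIdx fun j x => g (f j x) := by
  apply List.ext_getElem <;> simp

theorem mapIdx_snd {A : Type*} (l : List A) : (l.mapIdx fun _ x => x) = l := by
  apply List.ext_getElem <;> simp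

theorem map_snd_reading (T : Tableau m) : (reading T).map Prod.snd = letters T := by
  rw [reading, letters, List.map_flatMap]
  congr 1
  funext k
  rw [List.map_reverse, map_mapIdx, mapIdx_snd]

theorem nodup_map_fst_reading (T : Tableau m) : ((reading T).map Prod.fst).Nodup := by
  rw [reading, List.map_flatMap, List.nodup_flatMap]
  constructor
  · intro k _
    rw [List.map_reverse, map_mapIdx, List.nodup_reverse, List.nodup_iff_injective_get]
    intro a b h
    ext
    simpa using h
  · refine (List.nodup_finRange _).imp ?_
    intro k l hkl p hp hp'
    simp only at hp hp'
    rw [List.map_reverse, map_mapIdx, List.mem_reverse, List.mem_mapIdx] at hp hp'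
    obtain ⟨_, _, rfl⟩ := hp
    obtain ⟨_, _, h⟩ := hp'
    exact hkl (by simpa using (congrArg Prod.fst h).symm)

theorem reading_setBox (T : Tableau m) (c : Box m) (y : Fin (m + 2)) :
    reading (setBox T c y) = (reading T).map fun p => if p.1 = c then (p.1, y) else p := by
  obtain ⟨k, j⟩ := c
  rw [reading, reading, List.map_flatMap]
  congr 1
  funext l
  rw [List.map_reverse, map_mapIdx]
  congr 1
  by_cases h : l = k
  · subst h
    apply List.ext_getElem
    · simp [setBox]
    · intro t h1 h2
      simp only [setBox, List.getElem_mapIdx, Function.update_self, List.getElem_set]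
      by_cases htj : j = t
      · subst htj; simp
      · simp [htj, Ne.symm htj]
  · simp [setBox, h]

theorem reading_setBox_of_eq {T : Tableau m} {a b : List (Box m × Fin (m + 2))} {c : Box m}
    {x : Fin (m + 2)} (h : reading T = a ++ (c, x) :: b) (y : Fin (m + 2)) :
    reading (setBox T c y) = a ++ (c, y) :: b := by
  have hn := nodup_map_fst_reading T
  rw [h, List.map_append, List.map_cons, List.nodup_middle, List.nodup_cons] at hn
  rw [reading_setBox, h, List.map_append, List.map_cons]
  have key : ∀ s : List (Box m × Fin (m + 2)), (∀ p ∈ s, p.1 ≠ c) →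
      s.map (fun p => if p.1 = c then (p.1, y) else p) = s := by
    intro s hs
    conv_rhs => rw [← List.map_id s]
    exact List.map_congr_left fun p hp => by simp [hs p hp]
  rw [key a, key b]
  · simp
  · rintro p hp hpc
    exact hn.1 (List.mem_append_right _ (List.mem_map.2 ⟨p, hp, hpc⟩))
  · rintro p hp hpc
    exact hn.1 (List.mem_append_left _ (List.mem_map.2 ⟨p, hp, hpc⟩))

theorem setBox_row {T : Tableau m} {k : Fin (m + 2)} {l r : List (Fin (m + 2))} {x : Fin (m + 2)}
    (h : T k = l ++ x :: r) (y : Fin (m + 2)) :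
    setBox T (k, l.length) y = Function.update T k (l ++ y :: r) := by
  rw [setBox, h, List.set_append_right _ _ le_rfl]
  simp

theorem reading_eq_of_row {T : Tableau m} {k : Fin (m + 2)} {l r : List (Fin (m + 2))}
    {x : Fin (m + 2)} (h : T k = l ++ x :: r) :
    ∃ a b, reading T = a ++ ((k, l.length), x) :: b ∧
      a.map Prod.snd = above T k ++ r.reverse ∧ b.map Prod.snd = l.reverse ++ below T k := by
  have hs : ∀ s : List (Fin (m + 2)), (s.flatMap fun k =>
      ((T k).mapIdx fun j x => (((k, j), x) : Box m × Fin (m + 2))).reverse).map Prod.snd =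
      s.flatMap fun k => (T k).reverse := by
    intro s
    rw [List.map_flatMap]
    congr 1
    funext k
    rw [List.map_reverse, map_mapIdx, mapIdx_snd]
  refine ⟨((List.finRange (m + 2)).take k).flatMap (fun k =>
      ((T k).mapIdx fun j x => (((k, j), x) : Box m × Fin (m + 2))).reverse) ++
      (r.mapIdx fun j x => ((k, j + 1 + l.length), x)).reverse,
    (l.mapIdx fun j x => ((k, j), x)).reverse ++
      ((List.finRange (m + 2)).drop (k + 1)).flatMap (fun k =>
      ((T k).mapIdx fun j x => (((k, j), x) : Box m × Fin (m + 2))).reverse), ?_, ?_, ?_⟩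
  · rw [reading, finRange_split k, List.flatMap_append, List.flatMap_cons, h, List.mapIdx_append,
      List.mapIdx_cons, List.reverse_append, List.reverse_cons, ← finRange_split k]
    simp
  · rw [List.map_append, hs, List.map_reverse, map_mapIdx]
    simp [above, mapIdx_snd]
  · rw [List.map_append, hs, List.map_reverse, map_mapIdx]
    simp [below, mapIdx_snd]

theorem row_of_reading_eq {T : Tableau m} {k : Fin (m + 2)} {j : ℕ}
    {a b : List (Box m × Fin (m + 2))} {x : Fin (m + 2)} (h : reading T = a ++ ((k, j), x) :: b) :
    ∃ l r, T k = l ++ x :: r ∧ j = l.length ∧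
      a.map Prod.snd = above T k ++ r.reverse ∧ b.map Prod.snd = l.reverse ++ below T k := by
  have hmem : ((k, j), x) ∈ reading T := by simp [h]
  rw [reading, List.mem_flatMap] at hmem
  obtain ⟨k', -, hk'⟩ := hmem
  rw [List.mem_reverse, List.mem_mapIdx] at hk'
  obtain ⟨j', hj', he⟩ := hk'
  simp only [Prod.mk.injEq] at he
  obtain ⟨⟨rfl, rfl⟩, hx⟩ := he
  have hrow : T k' = (T k').take j' ++ x :: (T k').drop (j' + 1) := by
    conv_lhs => rw [← List.take_append_drop j' (T k'), List.drop_eq_getElem_cons hj', hx]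
  have hlen : ((T k').take j').length = j' := by simp; omega
  refine ⟨_, _, hrow, hlen.symm, ?_⟩
  obtain ⟨a', b', h', ha', hb'⟩ := reading_eq_of_row hrow
  rw [hlen, h] at h'
  have hn := nodup_map_fst_reading T
  rw [h, List.map_append, List.map_cons, List.nodup_middle, List.nodup_cons] at hn
  have hna : ((k', j'), x) ∉ a := fun hp =>
    hn.1 (List.mem_append_left _ (List.mem_map_of_mem (f := Prod.fst) hp))
  have hnb : ((k', j'), x) ∉ b := fun hp =>
    hn.1 (List.mem_append_right _ (List.mem_map_of_mem (f := Prod.fst) hp))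
  obtain ⟨rfl, -, rfl⟩ := (List.append_cons_inj_of_notMem hna hnb).1 h'
  exact ⟨ha', hb'⟩

/-- `T'` arises from `T` by changing one letter `x` to `y`, where the part of the reading word
before this letter satisfies `P` and the part after it satisfies `Q`. -/
def BoxChange (P Q : List (Fin (m + 2)) → Prop) (x y : Fin (m + 2)) (T T' : Tableau m) : Prop :=
  ∃ k l r, T k = l ++ x :: r ∧ T' = Function.update T k (l ++ y :: r) ∧
    P (above T k ++ r.reverse) ∧ Q (l.reverse ++ below T k)

/-- The operators are defined by boxes of the reading word, whereas rows, cores and enlargements are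
best handled by splitting a single row; this is the passage between the two. -/
theorem boxChange_iff {P Q : List (Fin (m + 2)) → Prop} {x y : Fin (m + 2)} {T T' : Tableau m} :
    BoxChange P Q x y T T' ↔ ∃ c a b, reading T = a ++ (c, x) :: b ∧ T' = setBox T c y ∧
      P (a.map Prod.snd) ∧ Q (b.map Prod.snd) := by
  constructor
  · rintro ⟨k, l, r, h, rfl, hP, hQ⟩
    obtain ⟨a, b, h1, h2, h3⟩ := reading_eq_of_row h
    exact ⟨(k, l.length), a, b, h1, (setBox_row h y).symm, h2 ▸ hP, h3 ▸ hQ⟩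
  · rintro ⟨⟨k, j⟩, a, b, h, rfl, hP, hQ⟩
    obtain ⟨l, r, h1, rfl, h2, h3⟩ := row_of_reading_eq h
    exact ⟨k, l, r, h1, setBox_row h1 y, h2 ▸ hP, h3 ▸ hQ⟩

theorem above_update (T : Tableau m) (k : Fin (m + 2)) (v) :
    above (Function.update T k v) k = above T k := by
  rw [above, above, List.flatMap_def, List.flatMap_def]
  congr 1
  refine List.map_congr_left fun l hl => ?_
  rw [Function.update_of_ne (mem_take_finRange.1 hl).ne]

theorem below_update (T : Tableau m) (k : Fin (m + 2)) (v) :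
    below (Function.update T k v) k = below T k := by
  rw [below, below, List.flatMap_def, List.flatMap_def]
  congr 1
  refine List.map_congr_left fun l hl => ?_
  rw [Function.update_of_ne (mem_drop_finRange.1 hl).ne']

section BoxChange

variable {P Q : List (Fin (m + 2)) → Prop} {x y : Fin (m + 2)} {T T' : Tableau m}

theorem BoxChange.symm (h : BoxChange P Q x y T T') : BoxChange P Q y x T' T := by
  obtain ⟨k, l, r, h, rfl, hP, hQ⟩ := h
  refine ⟨k, l, r, by simp, ?_, by rwa [above_update], by rwa [below_update]⟩
  rw [Function.update_idem, ← h, Function.update_eq_self]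

theorem BoxChange.changesTo (h : BoxChange P Q x y T T') :
    ChangesTo P Q x y (letters T) (letters T') := by
  obtain ⟨k, l, r, h, rfl, hP, hQ⟩ := h
  refine ⟨_, _, ?_, ?_, hP, hQ⟩
  · rw [letters_eq T k, h]; simp
  · rw [letters_eq _ k, above_update, below_update]; simp

theorem BoxChange.length_eq (h : BoxChange P Q x y T T') (k : Fin (m + 2)) :
    (T' k).length = (T k).length := by
  obtain ⟨k', l, r, h, rfl, -, -⟩ := h
  by_cases hk : k = k'
  · subst hk; simp [h]
  · rw [Function.update_of_ne hk]

theorem BoxChange.content (h : BoxChange P Q x y T T') :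
    content T' = content T + Pi.single y 1 - Pi.single x 1 := by
  obtain ⟨k, l, r, h, rfl, -, -⟩ := h
  funext a
  simp only [QueerCrystal.content, Pi.add_apply, Pi.sub_apply, Pi.single_apply]
  rw [← Finset.add_sum_erase _ _ (Finset.mem_univ k), ← Finset.add_sum_erase (a := k) _
    (fun k => ((T k).count a : ℤ)) (Finset.mem_univ k)]
  have : ∑ l' ∈ Finset.univ.erase k, ((Function.update T k (l ++ y :: r) l').count a : ℤ) =
      ∑ l' ∈ Finset.univ.erase k, ((T l').count a : ℤ) :=
    Finset.sum_congr rfl fun l' hl' => by rw [Function.update_of_ne (Finset.ne_of_mem_erase hl')]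
  rw [this, h, Function.update_self]
  simp only [List.count_append, List.count_cons, beq_iff_eq, @eq_comm _ a]
  split_ifs <;> push_cast <;> ring

end BoxChange

/-! ### The signature rule -/

theorem bracketStep_of_succ {i : Fin (m + 1)} {st : List (Box m × Fin (m + 2))}
    {p : Box m × Fin (m + 2)} (h : p.2 = i.succ) : bracketStep i st p = p :: st := by
  simp [bracketStep, h]

theorem bracketStep_of_ne {i : Fin (m + 1)} {st : List (Box m × Fin (m + 2))}
    {p : Box m × Fin (m + 2)} (h : p.2 ≠ i.castSucc) (h' : p.2 ≠ i.succ) :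
    bracketStep i st p = st := by
  simp [bracketStep, h, h']

theorem bracketStep_cancel {i : Fin (m + 1)} {st : List (Box m × Fin (m + 2))}
    {p q : Box m × Fin (m + 2)} (h : p.2 = i.castSucc) (hq : q.2 = i.succ) :
    bracketStep i (q :: st) p = st := by
  simp [bracketStep, h, hq, (succ_ne_castSucc i).symm]

theorem bracketStep_push {i : Fin (m + 1)} {st : List (Box m × Fin (m + 2))}
    {p : Box m × Fin (m + 2)} (h : p.2 = i.castSucc) (hst : ∀ q ∈ st, q.2 = i.castSucc) :
    bracketStep i st p = p :: st := by
  cases st with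
  | nil => simp [bracketStep, h, (succ_ne_castSucc i).symm]
  | cons q st =>
    simp [bracketStep, h, hst q (by simp), (succ_ne_castSucc i).symm]

/-- At most `height` many letters i of `b` reach below the letters that `b` itself supplies, and the
stock `E` of letters i+1 absorbs them, so the bottom `s` of the stack is never touched. -/
theorem foldl_bracketStep_suffix (i : Fin (m + 1)) (s : List (Box m × Fin (m + 2))) :
    ∀ (b E : List (Box m × Fin (m + 2))), (∀ p ∈ E, p.2 = i.succ) →
      height i (b.map Prod.snd) ≤ E.length →
      ∃ E', b.foldl (bracketStep i) (E ++ s) = E' ++ s ∧ ∀ p ∈ E', p.2 = i.succ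
  | [], E, hE, _ => ⟨E, rfl, hE⟩
  | y :: b, E, hE, h => by
    rw [List.map_cons, height_cons] at h
    rw [List.foldl_cons]
    rcases sgn_cases i y.2 with ⟨h1, h2⟩ | ⟨h1, h2⟩ | ⟨h1, h3, h2⟩
    · have h0 := height_nonneg i (b.map Prod.snd)
      cases E with
      | nil => simp at h; omega
      | cons q E =>
        rw [List.cons_append, bracketStep_cancel h1 (hE q (by simp))]
        refine foldl_bracketStep_suffix i s b E (fun p hp => hE p (by simp [hp])) ?_
        simp at h; omega
    · rw [bracketStep_of_succ h1, ← List.cons_append]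
      refine foldl_bracketStep_suffix i s b _ ?_ ?_
      · intro p hp
        rcases List.mem_cons.1 hp with rfl | hp
        · exact h1
        · exact hE p hp
      · simp; omega
    · rw [bracketStep_of_ne h1 h3]
      exact foldl_bracketStep_suffix i s b E hE (by omega)

/-- The stack always consists of letters i+1 on top of letters i: an i is pushed only when no i+1 is
left to cancel it. The count of uncancelled letters i is then the excess of the height over the
initial stock of i+1. -/
theorem foldl_bracketStep (i : Fin (m + 1)) :
    ∀ (a E F : List (Box m × Fin (m + 2))), (∀ p ∈ E, p.2 = i.succ) →
      (∀ p ∈ F, p.2 = i.castSucc) →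
      ∃ E' F', a.foldl (bracketStep i) (E ++ F) = E' ++ F' ∧ (∀ p ∈ E', p.2 = i.succ) ∧
        (∀ p ∈ F', p.2 = i.castSucc) ∧
        (F'.length : ℤ) = F.length + max 0 (height i (a.map Prod.snd) - E.length) ∧
        (F'.length : ℤ) - E'.length = F.length - E.length + total i (a.map Prod.snd)
  | [], E, F, hE, hF => ⟨E, F, rfl, hE, hF, by simp, by simp⟩
  | y :: a, E, F, hE, hF => by
    have h0 := height_nonneg i (a.map Prod.snd)
    rw [List.map_cons, height_cons, total_cons, List.foldl_cons]
    rcases sgn_cases i y.2 with ⟨h1, h2⟩ | ⟨h1, h2⟩ | ⟨h1, h3, h2⟩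
    · cases E with
      | nil =>
        have hF' : ∀ p ∈ y :: F, p.2 = i.castSucc := by
          intro p hp
          rcases List.mem_cons.1 hp with rfl | hp
          · exact h1
          · exact hF p hp
        rw [List.nil_append, bracketStep_push h1 hF]
        obtain ⟨E', F', h4, h5, h6, h7, h8⟩ := foldl_bracketStep i a [] (y :: F) hE hF'
        refine ⟨E', F', h4, h5, h6, ?_, ?_⟩
        · rw [h7, h2]; simp; omega
        · rw [h8, h2]; simp; omega
      | cons q E =>
        rw [List.cons_append, bracketStep_cancel h1 (hE q (by simp))]
        obtain ⟨E', F', h4, h5, h6, h7, h8⟩ :=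
          foldl_bracketStep i a E F (fun p hp => hE p (by simp [hp])) hF
        refine ⟨E', F', h4, h5, h6, ?_, ?_⟩
        · rw [h7, h2]; simp; omega
        · rw [h8, h2]; simp; omega
    · have hE' : ∀ p ∈ y :: E, p.2 = i.succ := by
        intro p hp
        rcases List.mem_cons.1 hp with rfl | hp
        · exact h1
        · exact hE p hp
      rw [bracketStep_of_succ h1, ← List.cons_append]
      obtain ⟨E', F', h4, h5, h6, h7, h8⟩ := foldl_bracketStep i a (y :: E) F hE' hF
      refine ⟨E', F', h4, h5, h6, ?_, ?_⟩
      · rw [h7, h2]; simp; omega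
      · rw [h8, h2]; simp; omega
    · rw [bracketStep_of_ne h1 h3]
      obtain ⟨E', F', h4, h5, h6, h7, h8⟩ := foldl_bracketStep i a E F hE hF
      refine ⟨E', F', h4, h5, h6, ?_, ?_⟩
      · rw [h7, h2]; omega
      · rw [h8, h2]; omega

theorem foldl_bracketStep_nil (i : Fin (m + 1)) (a : List (Box m × Fin (m + 2))) :
    ∃ E F, a.foldl (bracketStep i) [] = E ++ F ∧ (∀ p ∈ E, p.2 = i.succ) ∧
      (∀ p ∈ F, p.2 = i.castSucc) ∧ (F.length : ℤ) = height i (a.map Prod.snd) ∧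
      (E.length : ℤ) = height i (a.map Prod.snd) - total i (a.map Prod.snd) := by
  obtain ⟨E, F, h1, h2, h3, h4, h5⟩ := foldl_bracketStep i a [] [] (by simp) (by simp)
  have := height_nonneg i (a.map Prod.snd)
  refine ⟨E, F, h1, h2, h3, ?_, ?_⟩ <;> simp at h4 h5 <;> omega

theorem red_eq (i : Fin (m + 1)) (T : Tableau m) :
    ∃ E F, red i T = F ++ E ∧ (∀ p ∈ E, p.2 = i.succ) ∧
      (∀ p ∈ F, p.2 = i.castSucc) ∧ (F.length : ℤ) = height i (letters T) ∧
      (E.length : ℤ) = height i (letters T) - total i (letters T) := by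
  obtain ⟨E, F, h1, h2, h3, h4, h5⟩ := foldl_bracketStep_nil i (reading T)
  rw [map_snd_reading] at h4 h5
  refine ⟨E.reverse, F.reverse, ?_, by simpa using h2, by simpa using h3, by simpa using h4,
    by simpa using h5⟩
  rw [red, h1, List.reverse_append]

theorem redCount_castSucc (i : Fin (m + 1)) (T : Tableau m) :
    redCount i i.castSucc T = height i (letters T) := by
  obtain ⟨E, F, h1, h2, h3, h4, h5⟩ := red_eq i T
  rw [redCount, h1, List.countP_append, ← h4, List.countP_eq_length.2 (by simpa using h3),
    List.countP_eq_zero.2 (fun p hp => by simp [h2 p hp, succ_ne_castSucc]), Nat.add_zero]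

theorem redCount_succ (i : Fin (m + 1)) (T : Tableau m) :
    redCount i i.succ T = height i (letters T) - total i (letters T) := by
  obtain ⟨E, F, h1, h2, h3, h4, h5⟩ := red_eq i T
  rw [redCount, h1, List.countP_append, ← h5, (List.countP_eq_length (l := E)).2
    (by simpa using h2), (List.countP_eq_zero (l := F)).2
    (fun p hp => by simp [h3 p hp, (succ_ne_castSucc i).symm]), Nat.zero_add]

/-- When p is read, every earlier i+1 has been cancelled, so p is pushed onto a stack of letters i;
afterwards no letter i is left over to remove p. Hence p sits exactly at the border between the
letters i and the letters i+1 of the reduced word. -/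
theorem red_eq_of_reading_eq {i : Fin (m + 1)} {T : Tableau m}
    {a b : List (Box m × Fin (m + 2))} {p : Box m × Fin (m + 2)}
    (h : reading T = a ++ p :: b) (hp : p.2 = i.castSucc ∨ p.2 = i.succ)
    (ha : height i (a.map Prod.snd) = total i (a.map Prod.snd))
    (hb : height i (b.map Prod.snd) = 0) :
    ∃ E F, red i T = F ++ p :: E ∧ (∀ p ∈ E, p.2 = i.succ) ∧ (∀ p ∈ F, p.2 = i.castSucc) := by
  obtain ⟨E, F, h1, -, h3, -, h5⟩ := foldl_bracketStep_nil i a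
  obtain rfl : E = [] := by
    rw [← List.length_eq_zero_iff]; omega
  have h6 : bracketStep i F p = p :: F := by
    rcases hp with hp | hp
    · exact bracketStep_push hp h3
    · exact bracketStep_of_succ hp
  obtain ⟨E, h7, h8⟩ := foldl_bracketStep_suffix i (p :: F) b [] (by simp) (by simp [hb])
  refine ⟨E.reverse, F.reverse, ?_, by simpa using h8, by simpa using h3⟩
  rw [red, h, List.foldl_append, h1, List.foldl_cons, List.nil_append, h6]
  rw [List.nil_append] at h7
  rw [h7]
  simp

/-- The condition on the word before the letter that `e_i` or `f_i` changes. -/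
def AllLowered (i : Fin (m + 1)) (a : List (Fin (m + 2))) : Prop := height i a = total i a

/-- The condition on the word after the letter that `e_i` or `f_i` changes. -/
def AllRaised (i : Fin (m + 1)) (b : List (Fin (m + 2))) : Prop := height i b = 0

theorem rawF_of_boxChange {i : Fin (m + 1)} {T T' : Tableau m}
    (h : BoxChange (AllLowered i) (AllRaised i) i.castSucc i.succ T T') :
    rawF i T = some T' := by
  obtain ⟨c, a, b, hT, rfl, ha, hb⟩ := boxChange_iff.1 h
  obtain ⟨E, F, h1, h2, h3⟩ := red_eq_of_reading_eq hT (Or.inl rfl) ha hb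
  have : (red i T).reverse.find? (fun p => p.2 = i.castSucc) = some (c, i.castSucc) := by
    rw [List.find?_eq_some_iff_append]
    refine ⟨by simp, E.reverse, F.reverse, by simp [h1], fun p hp => ?_⟩
    simp [h2 p (by simpa using hp), succ_ne_castSucc]
  rw [rawF, this]
  rfl

theorem rawE_of_boxChange {i : Fin (m + 1)} {T T' : Tableau m}
    (h : BoxChange (AllLowered i) (AllRaised i) i.succ i.castSucc T T') :
    rawE i T = some T' := by
  obtain ⟨c, a, b, hT, rfl, ha, hb⟩ := boxChange_iff.1 h
  obtain ⟨E, F, h1, h2, h3⟩ := red_eq_of_reading_eq hT (Or.inr rfl) ha hb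
  have : (red i T).find? (fun p => p.2 = i.succ) = some (c, i.succ) := by
    rw [List.find?_eq_some_iff_append]
    refine ⟨by simp, F, E, by simp [h1], fun p hp => ?_⟩
    simp [h3 p hp, (succ_ne_castSucc i).symm]
  rw [rawE, this]
  rfl

theorem rawF_eq_none_iff {i : Fin (m + 1)} {T : Tableau m} :
    rawF i T = none ↔ height i (letters T) = 0 := by
  obtain ⟨E, F, h1, h2, h3, h4, h5⟩ := red_eq i T
  rw [rawF, Option.map_eq_none_iff, List.find?_eq_none, ← h4, h1]
  constructor
  · intro h
    rw [Int.natCast_eq_zero, List.length_eq_zero_iff, List.eq_nil_iff_forall_not_mem]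
    intro p hp
    simpa [h3 p hp] using h p (by simp [hp])
  · intro h p hp
    obtain rfl : F = [] := by simpa using h
    simp [h2 p (by simpa using hp), succ_ne_castSucc]

theorem rawE_eq_none_iff {i : Fin (m + 1)} {T : Tableau m} :
    rawE i T = none ↔ height i (letters T) = total i (letters T) := by
  obtain ⟨E, F, h1, h2, h3, h4, h5⟩ := red_eq i T
  rw [rawE, Option.map_eq_none_iff, List.find?_eq_none, h1]
  constructor
  · intro h
    have : E = [] := by
      rw [List.eq_nil_iff_forall_not_mem]
      intro p hp
      simpa [h2 p hp] using h p (by simp [hp])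
    rw [this] at h5; simp at h5; omega
  · intro h p hp
    obtain rfl : E = [] := by rw [← List.length_eq_zero_iff]; omega
    simp [h3 p (by simpa using hp), (succ_ne_castSucc i).symm]

/-- A position with the required signature conditions exists whenever the value is nonzero, and at
any such position the value is forced. So the bracketing rule can be replaced by these conditions
from here on. -/
theorem rawF_eq_some_iff {i : Fin (m + 1)} {T T' : Tableau m} :
    rawF i T = some T' ↔ BoxChange (AllLowered i) (AllRaised i) i.castSucc i.succ T T' := by
  refine ⟨fun h => ?_, rawF_of_boxChange⟩
  rcases exists_raisable (i := i) Prod.snd (reading T) with h0 | ⟨a, p, b, h1, h2, h3, h4⟩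
  · rw [map_snd_reading, ← rawF_eq_none_iff, h] at h0
    cases h0
  · obtain ⟨c, x⟩ := p
    obtain rfl : x = i.castSucc := h2
    have h5 : BoxChange (AllLowered i) (AllRaised i) i.castSucc i.succ T (setBox T c i.succ) :=
      boxChange_iff.2 ⟨c, a, b, h1, rfl, h3, h4⟩
    have h6 := rawF_of_boxChange h5
    rw [h] at h6
    rwa [Option.some.inj h6]

theorem rawE_eq_some_iff {i : Fin (m + 1)} {T T' : Tableau m} :
    rawE i T = some T' ↔ BoxChange (AllLowered i) (AllRaised i) i.succ i.castSucc T T' := by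
  refine ⟨fun h => ?_, rawE_of_boxChange⟩
  rcases exists_lowerable (i := i) Prod.snd (reading T) with h0 | ⟨a, p, b, h1, h2, h3, h4⟩
  · rw [map_snd_reading, ← rawE_eq_none_iff, h] at h0
    cases h0
  · obtain ⟨c, x⟩ := p
    obtain rfl : x = i.succ := h2
    have h5 : BoxChange (AllLowered i) (AllRaised i) i.succ i.castSucc T
        (setBox T c i.castSucc) := boxChange_iff.2 ⟨c, a, b, h1, rfl, h3, h4⟩
    have h6 := rawE_of_boxChange h5
    rw [h] at h6
    rwa [Option.some.inj h6]

theorem firstOneTwo_eq_some_iff {T : Tableau m} {p : Box m × Fin (m + 2)} :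
    firstOneTwo T = some p ↔ (p.2 = Fin.castSucc 0 ∨ p.2 = Fin.succ 0) ∧
      ∃ a b, reading T = a ++ p :: b ∧ NoOneTwo (a.map Prod.snd) := by
  rw [firstOneTwo, List.find?_eq_some_iff_append]
  simp only [decide_eq_true_eq, NoOneTwo, List.mem_map, forall_exists_index, and_imp,
    forall_apply_eq_imp_iff₂, Bool.not_eq_true', decide_eq_false_iff_not, not_or, ne_eq]

theorem rawFBar_eq_some_iff {T T' : Tableau m} :
    rawFBar T = some T' ↔
      BoxChange NoOneTwo (fun _ => True) (Fin.castSucc 0) (Fin.succ 0) T T' := by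
  rw [boxChange_iff, rawFBar, Option.bind_eq_some_iff]
  constructor
  · rintro ⟨⟨c, x⟩, h1, h2⟩
    obtain ⟨-, a, b, h3, h4⟩ := firstOneTwo_eq_some_iff.1 h1
    split_ifs at h2 with hx
    obtain rfl : x = Fin.castSucc 0 := hx
    exact ⟨c, a, b, h3, (Option.some.inj h2).symm, h4, trivial⟩
  · rintro ⟨c, a, b, h1, rfl, h2, -⟩
    exact ⟨(c, Fin.castSucc 0), firstOneTwo_eq_some_iff.2 ⟨Or.inl rfl, a, b, h1, h2⟩, if_pos rfl⟩

theorem rawEBar_eq_some_iff {T T' : Tableau m} :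
    rawEBar T = some T' ↔
      BoxChange NoOneTwo (fun _ => True) (Fin.succ 0) (Fin.castSucc 0) T T' := by
  rw [boxChange_iff, rawEBar, Option.bind_eq_some_iff]
  constructor
  · rintro ⟨⟨c, x⟩, h1, h2⟩
    obtain ⟨-, a, b, h3, h4⟩ := firstOneTwo_eq_some_iff.1 h1
    split_ifs at h2 with hx
    obtain rfl : x = Fin.succ 0 := hx
    exact ⟨c, a, b, h3, (Option.some.inj h2).symm, h4, trivial⟩
  · rintro ⟨c, a, b, h1, rfl, h2, -⟩
    exact ⟨(c, Fin.succ 0), firstOneTwo_eq_some_iff.2 ⟨Or.inr rfl, a, b, h1, h2⟩, if_pos rfl⟩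

theorem rawE_eq_some_iff_rawF {i : Fin (m + 1)} {T T' : Tableau m} :
    rawE i T = some T' ↔ rawF i T' = some T := by
  rw [rawE_eq_some_iff, rawF_eq_some_iff]
  exact ⟨BoxChange.symm, BoxChange.symm⟩

theorem rawEBar_eq_some_iff_rawFBar {T T' : Tableau m} :
    rawEBar T = some T' ↔ rawFBar T' = some T := by
  rw [rawEBar_eq_some_iff, rawFBar_eq_some_iff]
  exact ⟨BoxChange.symm, BoxChange.symm⟩

theorem height_of_rawF {i : Fin (m + 1)} {T T' : Tableau m} (h : rawF i T = some T') :
    height i (letters T') = height i (letters T) - 1 ∧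
      total i (letters T') = total i (letters T) - 2 := by
  obtain ⟨a, b, h1, h2, ha, hb⟩ := (rawF_eq_some_iff.1 h).changesTo
  rw [AllLowered] at ha
  rw [AllRaised] at hb
  have := height_nonneg i a
  rw [h1, h2]
  simp only [height_append, total_append, height_cons, total_cons, sgn_castSucc, sgn_succ, hb]
  constructor <;> omega

/-! ### Stability of semistandard decomposition tableaux -/

theorem isHookWord_iff_append (u : List (Fin (m + 2))) : IsHookWord u ↔ u ≠ [] ∧
    ∃ p q, u = p ++ q ∧ p.Pairwise (fun a b => b ≤ a) ∧ q.Pairwise (fun a b => a < b) := by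
  rw [isHookWord_iff]
  refine and_congr_right fun _ => ⟨?_, ?_⟩
  · rintro ⟨p, q, h, hp, hq⟩
    refine ⟨q.reverse, p.reverse, ?_, List.pairwise_reverse.2 hq, List.pairwise_reverse.2 hp⟩
    rw [← List.reverse_append, ← h, List.reverse_reverse]
  · rintro ⟨p, q, rfl, hp, hq⟩
    exact ⟨q.reverse, p.reverse, by simp, List.pairwise_reverse.2 hq, List.pairwise_reverse.2 hp⟩

theorem length_flatMap_reverse_congr {T T' : Tableau m}
    (h : ∀ k, (T' k).length = (T k).length) (s : List (Fin (m + 2))) :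
    (s.flatMap fun k => (T k).reverse).length = (s.flatMap fun k => (T' k).reverse).length := by
  simp [List.length_flatMap, h]

theorem below_castSucc (T : Tableau m) (j : Fin (m + 1)) :
    below T j.castSucc = (T j.succ).reverse ++ below T j.succ := by
  have h : (j : ℕ) + 1 < (List.finRange (m + 2)).length := by simp; omega
  rw [below, Fin.val_castSucc, List.drop_eq_getElem_cons h, List.flatMap_cons]
  congr 3
  simp only [List.getElem_finRange]
  rfl

/-- The reversal of a row, and of a row appended to the one below it, are factors of the reading
word, so `R` or equality holds between corresponding factors. Carrying valleys forward keeps the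
rows hook words; carrying them back bounds the new hook subwords by the old ones. -/
theorem IsSDT.of_letters {lam : StrictShape m} {T T' : Tableau m}
    {R : List (Fin (m + 2)) → List (Fin (m + 2)) → Prop} (hR : RestrictsToFactors R)
    (hV : PreservesValleys R) (hV' : PreservesValleys fun w w' => R w' w) (hT : IsSDT lam T)
    (hlen : ∀ k, (T' k).length = (T k).length) (h : R (letters T) (letters T')) :
    IsSDT lam T' := by
  have habove : ∀ k, (above T k).length = (above T' k).length :=
    fun k => length_flatMap_reverse_congr hlen _
  have hne : ∀ k, T' k ≠ [] → T k ≠ [] := by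
    intro k hk h0
    have := hlen k
    rw [h0, List.length_nil, List.length_eq_zero_iff] at this
    exact hk this
  refine ⟨fun k => (hlen k).trans (hT.shape k), fun k hk => ?_, fun j hj w hw hwh => ?_⟩
  · rw [letters_eq T k, letters_eq T' k] at h
    rcases (hR _ _ _ _ (habove k) h).2 with h1 | h1
    swap
    · have := (List.append_inj h1 (by simp [hlen])).1
      rw [← List.reverse_inj.1 this]
      exact hT.hook k (hne k hk)
    rcases (hR _ _ _ _ (by simp [hlen]) h1).1 with h2 | h2
    · obtain ⟨u, hu1, hu2, hu3⟩ := hV' _ _ _ h2 (List.Sublist.refl _)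
        ((isHookWord_iff _).1 (hT.hook k (hne k hk))).2
      -- The valley obtained has the full length of the row, hence is the row.
      have := hu1.eq_of_length (by simp [hu3, hlen])
      rw [this] at hu2
      exact (isHookWord_iff _).2 ⟨hk, hu2⟩
    · rw [← List.reverse_inj.1 h2]
      exact hT.hook k (hne k hk)
  · have hlw : ∀ S : Tableau m, letters S = above S j.castSucc ++
        ((S j.succ ++ S j.castSucc).reverse ++ below S j.succ) := by
      intro S
      rw [letters_eq S j.castSucc, below_castSucc, List.reverse_append, List.append_assoc]
    rw [hlw T, hlw T'] at h
    have hjT := hne _ hj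
    have hend : ∀ v : List (Fin (m + 2)), v.Sublist (T j.succ ++ T j.castSucc) → IsHookWord v →
        v.length = w.length → w.length ≤ (T' j.castSucc).length := by
      intro v hv1 hv2 hv3
      rw [hlen, ← hv3]
      exact hT.maximal j hjT v hv1 hv2
    rcases (hR _ _ _ _ (habove _) h).2 with h1 | h1
    swap
    · have := (List.append_inj h1 (by simp [hlen])).1
      rw [← List.reverse_inj.1 this] at hw
      exact hend w hw hwh rfl
    rcases (hR _ _ _ _ (by simp [hlen]) h1).1 with h2 | h2
    · obtain ⟨hw0, hw1⟩ := (isHookWord_iff _).1 hwh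
      obtain ⟨u, hu1, hu2, hu3⟩ := hV _ _ _ h2 (List.reverse_sublist.2 hw) hw1
      rw [List.length_reverse] at hu3
      refine hend u.reverse ?_ ((isHookWord_iff _).2 ⟨?_, by simpa using hu2⟩) (by simpa using hu3)
      · simpa using List.reverse_sublist.2 hu1
      · rw [← List.length_pos_iff] at hw0 ⊢
        simpa [hu3] using hw0
    · rw [← List.reverse_inj.1 h2] at hw
      exact hend w hw hwh rfl

theorem stableUnder_rawF (lam : StrictShape m) (i : Fin (m + 1)) :
    StableUnder (IsSDT lam) (rawF i) := by
  intro T T' hT h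
  rw [rawF_eq_some_iff] at h
  exact hT.of_letters (raises_restrictsToFactors i) (raises_preservesValleys i)
    (raises_swap_preservesValleys i) h.length_eq h.changesTo

theorem stableUnder_rawE (lam : StrictShape m) (i : Fin (m + 1)) :
    StableUnder (IsSDT lam) (rawE i) := by
  intro T T' hT h
  rw [rawE_eq_some_iff] at h
  exact hT.of_letters (raises_restrictsToFactors i).swap (raises_swap_preservesValleys i)
    (raises_preservesValleys i) h.length_eq h.symm.changesTo

theorem stableUnder_rawFBar (lam : StrictShape m) : StableUnder (IsSDT lam) rawFBar := by
  intro T T' hT h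
  rw [rawFBar_eq_some_iff] at h
  exact hT.of_letters barRaises_restrictsToFactors barRaises_preservesValleys
    barRaises_swap_preservesValleys h.length_eq h.changesTo

theorem stableUnder_rawEBar (lam : StrictShape m) : StableUnder (IsSDT lam) rawEBar := by
  intro T T' hT h
  rw [rawEBar_eq_some_iff] at h
  exact hT.of_letters barRaises_restrictsToFactors.swap barRaises_swap_preservesValleys
    barRaises_preservesValleys h.length_eq h.symm.changesTo

/-! ### Rows of semistandard decomposition tableaux -/

theorem IsHookWord.cons {u : List (Fin (m + 2))} {y : Fin (m + 2)}
    (hu : u ≠ [] → IsHookWord u) (hy : ∀ x ∈ u.head?, x ≤ y) : IsHookWord (y :: u) := by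
  rw [isHookWord_iff_append]
  refine ⟨by simp, ?_⟩
  rcases u with - | ⟨x, u⟩
  · exact ⟨[y], [], by simp, by simp, by simp⟩
  obtain ⟨-, p, q, h, hp, hq⟩ := (isHookWord_iff_append _).1 (hu (by simp))
  refine ⟨y :: p, q, by rw [h]; rfl, ?_, hq⟩
  rw [List.pairwise_cons]
  refine ⟨fun z hz => ?_, hp⟩
  cases p with
  | nil => simp at hz
  | cons x' p =>
    obtain ⟨rfl, -⟩ : x = x' ∧ _ := by simpa using h
    have hxy : x ≤ y := hy x (by simp)
    rcases List.mem_cons.1 hz with rfl | hz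
    · exact hxy
    · exact ((List.pairwise_cons.1 hp).1 z hz).trans hxy

theorem isHookWord_replicate_append {u : List (Fin (m + 2))} {y : Fin (m + 2)}
    (hu : u ≠ [] → IsHookWord u) (hy : ∀ x ∈ u.head?, x ≤ y) (c : ℕ) :
    List.replicate c y ++ u ≠ [] → IsHookWord (List.replicate c y ++ u) := by
  induction c with
  | zero => simpa using hu
  | succ c ih =>
    intro _
    rw [List.replicate_succ, List.cons_append]
    refine IsHookWord.cons ih fun x hx => ?_
    cases c with
    | zero => exact hy x (by simpa using hx)
    | succ c =>
      rw [List.replicate_succ] at hx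
      obtain rfl : y = x := by simpa using hx
      exact le_rfl

/-- A letter preceded by a smaller one lies in the strictly increasing part; if it is moreover
maximal, nothing can follow it. -/
theorem IsHookWord.eq_nil_of_max {a b : List (Fin (m + 2))} {x : Fin (m + 2)}
    (h : IsHookWord (a ++ x :: b)) (ha0 : a ≠ []) (ha : ∀ z ∈ a, z < x) (hb : ∀ z ∈ b, z ≤ x) :
    b = [] := by
  obtain ⟨-, p, q, hu, hp, hq⟩ := (isHookWord_iff_append _).1 h
  rcases List.append_eq_append_iff.1 hu with ⟨e, rfl, he⟩ | ⟨e, rfl, rfl⟩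
  · cases e with
    | nil =>
      obtain rfl : x :: b = q := by simpa using he
      rw [List.eq_nil_iff_forall_not_mem]
      intro z hz
      exact absurd ((List.pairwise_cons.1 hq).1 z hz) (not_lt.2 (hb z hz))
    | cons y e =>
      obtain ⟨rfl, rfl⟩ : x = y ∧ b = e ++ q := by simpa using he
      obtain ⟨z, hz⟩ := List.exists_mem_of_ne_nil _ ha0
      exact absurd ((List.pairwise_append.1 hp).2.2 z hz x (by simp)) (not_le.2 (ha z hz))
  · rw [List.eq_nil_iff_forall_not_mem]
    intro z hz
    have := (List.pairwise_append.1 hq).2.1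
    exact absurd ((List.pairwise_cons.1 this).1 z hz) (not_lt.2 (hb z hz))

theorem IsSDT.row_ne_nil {lam : StrictShape m} {T : Tableau m} (hT : IsSDT lam T)
    {j : Fin (m + 1)} (h : T j.succ ≠ []) : T j.castSucc ≠ [] := by
  rw [← List.length_pos_iff, hT.shape] at h ⊢
  exact h.trans_le (lam.anti j)

/-- Otherwise this letter of the lower row, put in front of the upper row, would give a hook subword
longer than the upper row. -/
theorem IsSDT.lt_head {lam : StrictShape m} {T : Tableau m} (hT : IsSDT lam T)
    {j : Fin (m + 1)} {x y : Fin (m + 2)} {v : List (Fin (m + 2))} (hv : T j.castSucc = x :: v)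
    (hy : y ∈ T j.succ) : y < x := by
  by_contra! hxy
  have h1 : IsHookWord (y :: T j.castSucc) :=
    IsHookWord.cons (hT.hook _) (by simpa [hv] using hxy)
  have h2 := hT.maximal j (List.ne_nil_of_mem hy) (y :: T j.castSucc)
    (List.Sublist.append (l₁ := [y]) (List.singleton_sublist.2 hy) (List.Sublist.refl _)) h1
  simp at h2

/-- Going down one row, every letter is strictly below the head of the previous row, so the upper
bound drops by one. -/
theorem IsSDT.le_rev {lam : StrictShape m} {T : Tableau m} (hT : IsSDT lam T) (k : Fin (m + 2)) :
    ∀ x ∈ T k, x ≤ k.rev := by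
  induction k using Fin.induction with
  | zero => intro x _; rw [Fin.rev_zero]; exact Fin.le_last x
  | succ j ih =>
    intro y hy
    obtain ⟨x, v, hv⟩ := List.exists_cons_of_ne_nil (hT.row_ne_nil (List.ne_nil_of_mem hy))
    have h1 := hT.lt_head hv hy
    have h2 := ih x (by simp [hv])
    rw [Fin.rev_castSucc] at h2
    rw [Fin.rev_succ]
    exact lt_succ_iff_le_castSucc.1 (h1.trans_le h2)

/-! ### Initial runs and cores -/

/-- The number of leftmost boxes of row `k` with the letter of that row. -/
def run (T : Tableau m) (k : Fin (m + 2)) : ℕ := ((T k).takeWhile (fun x => x = k.rev)).length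

/-- The rows of `T` without their leftmost boxes with the letter of the row. -/
def core (T : Tableau m) : Tableau m := fun k => (T k).dropWhile (fun x => x = k.rev)

theorem row_eq (T : Tableau m) (k : Fin (m + 2)) :
    T k = List.replicate (run T k) k.rev ++ core T k := by
  conv_lhs => rw [← List.takeWhile_append_dropWhile (p := fun x => decide (x = k.rev)) (l := T k)]
  rw [core, List.append_cancel_right_eq, List.eq_replicate_iff]
  exact ⟨rfl, fun x hx => by simpa using List.mem_takeWhile_imp hx⟩

theorem length_row (T : Tableau m) (k : Fin (m + 2)) :
    (T k).length = run T k + (core T k).length := by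
  conv_lhs => rw [row_eq T k]
  simp

theorem core_sublist (T : Tableau m) (k : Fin (m + 2)) : (core T k).Sublist (T k) :=
  List.dropWhile_sublist _

theorem head_core_ne (T : Tableau m) (k : Fin (m + 2)) : ∀ x ∈ (core T k).head?, x ≠ k.rev := by
  intro x hx h
  have := List.head?_dropWhile_not (fun x => decide (x = k.rev)) (T k)
  rw [show (T k).dropWhile (fun x => decide (x = k.rev)) = core T k from rfl,
    Option.mem_def.1 hx] at this
  simp [h] at this

theorem dropWhile_replicate_append {A : Type*} [DecidableEq A] (x : A) (c : ℕ) (v : List A) :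
    (List.replicate c x ++ v).dropWhile (fun z => z = x) = v.dropWhile (fun z => z = x) := by
  induction c with
  | zero => rfl
  | succ c ih => rw [List.replicate_succ, List.cons_append, List.dropWhile_cons_of_pos (by simp), ih]

theorem dropWhile_eq_self_of_head {A : Type*} [DecidableEq A] {x : A} {v : List A}
    (h : ∀ z ∈ v.head?, z ≠ x) : v.dropWhile (fun z => z = x) = v := by
  cases v with
  | nil => rfl
  | cons y v => rw [List.dropWhile_cons_of_neg]; simpa using h y (by simp)

theorem core_eq_of_row {T : Tableau m} {k : Fin (m + 2)} {c : ℕ} {v : List (Fin (m + 2))}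
    (h : T k = List.replicate c k.rev ++ v) (hv : ∀ x ∈ v.head?, x ≠ k.rev) : core T k = v := by
  rw [core, h, dropWhile_replicate_append, dropWhile_eq_self_of_head hv]

/-- Copies of the lower row's own letter, followed by the core of the upper row, form a hook word,
since the head of that core is at most this letter. Maximality of the upper row, whose length is run
plus core, gives the bound. -/
theorem IsSDT.count_le_run {lam : StrictShape m} {T : Tableau m} (hT : IsSDT lam T)
    (j : Fin (m + 1)) : (T j.succ).count j.rev.castSucc ≤ run T j.castSucc := by
  set p := (T j.succ).count j.rev.castSucc with hp
  by_cases h0 : p = 0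
  · omega
  have hne : T j.succ ≠ [] := by
    intro h; rw [h] at hp; simp at hp; omega
  have hhead : ∀ x ∈ (core T j.castSucc).head?, x ≤ j.rev.castSucc := by
    intro x hx
    have h1 := head_core_ne T _ x hx
    have h2 := hT.le_rev j.castSucc x ((core_sublist T _).subset (List.mem_of_mem_head? hx))
    rw [Fin.rev_castSucc] at h1 h2
    exact lt_succ_iff_le_castSucc.1 (lt_of_le_of_ne h2 h1)
  have hhook : IsHookWord (List.replicate p j.rev.castSucc ++ core T j.castSucc) := by
    refine isHookWord_replicate_append (fun h => ?_) hhead p ?_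
    · exact (hT.hook _ (hT.row_ne_nil hne)).sublist (core_sublist T _) h
    · simp [h0]
  have h1 := hT.maximal j hne _ (List.Sublist.append
    (List.replicate_sublist_iff.2 le_rfl) (core_sublist T _)) hhook
  rw [length_row T j.castSucc] at h1
  simp at h1
  omega

/-! ### The maximality condition and enlarged shapes -/

/-- The possible lengths of hook subwords across a run of a maximal letter. -/
theorem IsHookWord.length_cases {v' v w : List (Fin (m + 2))} {c : ℕ} {x : Fin (m + 2)}
    (hw : IsHookWord w) (hs : w.Sublist (v' ++ (List.replicate c x ++ v)))
    (hv' : ∀ z ∈ v', z < x) (hv : ∀ z ∈ v, z ≤ x) :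
    w.Sublist (v' ++ v) ∨ w.length ≤ c + v.length ∨ w.length ≤ v'.length + 1 := by
  obtain ⟨w1, w2, rfl, h1, h2⟩ := List.sublist_append_iff.1 hs
  obtain ⟨w3, w4, rfl, h3, h4⟩ := List.sublist_append_iff.1 h2
  obtain ⟨s, hsc, rfl⟩ := List.sublist_replicate_iff.1 h3
  rcases s with - | s
  · left
    simpa using h1.append h4
  right
  by_cases h0 : w1 = []
  · left
    subst h0
    have := h4.length_le
    simp; omega
  · right
    rw [List.replicate_succ, List.cons_append] at hw
    -- A letter of `v'` precedes the first x used, and all such letters are smaller, so the subword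
    -- ends with that x.
    have h5 := hw.eq_nil_of_max h0 (fun z hz => hv' z (h1.subset hz)) (fun z hz => by
      rcases List.mem_append.1 hz with hz | hz
      · exact (List.eq_of_mem_replicate hz).le
      · exact hv z (h4.subset hz))
    have h6 := congrArg List.length h5
    have := h1.length_le
    simp only [List.length_append, List.length_replicate, List.length_nil] at h6
    simp; omega

theorem lt_castSucc_rev_of_le {j : Fin (m + 1)} {z : Fin (m + 2)} (h : z ≤ j.succ.rev) :
    z < j.castSucc.rev := by
  rw [Fin.rev_succ] at h
  rw [Fin.rev_castSucc]
  exact lt_succ_iff_le_castSucc.2 h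

/-- A run longer than the row below makes maximality automatic: replacing the run by the whole row
below loses length, and so does stopping after one letter of the run unless that length is no larger
than the row. -/
theorem isSDT_of_run {lam : StrictShape m} {T : Tableau m} (hshape : ∀ k, (T k).length = lam.parts k)
    (hhook : ∀ k, T k ≠ [] → IsHookWord (T k)) (hle : ∀ k, ∀ x ∈ T k, x ≤ k.rev)
    (hrun : ∀ j : Fin (m + 1), (T j.succ).length < run T j.castSucc) : IsSDT lam T := by
  refine ⟨hshape, hhook, fun j hj w hw hwh => ?_⟩
  have hr := hrun j
  have hl := length_row T j.castSucc
  rw [row_eq T j.castSucc] at hw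
  rcases hwh.length_cases hw (fun z hz => lt_castSucc_rev_of_le (hle _ z hz))
    (fun z hz => hle _ z ((core_sublist T _).subset hz)) with h | h | h
  · have := h.length_le
    simp at this
    omega
  · omega
  · omega

theorem length_enlarge {lam mu : StrictShape m} (h : lam ≤ mu) {T : Tableau m}
    (hT : IsSDT lam T) (k : Fin (m + 2)) : (enlarge lam mu T k).length = mu.parts k := by
  obtain ⟨nu, hnu⟩ := h
  simp [enlarge, hT.shape, hnu, Nat.add_comm]

/-- A hook subword either avoids the boxes added to the upper row, or begins in the upper row, or
stops at its first letter there. In the first case the old maximality applies, the lower row gaining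
no more boxes than the upper; in the last case strictness of the larger shape suffices. -/
theorem isSDT_enlarge {lam mu : StrictShape m} (h : lam ≤ mu) {T : Tableau m}
    (hT : IsSDT lam T) : IsSDT mu (enlarge lam mu T) := by
  refine ⟨length_enlarge h hT, fun k => ?_, fun j hj w hw hwh => ?_⟩
  · exact isHookWord_replicate_append (hT.hook k)
      (fun x hx => hT.le_rev k x (List.mem_of_mem_head? hx)) _
  · have hlen := length_enlarge h hT
    rw [hlen]
    rw [← List.length_pos_iff, hlen] at hj
    have h1 := mu.anti j
    have h2 := mu.strict j
    have hd : mu.parts j.succ - lam.parts j.succ ≤ mu.parts j.castSucc - lam.parts j.castSucc := by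
      obtain ⟨nu, hnu⟩ := h
      have := nu.anti j
      rw [hnu, hnu]; omega
    have hle : lam.parts j.castSucc ≤ mu.parts j.castSucc := by
      obtain ⟨nu, hnu⟩ := h
      rw [hnu]; omega
    have h3 := hlen j.succ
    have h4 := hT.shape j.castSucc
    have hlow : ∀ z ∈ enlarge lam mu T j.succ, z < j.castSucc.rev := by
      intro z hz
      refine lt_castSucc_rev_of_le ?_
      rcases List.mem_append.1 hz with hz | hz
      · exact (List.eq_of_mem_replicate hz).le
      · exact hT.le_rev _ z hz
    rcases hwh.length_cases hw hlow (fun z hz => hT.le_rev _ z hz) with h5 | h5 | h5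
    · rw [enlarge, List.append_assoc] at h5
      obtain ⟨w1, w2, rfl, h6, h7⟩ := List.sublist_append_iff.1 h5
      have h8 := h6.length_le
      have h9 : w2.length ≤ (T j.castSucc).length := by
        by_cases hT0 : T j.succ = []
        · rw [hT0, List.nil_append] at h7
          exact h7.length_le
        · by_cases hw2 : w2 = []
          · simp [hw2]
          · exact hT.maximal j hT0 w2 h7 (hwh.sublist (List.sublist_append_right _ _) hw2)
      simp at h8 ⊢
      omega
    · omega
    · omega

theorem core_enlarge (lam mu : StrictShape m) (T : Tableau m) :
    core (enlarge lam mu T) = core T := by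
  funext k
  rw [core, enlarge, dropWhile_replicate_append]
  rfl

/-- The row lengths and the core leave no freedom for the runs. Equalities between tableaux of one
shape are therefore checked on cores. -/
theorem eq_of_core_eq {T T' : Tableau m} (hl : ∀ k, (T k).length = (T' k).length)
    (hc : core T = core T') : T = T' := by
  funext k
  have h1 := length_row T k
  have h2 := length_row T' k
  have h3 := hl k
  rw [hc] at h1
  rw [row_eq T k, row_eq T' k, hc, show run T k = run T' k by omega]

/-! ### The operators and enlargements of the shape -/

theorem sgn_rev_of_lt {j : Fin (m + 1)} {l : Fin (m + 2)} (h : l < j.castSucc) :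
    sgn j.rev l.rev = 0 := by
  rw [← Fin.rev_lt_rev, Fin.rev_castSucc] at h
  exact sgn_eq_zero (Fin.castSucc_lt_succ.trans h).ne' h.ne'

theorem IsSDT.lt_of_mem_below {lam : StrictShape m} {T : Tableau m} (hT : IsSDT lam T)
    {j : Fin (m + 1)} {k : Fin (m + 2)} (hk : j.succ < k) {x : Fin (m + 2)} (hx : x ∈ T k) :
    x < j.rev.castSucc := by
  rw [← Fin.rev_lt_rev, Fin.rev_succ] at hk
  exact (hT.le_rev k x hx).trans_lt hk

theorem IsSDT.sgn_below {lam : StrictShape m} {T : Tableau m} (hT : IsSDT lam T)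
    (j : Fin (m + 1)) : ∀ x ∈ below T j.succ, sgn j.rev x = 0 := by
  intro x hx
  rw [below, List.mem_flatMap] at hx
  obtain ⟨k, hk, hxk⟩ := hx
  have := hT.lt_of_mem_below (mem_drop_finRange.1 hk) (List.mem_reverse.1 hxk)
  exact sgn_eq_zero this.ne (this.trans Fin.castSucc_lt_succ).ne

theorem IsSDT.count_succ_row {lam : StrictShape m} {T : Tableau m} (hT : IsSDT lam T)
    (j : Fin (m + 1)) : (T j.succ).count j.rev.succ = 0 := by
  rw [List.count_eq_zero]
  intro h
  have := hT.le_rev _ _ h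
  rw [Fin.rev_succ] at this
  exact absurd this (not_le.2 Fin.castSucc_lt_succ)

/-- The letters of the reading word that decide about the action of `e_i` and `f_i`. -/
def activeWord (T : Tableau m) (j : Fin (m + 1)) : List (Fin (m + 2)) :=
  above T j.castSucc ++ (core T j.castSucc).reverse

theorem letters_eq_activeWord (T : Tableau m) (j : Fin (m + 1)) : letters T =
    activeWord T j ++ (List.replicate (run T j.castSucc) j.rev.succ ++
      ((T j.succ).reverse ++ below T j.succ)) := by
  rw [letters_eq T j.castSucc, below_castSucc, activeWord]
  conv_lhs => rw [row_eq T j.castSucc]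
  rw [List.reverse_append, List.reverse_replicate, Fin.rev_castSucc]
  simp only [List.append_assoc]

/-- After the active word come the initial letters i+1 of their row. They are at least as many as
all letters i still to be read, so the path does not exceed its earlier maximum. The right-hand side
does not see the length of that run. -/
theorem IsSDT.height_letters {lam : StrictShape m} {T : Tableau m} (hT : IsSDT lam T)
    (j : Fin (m + 1)) : height j.rev (letters T) = height j.rev (activeWord T j) := by
  have h1 := height_le_count j.rev ((T j.succ).reverse)
  have h2 := hT.count_le_run j
  have h3 := total_le_height j.rev (activeWord T j)
  have h4 := total_le_height j.rev ((T j.succ).reverse)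
  have h5 := total_eq_count j.rev (T j.succ)
  rw [hT.count_succ_row] at h5
  have h6 := height_nonneg j.rev (activeWord T j)
  rw [List.count_reverse] at h1
  rw [letters_eq_activeWord T j, height_append, height_replicate_succ_append, height_append,
    height_eq_zero_of_sgn _ (hT.sgn_below j), total_reverse]
  omega

theorem total_replicate_succ (i : Fin (m + 1)) (c : ℕ) :
    total i (List.replicate c i.succ) = -c := by
  simp [total]

theorem IsSDT.total_letters {lam : StrictShape m} {T : Tableau m} (hT : IsSDT lam T)
    (j : Fin (m + 1)) : total j.rev (letters T) =
      total j.rev (activeWord T j) - run T j.castSucc + (T j.succ).count j.rev.castSucc := by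
  rw [letters_eq_activeWord T j, total_append, total_append, total_append, total_reverse,
    total_eq_zero_of_sgn _ (hT.sgn_below j), total_replicate_succ, total_eq_count _ (T j.succ),
    hT.count_succ_row]
  push_cast
  ring

/-- The added letters are neither i nor i+1 in the rows considered, so the path only acquires level
steps. -/
theorem signature_enlarge (lam mu : StrictShape m) (T : Tableau m) (i : Fin (m + 1)) :
    ∀ s : List (Fin (m + 2)), (∀ l ∈ s, sgn i l.rev = 0) →
      height i (s.flatMap fun k => (enlarge lam mu T k).reverse) =
        height i (s.flatMap fun k => (T k).reverse) ∧
      total i (s.flatMap fun k => (enlarge lam mu T k).reverse) =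
        total i (s.flatMap fun k => (T k).reverse)
  | [], _ => ⟨rfl, rfl⟩
  | l :: s, hs => by
    obtain ⟨h1, h2⟩ := signature_enlarge lam mu T i s fun l hl => hs l (by simp [hl])
    have h0 : ∀ x ∈ List.replicate (mu.parts l - lam.parts l) l.rev, sgn i x = 0 := by
      intro x hx
      rw [List.eq_of_mem_replicate hx]; exact hs l (by simp)
    rw [List.flatMap_cons, List.flatMap_cons]
    simp only [height_append, total_append, h1, h2]
    rw [enlarge, List.reverse_append, List.reverse_replicate, height_append, total_append,
      height_eq_zero_of_sgn i h0, total_eq_zero_of_sgn i h0]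
    have := total_le_height i (T l).reverse
    constructor <;> omega

theorem signature_above_enlarge (lam mu : StrictShape m) (T : Tableau m) {j : Fin (m + 1)}
    {k : Fin (m + 2)} (hk : k ≤ j.castSucc) :
    height j.rev (above (enlarge lam mu T) k) = height j.rev (above T k) ∧
      total j.rev (above (enlarge lam mu T) k) = total j.rev (above T k) :=
  signature_enlarge lam mu T j.rev _ fun _ hl =>
    sgn_rev_of_lt ((mem_take_finRange.1 hl).trans_le hk)

theorem height_letters_enlarge {lam mu : StrictShape m} (h : lam ≤ mu) {T : Tableau m}
    (hT : IsSDT lam T) (i : Fin (m + 1)) :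
    height i (letters (enlarge lam mu T)) = height i (letters T) := by
  obtain ⟨j, rfl⟩ := Fin.rev_surjective i
  obtain ⟨h1, h2⟩ := signature_above_enlarge lam mu T (le_refl j.castSucc)
  rw [hT.height_letters, (isSDT_enlarge h hT).height_letters, activeWord, activeWord,
    core_enlarge, height_append, height_append, h1, h2]

/-- An i in its own row is read after the run of i+1 in the row above. By `IsSDT.count_le_run` the
letters i read before it in its row are too few to cancel that run, against the condition on the
word before it. Lower rows contain no i at all. -/
theorem le_of_rawF {lam : StrictShape m} {T : Tableau m} (hT : IsSDT lam T)
    {j : Fin (m + 1)} {k : Fin (m + 2)} {l r : List (Fin (m + 2))}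
    (hk : T k = l ++ j.rev.castSucc :: r) (h : AllLowered j.rev (above T k ++ r.reverse)) :
    k ≤ j.castSucc := by
  by_contra! hlt
  have hle : j.succ ≤ k := Fin.castSucc_lt_iff_succ_le.1 hlt
  rcases hle.eq_or_lt with rfl | hlt'
  · have h1 : above T j.succ = activeWord T j ++ List.replicate (run T j.castSucc) j.rev.succ := by
      have h2 := letters_eq_activeWord T j
      rw [letters_eq T j.succ, ← List.append_assoc (activeWord T j)] at h2
      exact (List.append_inj' h2 rfl).1
    rw [h1, List.append_assoc] at h
    have h2 := height_eq_total_of_append h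
    have h3 := height_nonneg j.rev (List.replicate (run T j.castSucc) j.rev.succ ++ r.reverse)
    rw [h2, total_append, total_reverse, total_replicate_succ, total_eq_count] at h3
    have h4 := hT.count_le_run j
    rw [hk, List.count_append, List.count_cons_self] at h4
    omega
  · exact absurd (hT.lt_of_mem_below hlt' (by rw [hk]; simp)) (lt_irrefl _)

/-- If the last row contains a 1, the row above it has an initial 2, which is read earlier. -/
theorem le_of_rawFBar {lam : StrictShape m} {T : Tableau m} (hT : IsSDT lam T)
    {k : Fin (m + 2)} {l r : List (Fin (m + 2))}
    (hk : T k = l ++ Fin.castSucc 0 :: r) (h : NoOneTwo (above T k ++ r.reverse)) :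
    k ≤ (Fin.rev (0 : Fin (m + 1))).castSucc := by
  set j := Fin.rev (0 : Fin (m + 1)) with hj
  have hj' : j.rev = 0 := by rw [hj, Fin.rev_rev]
  by_contra! hlt
  have hle : j.succ ≤ k := Fin.castSucc_lt_iff_succ_le.1 hlt
  rcases hle.eq_or_lt with rfl | hlt'
  · have h4 := hT.count_le_run j
    rw [hk, hj', List.count_append, List.count_cons_self] at h4
    refine (h (Fin.succ 0) ?_).2 rfl
    rw [List.mem_append, above, List.mem_flatMap]
    refine Or.inl ⟨j.castSucc, mem_take_finRange.2 Fin.castSucc_lt_succ, ?_⟩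
    rw [List.mem_reverse, row_eq T j.castSucc, List.mem_append, List.mem_replicate,
      Fin.rev_castSucc, hj']
    exact Or.inl ⟨by omega, rfl⟩
  · have := hT.lt_of_mem_below hlt' (x := Fin.castSucc 0) (by rw [hk]; simp)
    rw [hj'] at this
    exact lt_irrefl _ this

theorem enlarge_row (lam mu : StrictShape m) {T : Tableau m} {k : Fin (m + 2)}
    {l r : List (Fin (m + 2))} {x : Fin (m + 2)} (hk : T k = l ++ x :: r) :
    enlarge lam mu T k = (List.replicate (mu.parts k - lam.parts k) k.rev ++ l) ++ x :: r := by
  rw [enlarge, hk, List.append_assoc]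

theorem enlarge_update (lam mu : StrictShape m) (T : Tableau m) (k : Fin (m + 2))
    (l r : List (Fin (m + 2))) (y : Fin (m + 2)) :
    enlarge lam mu (Function.update T k (l ++ y :: r)) = Function.update (enlarge lam mu T) k
      ((List.replicate (mu.parts k - lam.parts k) k.rev ++ l) ++ y :: r) := by
  funext k'
  by_cases h : k' = k
  · subst h; simp [enlarge]
  · simp [enlarge, Function.update_of_ne h]

theorem height_append_castSucc_cons {i : Fin (m + 1)} {a b : List (Fin (m + 2))}
    (ha : AllLowered i a) :
    height i (a ++ i.castSucc :: b) = total i a + 1 + height i b := by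
  have h1 := height_nonneg i b
  rw [AllLowered] at ha
  rw [height_append, height_cons, sgn_castSucc, ha]
  omega

theorem rawF_enlarge {lam mu : StrictShape m} (h : lam ≤ mu) {T T' : Tableau m}
    (hT : IsSDT lam T) {i : Fin (m + 1)} (hF : rawF i T = some T') :
    rawF i (enlarge lam mu T) = some (enlarge lam mu T') := by
  obtain ⟨j, rfl⟩ := Fin.rev_surjective i
  obtain ⟨k, l, r, hk, rfl, ha, hb⟩ := rawF_eq_some_iff.1 hF
  have hkj := le_of_rawF hT hk ha
  obtain ⟨h1, h2⟩ := signature_above_enlarge lam mu T hkj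
  have ha' : AllLowered j.rev (above (enlarge lam mu T) k ++ r.reverse) := by
    rw [AllLowered] at ha ⊢
    rw [height_append, total_append] at ha ⊢
    rw [h1, h2]; exact ha
  rw [rawF_eq_some_iff]
  refine ⟨k, _, r, enlarge_row lam mu hk, enlarge_update .., ha', ?_⟩
  -- The height of the whole word is the total before the letter, plus 1, plus the height after it.
  -- The whole height and the total before are unchanged, hence so is the height after.
  have h3 := height_letters_enlarge h hT j.rev
  have h4 : ∀ {S : Tableau m} {l : List (Fin (m + 2))}, S k = l ++ j.rev.castSucc :: r →
      letters S = (above S k ++ r.reverse) ++ j.rev.castSucc :: (l.reverse ++ below S k) := by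
    intro S l hS
    rw [letters_eq S k, hS]; simp
  rw [h4 hk, h4 (enlarge_row lam mu hk), height_append_castSucc_cons ha,
    height_append_castSucc_cons ha', total_append, total_append, h2] at h3
  rw [AllRaised] at hb ⊢
  omega

theorem rawFBar_enlarge {lam mu : StrictShape m} {T T' : Tableau m}
    (hT : IsSDT lam T) (hF : rawFBar T = some T') :
    rawFBar (enlarge lam mu T) = some (enlarge lam mu T') := by
  obtain ⟨k, l, r, hk, rfl, ha, -⟩ := rawFBar_eq_some_iff.1 hF
  have hkj := le_of_rawFBar hT hk ha
  rw [rawFBar_eq_some_iff]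
  refine ⟨k, _, r, enlarge_row lam mu hk, enlarge_update .., ?_, trivial⟩
  intro x hx
  rcases List.mem_append.1 hx with hx | hx
  · rw [above, List.mem_flatMap] at hx
    obtain ⟨k', hk', hx⟩ := hx
    -- Boxes added above the row of the letter 2 carry letters greater than 2, so they do not affect
    -- which 1 or 2 is read first.
    rw [List.mem_reverse, enlarge, List.mem_append] at hx
    rcases hx with hx | hx
    · obtain rfl := List.eq_of_mem_replicate hx
      have h1 := (mem_take_finRange.1 hk').trans_le hkj
      rw [← Fin.rev_lt_rev, Fin.rev_castSucc, Fin.rev_rev] at h1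
      exact ⟨(Fin.castSucc_lt_succ.trans h1).ne', h1.ne'⟩
    · refine ha x (List.mem_append_left _ ?_)
      rw [above, List.mem_flatMap]
      exact ⟨k', hk', List.mem_reverse.2 hx⟩
  · exact ha x (List.mem_append_right _ hx)

theorem rawE_enlarge {lam mu : StrictShape m} (h : lam ≤ mu) {T T' : Tableau m}
    (hT : IsSDT lam T) {i : Fin (m + 1)} (hE : rawE i T = some T') :
    rawE i (enlarge lam mu T) = some (enlarge lam mu T') := by
  have hT' := stableUnder_rawE lam i T T' hT hE
  rw [rawE_eq_some_iff_rawF] at hE ⊢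
  exact rawF_enlarge h hT' hE

theorem rawEBar_enlarge {lam mu : StrictShape m} {T T' : Tableau m}
    (hT : IsSDT lam T) (hE : rawEBar T = some T') :
    rawEBar (enlarge lam mu T) = some (enlarge lam mu T') := by
  have hT' := stableUnder_rawEBar lam T T' hT hE
  rw [rawEBar_eq_some_iff_rawFBar] at hE ⊢
  exact rawFBar_enlarge hT' hE

/-! ### The effect of the operators on cores -/

/-- A letter `i` in the row of `i + 1` or above it is changed to `i + 1`, and the letter
to the right of it is not `i + 1`. -/
def IsMove (i : Fin (m + 1)) (T T' : Tableau m) : Prop :=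
  ∃ k l r, T k = l ++ i.castSucc :: r ∧ T' = Function.update T k (l ++ i.succ :: r) ∧
    k ≤ i.rev.castSucc ∧ ∀ x ∈ r.head?, x ≠ i.succ

/-- The right neighbour is read immediately before the changed letter; were it an i+1, it would be
an uncancelled one. -/
theorem isMove_of_rawF {lam : StrictShape m} {T T' : Tableau m} (hT : IsSDT lam T)
    {i : Fin (m + 1)} (hF : rawF i T = some T') : IsMove i T T' := by
  obtain ⟨j, rfl⟩ := Fin.rev_surjective i
  obtain ⟨k, l, r, hk, rfl, ha, hb⟩ := rawF_eq_some_iff.1 hF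
  refine ⟨k, l, r, hk, rfl, by rw [Fin.rev_rev]; exact le_of_rawF hT hk ha, ?_⟩
  rintro x hx rfl
  cases r with
  | nil => simp at hx
  | cons y r =>
    obtain rfl : y = j.rev.succ := by simpa using hx
    rw [AllLowered, List.reverse_cons, ← List.append_assoc] at ha
    have := height_eq_total_of_append ha
    simp [height_cons] at this

theorem isMove_of_rawFBar {lam : StrictShape m} {T T' : Tableau m} (hT : IsSDT lam T)
    (hF : rawFBar T = some T') : IsMove 0 T T' := by
  obtain ⟨k, l, r, hk, rfl, ha, -⟩ := rawFBar_eq_some_iff.1 hF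
  refine ⟨k, l, r, hk, rfl, le_of_rawFBar hT hk ha, fun x hx => (ha x ?_).2⟩
  exact List.mem_append_right _ (List.mem_reverse.2 (List.mem_of_mem_head? hx))

theorem IsMove.length_eq {i : Fin (m + 1)} {T T' : Tableau m} (h : IsMove i T T')
    (k : Fin (m + 2)) : (T' k).length = (T k).length := by
  obtain ⟨k', l, r, hk, rfl, -, -⟩ := h
  by_cases hkk : k = k'
  · subst hkk; simp [hk]
  · rw [Function.update_of_ne hkk]

/-- The run can only grow if the letter directly after it becomes the letter of the row, which
forces the row of i+1. It then grows by exactly one, because the next letter is not i+1. -/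
theorem IsMove.length_core {i : Fin (m + 1)} {T T' : Tableau m} (h : IsMove i T T') :
    (∀ k, (core T' k).length = (core T k).length) ∨
      ((core T' i.rev.castSucc).length + 1 = (core T i.rev.castSucc).length ∧
        ∀ k, k ≠ i.rev.castSucc → (core T' k).length = (core T k).length) := by
  obtain ⟨k, l, r, hk, rfl, hle, hr⟩ := h
  have hne : ∀ k', k' ≠ k → core (Function.update T k (l ++ i.succ :: r)) k' = core T k' := by
    intro k' hk'
    rw [core, core, Function.update_of_ne hk']
  have hi : i.castSucc ≠ k.rev := by
    rw [← Fin.rev_le_rev, Fin.rev_castSucc, Fin.rev_rev] at hle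
    exact (Fin.castSucc_lt_succ.trans_le hle).ne
  have h1 : core T k = (l ++ i.castSucc :: r).dropWhile (fun x => x = k.rev) := by rw [core, hk]
  have h2 : core (Function.update T k (l ++ i.succ :: r)) k =
      (l ++ i.succ :: r).dropWhile (fun x => x = k.rev) := by rw [core, Function.update_self]
  rw [List.dropWhile_append] at h1 h2
  by_cases hcase : (l.dropWhile (fun x => x = k.rev)).isEmpty ∧ i.succ = k.rev
  · obtain ⟨h3, h4⟩ := hcase
    right
    have h5 : k = i.rev.castSucc := by rw [← Fin.rev_rev k, ← h4, Fin.rev_succ]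
    rw [if_pos h3, List.dropWhile_cons_of_neg (by simpa using hi)] at h1
    rw [if_pos h3, List.dropWhile_cons_of_pos (by simpa using h4),
      dropWhile_eq_self_of_head (by rwa [← h4])] at h2
    subst h5
    exact ⟨by rw [h1, h2]; simp, fun k' hk' => by rw [hne k' hk']⟩
  · left
    intro k'
    by_cases hkk : k' = k
    · subst hkk
      rw [h1, h2]
      split_ifs with h3
      · have h4 : ¬ i.succ = k'.rev := fun h4 => hcase ⟨h3, h4⟩
        rw [List.dropWhile_cons_of_neg (by simpa using h4),
          List.dropWhile_cons_of_neg (by simpa using hi)]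
        simp
      · simp
    · rw [hne k' hkk]

/-! ### Dual marginally large tableaux -/

@[simp] theorem lengthBelow_castSucc (T : Tableau m) (j : Fin (m + 1)) :
    lengthBelow T j.castSucc = (T j.succ).length := by
  rw [lengthBelow, dif_pos (by simp; omega)]
  rfl

@[simp] theorem lengthBelow_last (T : Tableau m) : lengthBelow T (Fin.last (m + 1)) = 0 := by
  rw [lengthBelow, dif_neg (by simp)]

theorem isDualMarginallyLarge_iff_run {T : Tableau m} :
    IsDualMarginallyLarge T ↔ ∀ k, run T k = lengthBelow T k + 1 := by
  refine ⟨fun h => h.2, fun h => ⟨fun k hk => ?_, h⟩⟩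
  have h1 := h k
  have h2 := length_row T k
  rw [hk, List.length_nil] at h2
  omega

/-- In this form the condition is a recursion for the row lengths in terms of the core. -/
theorem isDualMarginallyLarge_iff {T : Tableau m} : IsDualMarginallyLarge T ↔
    ∀ k, (T k).length = lengthBelow T k + 1 + (core T k).length := by
  rw [isDualMarginallyLarge_iff_run]
  refine forall_congr' fun k => ?_
  rw [length_row]
  omega

theorem IsDualMarginallyLarge.inSDTInf {T : Tableau m} (h : IsDualMarginallyLarge T)
    (hhook : ∀ k, T k ≠ [] → IsHookWord (T k)) (hle : ∀ k, ∀ x ∈ T k, x ≤ k.rev) :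
    InSDTInf T := by
  have h1 : ∀ j : Fin (m + 1), (T j.succ).length < run T j.castSucc := by
    intro j
    rw [isDualMarginallyLarge_iff_run.1 h, lengthBelow_castSucc]
    omega
  have h2 : ∀ j : Fin (m + 1), (T j.succ).length < (T j.castSucc).length := fun j =>
    (h1 j).trans_le (by rw [length_row]; omega)
  exact ⟨⟨⟨fun k => (T k).length, fun j => (h2 j).le, fun j hj => absurd hj (h2 j).ne'⟩,
    isSDT_of_run (fun _ => rfl) hhook hle h1⟩, h⟩

theorem core_pushIn (h : ℕ) (T : Tableau m) : core (pushIn h T) = core T := by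
  funext k
  rw [core, core, pushIn]
  split_ifs
  · rw [List.dropWhile_cons_of_pos (by simp)]
  · rfl

theorem core_pushOut {h : ℕ} {T : Tableau m} (hT : ∀ k, k.val < h → 0 < run T k) :
    core (pushOut h T) = core T := by
  funext k
  by_cases hk : k.val < h
  · have h1 := row_eq T k
    obtain ⟨c, hc⟩ := Nat.exists_eq_succ_of_ne_zero (hT k hk).ne'
    refine core_eq_of_row (c := c) ?_ (head_core_ne T k)
    rw [pushOut, if_pos hk]
    conv_lhs => rw [h1, hc, List.replicate_succ, List.cons_append, List.tail_cons]
  · rw [core, pushOut, if_neg hk]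
    rfl

theorem length_pushIn (h : ℕ) (T : Tableau m) (k : Fin (m + 2)) :
    (pushIn h T k).length = (T k).length + if k.val < h then 1 else 0 := by
  rw [pushIn]
  split_ifs <;> simp

theorem length_pushOut (h : ℕ) (T : Tableau m) (k : Fin (m + 2)) :
    (pushOut h T k).length = (T k).length - if k.val < h then 1 else 0 := by
  rw [pushOut]
  split_ifs <;> simp

theorem lengthBelow_congr {T T' : Tableau m} (h : ∀ k, (T' k).length = (T k).length)
    (k : Fin (m + 2)) : lengthBelow T' k = lengthBelow T k := by
  rw [lengthBelow, lengthBelow]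
  split_ifs
  · exact h _
  · rfl

theorem succ_lt_columnHeight_iff {i j : Fin (m + 1)} :
    (j.succ).val < columnHeight i ↔ j < i.rev := by
  rw [columnHeight, Fin.lt_def, Fin.val_succ, Fin.val_rev]
  omega

theorem castSucc_lt_columnHeight_iff {i j : Fin (m + 1)} :
    (j.castSucc).val < columnHeight i ↔ j ≤ i.rev := by
  rw [columnHeight, Fin.le_def, Fin.val_castSucc, Fin.val_rev]
  omega

theorem last_not_lt_columnHeight (i : Fin (m + 1)) :
    ¬ (Fin.last (m + 1)).val < columnHeight i := by
  rw [columnHeight, Fin.val_last]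
  omega

/-- If marginality is lost, the core has gained one letter in the row of i+1. The length recursion
then asks for one more box in this row and in every row above it, which is the trivial column pushed
in. -/
theorem IsMove.fixE {lam : StrictShape m} {i : Fin (m + 1)} {T T' : Tableau m}
    (h : IsMove i T T') (hT : IsSDT lam T) (hT' : IsDualMarginallyLarge T') :
    InSDTInf (fixE i T) ∧ core (fixE i T) = core T := by
  rw [QueerCrystal.fixE]
  split_ifs with hD
  · exact ⟨⟨⟨lam, hT⟩, hD⟩, rfl⟩
  refine ⟨?_, core_pushIn _ _⟩
  rw [isDualMarginallyLarge_iff] at hT' hD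
  simp only [h.length_eq, lengthBelow_congr h.length_eq] at hT'
  rcases h.length_core with h1 | ⟨h1, h2⟩
  · simp only [h1] at hT'
    exact absurd hT' hD
  refine IsDualMarginallyLarge.inSDTInf ?_ ?_ ?_
  · rw [isDualMarginallyLarge_iff]
    intro k
    have h3 := hT' k
    rw [core_pushIn]
    cases k using Fin.lastCases with
    | last =>
      rw [lengthBelow_last] at h3 ⊢
      rw [length_pushIn, if_neg (last_not_lt_columnHeight i), h3,
        h2 _ (Fin.castSucc_lt_last _).ne']
      rfl
    | cast j =>
      rw [lengthBelow_castSucc] at h3 ⊢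
      rw [length_pushIn, length_pushIn]
      simp only [succ_lt_columnHeight_iff, castSucc_lt_columnHeight_iff]
      -- Above the row of i+1 both this row and the next gain a box; in that row the box compensates
      -- the new core letter; below it nothing changes.
      rcases lt_trichotomy j i.rev with hj | rfl | hj
      · rw [h2 _ (fun h => hj.ne (Fin.castSucc_injective _ h))] at h3
        rw [if_pos hj, if_pos hj.le]; omega
      · rw [if_pos le_rfl, if_neg (lt_irrefl _)]; omega
      · rw [h2 _ (fun h => hj.ne' (Fin.castSucc_injective _ h))] at h3
        rw [if_neg (not_lt.2 hj.le), if_neg (not_le.2 hj)]; omega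
  · intro k hk
    rw [pushIn] at hk ⊢
    split_ifs at hk ⊢ with hkh
    · exact IsHookWord.cons (hT.hook k) fun x hx => hT.le_rev k x (List.mem_of_mem_head? hx)
    · exact hT.hook k hk
  · intro k x hx
    rw [pushIn] at hx
    split_ifs at hx
    · rcases List.mem_cons.1 hx with rfl | hx
      · exact le_rfl
      · exact hT.le_rev k x hx
    · exact hT.le_rev k x hx

/-- The reverse correction: the core has lost one letter in the row of i+1, so that row and those
above must each lose a box. Since every run is nonempty, the removed box belongs to a run and the
core is untouched. -/
theorem IsMove.fixF {lam : StrictShape m} {i : Fin (m + 1)} {T T' : Tableau m}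
    (h : IsMove i T T') (hT' : IsSDT lam T') (hT : IsDualMarginallyLarge T) :
    InSDTInf (fixF i T') ∧ core (fixF i T') = core T' := by
  rw [QueerCrystal.fixF]
  split_ifs with hD
  · exact ⟨⟨⟨lam, hT'⟩, hD⟩, rfl⟩
  rw [isDualMarginallyLarge_iff] at hT hD
  simp only [← h.length_eq, ← lengthBelow_congr h.length_eq] at hT
  rcases h.length_core with h1 | ⟨h1, h2⟩
  · simp only [← h1] at hT
    exact absurd hT hD
  have hrun : ∀ k, 0 < run T' k := by
    intro k
    have h3 := hT k
    have h4 := length_row T' k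
    by_cases hk : k = i.rev.castSucc
    · subst hk; omega
    · rw [← h2 k hk] at h3; omega
  have hcore := core_pushOut (h := columnHeight i) fun k _ => hrun k
  refine ⟨IsDualMarginallyLarge.inSDTInf ?_ ?_ ?_, hcore⟩
  · rw [isDualMarginallyLarge_iff, hcore]
    intro k
    have h3 := hT k
    cases k using Fin.lastCases with
    | last =>
      rw [lengthBelow_last] at h3 ⊢
      rw [length_pushOut, if_neg (last_not_lt_columnHeight i), h3,
        h2 _ (Fin.castSucc_lt_last _).ne']
      rfl
    | cast j =>
      rw [lengthBelow_castSucc] at h3 ⊢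
      rw [length_pushOut, length_pushOut]
      simp only [succ_lt_columnHeight_iff, castSucc_lt_columnHeight_iff]
      have h4 := length_row T' j.succ
      have h5 := hrun j.succ
      rcases lt_trichotomy j i.rev with hj | rfl | hj
      · rw [← h2 _ (fun h => hj.ne (Fin.castSucc_injective _ h))] at h3
        rw [if_pos hj, if_pos hj.le]; omega
      · rw [if_pos le_rfl, if_neg (lt_irrefl _)]; omega
      · rw [← h2 _ (fun h => hj.ne' (Fin.castSucc_injective _ h))] at h3
        rw [if_neg (not_lt.2 hj.le), if_neg (not_le.2 hj)]; omega
  · intro k hk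
    have hsub : (pushOut (columnHeight i) T' k).Sublist (T' k) := by
      rw [pushOut]
      split_ifs
      · exact List.tail_sublist _
      · exact List.Sublist.refl _
    refine (hT'.hook k ?_).sublist hsub hk
    intro h0
    rw [h0, List.sublist_nil] at hsub
    exact hk hsub
  · intro k x hx
    refine hT'.le_rev k x ?_
    rw [pushOut] at hx
    split_ifs at hx
    · exact List.mem_of_mem_tail hx
    · exact hx

theorem fixF_of_rawF {i : Fin (m + 1)} {T T1 : Tableau m} {lam : StrictShape m}
    (hT : IsSDT lam T) (hD : IsDualMarginallyLarge T) (h : rawF i T = some T1) :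
    InSDTInf (fixF i T1) ∧ core (fixF i T1) = core T1 :=
  (isMove_of_rawF hT h).fixF (stableUnder_rawF lam i T T1 hT h) hD

theorem fixE_of_rawE {i : Fin (m + 1)} {T T1 : Tableau m} {lam : StrictShape m}
    (hT : IsSDT lam T) (hD : IsDualMarginallyLarge T) (h : rawE i T = some T1) :
    InSDTInf (fixE i T1) ∧ core (fixE i T1) = core T1 := by
  have h1 := stableUnder_rawE lam i T T1 hT h
  exact (isMove_of_rawF h1 (rawE_eq_some_iff_rawF.1 h)).fixE h1 hD

theorem fixF_of_rawFBar {T T1 : Tableau m} {lam : StrictShape m} (hT : IsSDT lam T)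
    (hD : IsDualMarginallyLarge T) (h : rawFBar T = some T1) :
    InSDTInf (fixF 0 T1) ∧ core (fixF 0 T1) = core T1 :=
  (isMove_of_rawFBar hT h).fixF (stableUnder_rawFBar lam T T1 hT h) hD

theorem fixE_of_rawEBar {T T1 : Tableau m} {lam : StrictShape m} (hT : IsSDT lam T)
    (hD : IsDualMarginallyLarge T) (h : rawEBar T = some T1) :
    InSDTInf (fixE 0 T1) ∧ core (fixE 0 T1) = core T1 := by
  have h1 := stableUnder_rawEBar lam T T1 hT h
  exact (isMove_of_rawFBar h1 (rawEBar_eq_some_iff_rawFBar.1 h)).fixE h1 hD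

/-! ### Nonvanishing of operators -/

/-- The run of i+1 exceeds the length of the next row, hence the number of letters i there, so at
least one i+1 stays uncancelled. -/
theorem rawE_ne_none {lam : StrictShape m} {T : Tableau m} (hT : IsSDT lam T)
    (hD : IsDualMarginallyLarge T) (i : Fin (m + 1)) : rawE i T ≠ none := by
  obtain ⟨j, rfl⟩ := Fin.rev_surjective i
  rw [Ne, rawE_eq_none_iff, hT.height_letters, hT.total_letters]
  have h1 := total_le_height j.rev (activeWord T j)
  have h2 := isDualMarginallyLarge_iff_run.1 hD j.castSucc
  rw [lengthBelow_castSucc] at h2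
  have h3 := List.count_le_length (a := j.rev.castSucc) (l := T j.succ)
  omega

/-- In a dual marginally large tableau one of the two odd operators does not vanish. -/
theorem rawEBar_or_rawFBar {T : Tableau m} (hD : IsDualMarginallyLarge T) :
    (∃ T', rawEBar T = some T') ∨ ∃ T', rawFBar T = some T' := by
  set j := Fin.rev (0 : Fin (m + 1)) with hj
  have hmem : Fin.succ 0 ∈ letters T := by
    rw [letters, List.mem_flatMap]
    refine ⟨j.castSucc, List.mem_finRange _, ?_⟩
    rw [List.mem_reverse, row_eq T j.castSucc, isDualMarginallyLarge_iff_run.1 hD,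
      Fin.rev_castSucc, hj, Fin.rev_rev]
    simp
  rw [← map_snd_reading, List.mem_map] at hmem
  obtain ⟨p, hp, hp2⟩ := hmem
  have hsome : (firstOneTwo T).isSome := by
    rw [firstOneTwo, List.find?_isSome]
    exact ⟨p, hp, by simp [hp2]⟩
  obtain ⟨q, hq⟩ := Option.isSome_iff_exists.1 hsome
  rcases (firstOneTwo_eq_some_iff.1 hq).1 with h | h
  · exact Or.inr ⟨_, by rw [rawFBar, hq, Option.bind_some, if_pos h]⟩
  · exact Or.inl ⟨_, by rw [rawEBar, hq, Option.bind_some, if_pos h]⟩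

theorem rawEBar_eq_none_of_rawFBar {T T' : Tableau m} (h : rawFBar T = some T') :
    rawEBar T = none := by
  rw [rawFBar, Option.bind_eq_some_iff] at h
  obtain ⟨p, hp, h⟩ := h
  split_ifs at h with h1
  rw [rawEBar, hp, Option.bind_some, if_neg]
  rw [h1]
  exact (succ_ne_castSucc 0).symm

/-! ### The dual marginally large tableau with a given core -/

/-- The length of row `k` of the dual marginally large tableau with the same core as `T`. -/
def marginalLength (T : Tableau m) (k : Fin (m + 2)) : ℕ :=
  ∑ l ∈ Finset.Ici k, (1 + (core T l).length)

theorem marginalLength_last (T : Tableau m) :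
    marginalLength T (Fin.last (m + 1)) = 1 + (core T (Fin.last (m + 1))).length := by
  rw [marginalLength, show Finset.Ici (Fin.last (m + 1)) = {Fin.last (m + 1)} from ?_,
    Finset.sum_singleton]
  ext x
  simp [Fin.last_le_iff]

theorem marginalLength_castSucc (T : Tableau m) (j : Fin (m + 1)) :
    marginalLength T j.castSucc =
      marginalLength T j.succ + 1 + (core T j.castSucc).length := by
  have : Finset.Ici j.castSucc = insert j.castSucc (Finset.Ici j.succ) := by
    ext x
    rw [Finset.mem_insert, Finset.mem_Ici, Finset.mem_Ici, le_iff_eq_or_lt,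
      castSucc_lt_iff_succ_le, eq_comm]
  rw [marginalLength, this, Finset.sum_insert (by simp)]
  rw [marginalLength]
  omega

/-- The dual marginally large tableau with the same core as `T`. -/
def marginalize (T : Tableau m) : Tableau m := fun k =>
  List.replicate (marginalLength T k - (core T k).length) k.rev ++ core T k

theorem core_marginalize (T : Tableau m) : core (marginalize T) = core T :=
  funext fun k => core_eq_of_row rfl (head_core_ne T k)

theorem length_marginalize (T : Tableau m) (k : Fin (m + 2)) :
    (marginalize T k).length = marginalLength T k := by
  -- The core of row k is part of one summand, so the subtraction in `marginalize` does not
  -- truncate.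
  have h : (core T k).length ≤ marginalLength T k := by
    rw [marginalLength]
    refine le_trans ?_ (Finset.single_le_sum (f := fun l => 1 + (core T l).length)
      (fun _ _ => Nat.zero_le _) (Finset.mem_Ici.2 le_rfl))
    simp
  simp [marginalize, h]

theorem isDualMarginallyLarge_marginalize (T : Tableau m) :
    IsDualMarginallyLarge (marginalize T) := by
  rw [isDualMarginallyLarge_iff, core_marginalize]
  intro k
  cases k using Fin.lastCases with
  | last => rw [length_marginalize, marginalLength_last, lengthBelow_last, Nat.zero_add]
  | cast j => rw [lengthBelow_castSucc, length_marginalize, length_marginalize,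
      marginalLength_castSucc]

theorem inSDTInf_marginalize {lam : StrictShape m} {T : Tableau m} (hT : IsSDT lam T) :
    InSDTInf (marginalize T) := by
  have hmem : ∀ k, ∀ x ∈ core T k, x ≤ k.rev := fun k x hx =>
    hT.le_rev k x ((core_sublist T k).subset hx)
  refine (isDualMarginallyLarge_marginalize T).inSDTInf (fun k => ?_) fun k x hx => ?_
  · refine isHookWord_replicate_append (fun h => ?_)
      (fun x hx => hmem k x (List.mem_of_mem_head? hx)) _
    refine (hT.hook k ?_).sublist (core_sublist T k) h
    intro h0
    have := core_sublist T k
    rw [h0, List.sublist_nil] at this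
    exact h this
  · rcases List.mem_append.1 hx with hx | hx
    · exact (List.eq_of_mem_replicate hx).le
    · exact hmem k x hx

theorem IsDualMarginallyLarge.length_eq {T : Tableau m} (h : IsDualMarginallyLarge T)
    (k : Fin (m + 2)) : (T k).length = marginalLength T k := by
  rw [isDualMarginallyLarge_iff] at h
  induction k using Fin.reverseInduction with
  | last => rw [h, marginalLength_last, lengthBelow_last, Nat.zero_add]
  | cast j ih => rw [h, marginalLength_castSucc, lengthBelow_castSucc, ih]

/-- The core determines all row lengths by recursion from the last row, and then the tableau. -/
theorem IsDualMarginallyLarge.eq_of_core {T T' : Tableau m} (h : IsDualMarginallyLarge T)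
    (h' : IsDualMarginallyLarge T') (hc : core T = core T') : T = T' := by
  refine eq_of_core_eq (fun k => ?_) hc
  rw [h.length_eq, h'.length_eq, marginalLength, marginalLength, hc]

/-! ### The crystals `SDT(λ) ⊗ T_{-λ}` -/

theorem restrict_eq_some_iff {P : Tableau m → Prop} {o : Option (Tableau m)}
    {T : {T : Tableau m // P T}} : restrict P o = some T ↔ o = some T.1 := by
  rw [restrict, Option.bind_eq_some_iff]
  constructor
  · rintro ⟨S, h1, h2⟩
    split_ifs at h2 with h3
    rw [h1, ← Option.some.inj h2]
  · intro h
    exact ⟨T.1, h, dif_pos T.2⟩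

theorem isSDT_tableauOf {lam : StrictShape m} (b : (shiftedSDT lam).carrier) :
    IsSDT lam (tableauOf b) :=
  (show {T : Tableau m // IsSDT lam T} × Unit from b).1.2

theorem tableauOf_injective {lam : StrictShape m} :
    Function.Injective (tableauOf (lam := lam)) := by
  rintro ⟨⟨T, hT⟩, ⟨⟩⟩ ⟨⟨T', hT'⟩, ⟨⟩⟩ h
  obtain rfl : T = T' := h
  rfl

theorem shiftedSDT_wt {lam : StrictShape m} (b : (shiftedSDT lam).carrier) :
    (shiftedSDT lam).wt b = content (tableauOf b) - lowestWeight lam.parts :=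
  (sub_eq_add_neg _ _).symm

theorem shiftedSDT_eps {lam : StrictShape m} (i : Fin (m + 1)) (b : (shiftedSDT lam).carrier) :
    (shiftedSDT lam).eps i b = ((redCount i i.succ (tableauOf b) +
      wtDiff i (lowestWeight lam.parts) : ℤ) : WithBot ℤ) := by
  have h : -wtDiff i (-lowestWeight lam.parts) = wtDiff i (lowestWeight lam.parts) := by
    simp only [wtDiff, Pi.neg_apply]; ring
  rw [WithBot.coe_add, ← h]
  exact max_eq_right bot_le

theorem shiftedSDT_phi {lam : StrictShape m} (i : Fin (m + 1)) (b : (shiftedSDT lam).carrier) :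
    (shiftedSDT lam).phi i b = ((redCount i i.castSucc (tableauOf b) : ℤ) : WithBot ℤ) := by
  refine max_eq_left ?_
  exact bot_le

theorem map_mkShifted_eq_some_iff {lam : StrictShape m} {o : Option (Tableau m)}
    {b : (shiftedSDT lam).carrier} :
    ((restrict (IsSDT lam) o).map fun c => mkShifted c.1 c.2) = some b ↔
      o = some (tableauOf b) := by
  rw [Option.map_eq_some_iff]
  constructor
  · rintro ⟨c, h1, h2⟩
    rw [restrict_eq_some_iff] at h1
    rw [h1, ← h2]
    rfl
  · intro h
    exact ⟨⟨tableauOf b, isSDT_tableauOf b⟩, restrict_eq_some_iff.2 h, rfl⟩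

/-- The tensor rule compares with the value -∞ of the one-element crystal. For e_i the comparison is
strict, so finiteness of ε_i is needed. -/
theorem tensor_tCrystal_e {B : CrystalData m} {μ : Weight m} {i : Fin (m + 1)} {b : B.carrier}
    (h : B.eps i b ≠ ⊥) (u : (tCrystal μ).carrier) :
    (tensor B (tCrystal μ)).e i (b, u) = (B.e i b).map fun c => (c, u) :=
  if_pos (bot_lt_iff_ne_bot.2 h)

theorem tensor_tCrystal_f {B : CrystalData m} {μ : Weight m} {i : Fin (m + 1)} {b : B.carrier}
    (u : (tCrystal μ).carrier) :
    (tensor B (tCrystal μ)).f i (b, u) = (B.f i b).map fun c => (c, u) := by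
  have h : (tCrystal μ).phi i u ≤ B.eps i b := bot_le
  simp only [tensor, if_pos h]

theorem shiftedSDT_e {lam : StrictShape m} {i : Fin (m + 1)} {b b' : (shiftedSDT lam).carrier} :
    (shiftedSDT lam).e i b = some b' ↔ rawE i (tableauOf b) = some (tableauOf b') := by
  rw [← map_mkShifted_eq_some_iff]
  have : (shiftedSDT lam).e i b =
      (restrict (IsSDT lam) (rawE i (tableauOf b))).map fun c => mkShifted c.1 c.2 := by
    refine (tensor_tCrystal_e (B := sdt lam) ?_ b.2).trans rfl
    exact WithBot.coe_ne_bot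
  rw [this]

theorem shiftedSDT_f {lam : StrictShape m} {i : Fin (m + 1)} {b b' : (shiftedSDT lam).carrier} :
    (shiftedSDT lam).f i b = some b' ↔ rawF i (tableauOf b) = some (tableauOf b') := by
  rw [← map_mkShifted_eq_some_iff]
  have : (shiftedSDT lam).f i b =
      (restrict (IsSDT lam) (rawF i (tableauOf b))).map fun c => mkShifted c.1 c.2 := by
    exact (tensor_tCrystal_f (B := sdt lam) (i := i) (b := b.1) b.2).trans rfl
  rw [this]

theorem shiftedSDT_eBar {lam : StrictShape m} {b b' : (shiftedSDT lam).carrier} :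
    (shiftedSDT lam).eBar b = some b' ↔ rawEBar (tableauOf b) = some (tableauOf b') := by
  rw [← map_mkShifted_eq_some_iff]
  have : (shiftedSDT lam).eBar b =
      (restrict (IsSDT lam) (rawEBar (tableauOf b))).map fun c => mkShifted c.1 c.2 := by
    -- When both odd operators vanish on T the rule turns to the second factor, where the value is
    -- also zero.
    refine ite_eq_right_iff.2 fun h => ?_
    have h1 : restrict (IsSDT lam) (rawEBar (tableauOf b)) = none := h.1
    exact (congrArg (Option.map fun c => mkShifted c.1 c.2) h1).symm
  rw [this]

theorem shiftedSDT_fBar {lam : StrictShape m} {b b' : (shiftedSDT lam).carrier} :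
    (shiftedSDT lam).fBar b = some b' ↔ rawFBar (tableauOf b) = some (tableauOf b') := by
  rw [← map_mkShifted_eq_some_iff]
  have : (shiftedSDT lam).fBar b =
      (restrict (IsSDT lam) (rawFBar (tableauOf b))).map fun c => mkShifted c.1 c.2 := by
    refine ite_eq_right_iff.2 fun h => ?_
    have h1 : restrict (IsSDT lam) (rawFBar (tableauOf b)) = none := h.2
    exact (congrArg (Option.map fun c => mkShifted c.1 c.2) h1).symm
  rw [this]

theorem wtDiff_content (i : Fin (m + 1)) (T : Tableau m) :
    wtDiff i (content T) = total i (letters T) := by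
  have h : ∀ x, (content T x : ℤ) = (letters T).count x := by
    intro x
    rw [content, letters, List.count_flatMap, ← Fin.sum_univ_def]
    push_cast
    simp
  rw [wtDiff, h, h, total_eq_count]

/-! ### The odd operators commute with the operators for `i ≥ 3` -/

theorem setBox_comm (T : Tableau m) {c d : Box m} (h : c ≠ d) (x y : Fin (m + 2)) :
    setBox (setBox T c x) d y = setBox (setBox T d y) c x := by
  obtain ⟨k, j⟩ := c
  obtain ⟨k', j'⟩ := d
  by_cases hk : k = k'
  · subst hk
    have hj : j ≠ j' := fun hj => h (by rw [hj])
    simp [setBox, List.set_comm _ _ hj]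
  · simp only [setBox, Function.update_of_ne hk, Function.update_of_ne (Ne.symm hk)]
    exact Function.update_comm hk _ _ _

/-- The box and the new letter for `e_i`. -/
def selectE (i : Fin (m + 1)) (T : Tableau m) : Option (Box m × Fin (m + 2)) :=
  ((red i T).find? fun p => p.2 = i.succ).map fun p => (p.1, i.castSucc)

/-- The box and the new letter for `f_i`. -/
def selectF (i : Fin (m + 1)) (T : Tableau m) : Option (Box m × Fin (m + 2)) :=
  ((red i T).reverse.find? fun p => p.2 = i.castSucc).map fun p => (p.1, i.succ)

/-- The box and the new letter for `e_{\bar 1}`. -/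
def selectEBar (T : Tableau m) : Option (Box m × Fin (m + 2)) :=
  (firstOneTwo T).bind fun p =>
    if p.2 = Fin.succ 0 then some (p.1, Fin.castSucc 0) else none

/-- The box and the new letter for `f_{\bar 1}`. -/
def selectFBar (T : Tableau m) : Option (Box m × Fin (m + 2)) :=
  (firstOneTwo T).bind fun p =>
    if p.2 = Fin.castSucc 0 then some (p.1, Fin.succ 0) else none

/-- Perform the selected change. -/
def applySelect (s : Tableau m → Option (Box m × Fin (m + 2))) (T : Tableau m) :
    Option (Tableau m) := (s T).map fun p => setBox T p.1 p.2

theorem rawE_eq_applySelect (i : Fin (m + 1)) : rawE i = applySelect (selectE i) := by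
  funext T; simp [rawE, applySelect, selectE, Function.comp_def]

theorem rawF_eq_applySelect (i : Fin (m + 1)) : rawF i = applySelect (selectF i) := by
  funext T; simp [rawF, applySelect, selectF, Function.comp_def]

theorem rawEBar_eq_applySelect : rawEBar (m := m) = applySelect selectEBar := by
  funext T
  rw [rawEBar, applySelect, selectEBar, Option.map_bind]
  congr 1
  funext p
  simp only [Function.comp]
  split_ifs <;> rfl

theorem rawFBar_eq_applySelect : rawFBar (m := m) = applySelect selectFBar := by
  funext T
  rw [rawFBar, applySelect, selectFBar, Option.map_bind]
  congr 1
  funext p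
  simp only [Function.comp]
  split_ifs <;> rfl

/-- Neither change affects the other selection, and changes in distinct boxes commute. -/
theorem applySelect_comm {s t : Tableau m → Option (Box m × Fin (m + 2))} {T : Tableau m}
    (hst : ∀ p, s T = some p → t (setBox T p.1 p.2) = t T)
    (hts : ∀ p, t T = some p → s (setBox T p.1 p.2) = s T)
    (hne : ∀ p q, s T = some p → t T = some q → p.1 ≠ q.1) :
    (applySelect s T).bind (applySelect t) = (applySelect t T).bind (applySelect s) := by
  simp only [applySelect]
  rcases h1 : s T with - | p <;> rcases h2 : t T with - | q
  · rfl
  · simp [applySelect, hts q h2, h1]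
  · simp [applySelect, hst p h1, h2]
  · simp [applySelect, hts q h2, hst p h1, h1, h2, setBox_comm T (hne p q h1 h2)]

/-- `c` is a box of `T` whose letter satisfies `P`. -/
def HasLetter (P : Fin (m + 2) → Prop) (T : Tableau m) (c : Box m) : Prop :=
  ∃ x, P x ∧ (c, x) ∈ reading T

theorem HasLetter.ne {P Q : Fin (m + 2) → Prop} {T : Tableau m} {c d : Box m}
    (hc : HasLetter P T c) (hd : HasLetter Q T d) (hPQ : ∀ x, P x → ¬ Q x) : c ≠ d := by
  rintro rfl
  obtain ⟨x, hx, h1⟩ := hc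
  obtain ⟨y, hy, h2⟩ := hd
  have h3 := List.inj_on_of_nodup_map (nodup_map_fst_reading T) h1 h2 rfl
  obtain rfl : x = y := congrArg Prod.snd h3
  exact hPQ x hx hy

theorem red_setBox {i : Fin (m + 1)} {T : Tableau m} {c : Box m} {y : Fin (m + 2)}
    (hc : HasLetter (fun x => sgn i x = 0) T c) (hy : sgn i y = 0) :
    red i (setBox T c y) = red i T := by
  obtain ⟨x, hx, hmem⟩ := hc
  obtain ⟨a, b, h⟩ := List.append_of_mem hmem
  have hstep : ∀ z : Fin (m + 2), sgn i z = 0 → ∀ st, bracketStep i st (c, z) = st := by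
    intro z hz st
    rcases sgn_cases i z with h | h | h
    · omega
    · omega
    · exact bracketStep_of_ne h.1 h.2.1
  rw [red, red, reading_setBox_of_eq h, h]
  simp only [List.foldl_append, List.foldl_cons, hstep x hx, hstep y hy]

theorem firstOneTwo_setBox {T : Tableau m} {c : Box m} {y : Fin (m + 2)}
    (hc : HasLetter (fun x => ¬ (x = Fin.castSucc 0 ∨ x = Fin.succ 0)) T c)
    (hy : ¬ (y = Fin.castSucc 0 ∨ y = Fin.succ 0)) :
    firstOneTwo (setBox T c y) = firstOneTwo T := by
  obtain ⟨x, hx, hmem⟩ := hc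
  obtain ⟨a, b, h⟩ := List.append_of_mem hmem
  rw [firstOneTwo, firstOneTwo, reading_setBox_of_eq h, h, List.find?_append, List.find?_append,
    List.find?_cons_of_neg (by rwa [decide_eq_true_eq]),
    List.find?_cons_of_neg (by rwa [decide_eq_true_eq])]

theorem bracketStep_subset {i : Fin (m + 1)} {st : List (Box m × Fin (m + 2))}
    {p q : Box m × Fin (m + 2)} (h : q ∈ bracketStep i st p) : q = p ∨ q ∈ st := by
  unfold bracketStep at h
  split_ifs at h
  · exact List.mem_cons.1 h
  · cases st with
    | nil => exact Or.inl (by simpa using h)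
    | cons z st =>
      simp only at h
      split_ifs at h
      · exact Or.inr (List.mem_cons_of_mem _ h)
      · exact List.mem_cons.1 h
  · exact Or.inr h

theorem foldl_bracketStep_subset {i : Fin (m + 1)} {q : Box m × Fin (m + 2)} :
    ∀ (w st : List (Box m × Fin (m + 2))), q ∈ w.foldl (bracketStep i) st → q ∈ w ∨ q ∈ st
  | [], _, h => Or.inr h
  | p :: w, st, h => by
    rcases foldl_bracketStep_subset w _ h with h | h
    · exact Or.inl (List.mem_cons_of_mem _ h)
    · rcases bracketStep_subset h with rfl | h
      · exact Or.inl (by simp)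
      · exact Or.inr h

theorem mem_reading_of_mem_red {i : Fin (m + 1)} {T : Tableau m} {q : Box m × Fin (m + 2)}
    (h : q ∈ red i T) : q ∈ reading T := by
  rw [red, List.mem_reverse] at h
  simpa using foldl_bracketStep_subset _ _ h

/-- The letters `1` and `2`. -/
def IsOneTwo (x : Fin (m + 2)) : Prop := x = Fin.castSucc 0 ∨ x = Fin.succ 0

theorem selectEBar_spec {T : Tableau m} {p : Box m × Fin (m + 2)} (h : selectEBar T = some p) :
    HasLetter IsOneTwo T p.1 ∧ IsOneTwo p.2 := by
  rw [selectEBar, Option.bind_eq_some_iff] at h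
  obtain ⟨q, h1, h2⟩ := h
  split_ifs at h2
  rw [← Option.some.inj h2]
  exact ⟨⟨q.2, (firstOneTwo_eq_some_iff.1 h1).1, List.mem_of_find?_eq_some h1⟩, Or.inl rfl⟩

theorem selectFBar_spec {T : Tableau m} {p : Box m × Fin (m + 2)} (h : selectFBar T = some p) :
    HasLetter IsOneTwo T p.1 ∧ IsOneTwo p.2 := by
  rw [selectFBar, Option.bind_eq_some_iff] at h
  obtain ⟨q, h1, h2⟩ := h
  split_ifs at h2
  rw [← Option.some.inj h2]
  exact ⟨⟨q.2, (firstOneTwo_eq_some_iff.1 h1).1, List.mem_of_find?_eq_some h1⟩, Or.inr rfl⟩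

theorem not_isOneTwo {i : Fin (m + 1)} (hi : 2 ≤ i.val) :
    ¬ IsOneTwo i.castSucc ∧ ¬ IsOneTwo i.succ := by
  simp only [IsOneTwo, Fin.ext_iff, Fin.val_castSucc, Fin.val_succ, Fin.val_zero]
  omega

theorem IsOneTwo.sgn_eq_zero {i : Fin (m + 1)} (hi : 2 ≤ i.val) {x : Fin (m + 2)}
    (hx : IsOneTwo x) : sgn i x = 0 := by
  refine QueerCrystal.sgn_eq_zero ?_ ?_
  · rintro rfl; exact (not_isOneTwo hi).1 hx
  · rintro rfl; exact (not_isOneTwo hi).2 hx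

theorem selectE_spec {i : Fin (m + 1)} (hi : 2 ≤ i.val) {T : Tableau m}
    {p : Box m × Fin (m + 2)} (h : selectE i T = some p) :
    HasLetter (fun x => ¬ IsOneTwo x) T p.1 ∧ ¬ IsOneTwo p.2 := by
  rw [selectE, Option.map_eq_some_iff] at h
  obtain ⟨q, h1, rfl⟩ := h
  have h2 : q.2 = i.succ := by simpa using List.find?_some h1
  exact ⟨⟨q.2, by rw [h2]; exact (not_isOneTwo hi).2,
    mem_reading_of_mem_red (List.mem_of_find?_eq_some h1)⟩, (not_isOneTwo hi).1⟩

theorem selectF_spec {i : Fin (m + 1)} (hi : 2 ≤ i.val) {T : Tableau m}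
    {p : Box m × Fin (m + 2)} (h : selectF i T = some p) :
    HasLetter (fun x => ¬ IsOneTwo x) T p.1 ∧ ¬ IsOneTwo p.2 := by
  rw [selectF, Option.map_eq_some_iff] at h
  obtain ⟨q, h1, rfl⟩ := h
  have h2 : q.2 = i.castSucc := by simpa using List.find?_some h1
  exact ⟨⟨q.2, by rw [h2]; exact (not_isOneTwo hi).1,
    mem_reading_of_mem_red (List.mem_reverse.1 (List.mem_of_find?_eq_some h1))⟩,
    (not_isOneTwo hi).2⟩

theorem HasLetter.mono {P Q : Fin (m + 2) → Prop} {T : Tableau m} {c : Box m}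
    (h : HasLetter P T c) (hPQ : ∀ x, P x → Q x) : HasLetter Q T c := by
  obtain ⟨x, hx, hmem⟩ := h
  exact ⟨x, hPQ x hx, hmem⟩

/-- An odd operator commutes with an even one, if the former is determined by the first letter
`1` or `2` and the latter by `red_i` with `i ≥ 3`. -/
theorem applySelect_comm_of_factor {i : Fin (m + 1)} (hi : 2 ≤ i.val)
    {s t : Tableau m → Option (Box m × Fin (m + 2))}
    (hs : ∀ T T', firstOneTwo T = firstOneTwo T' → s T = s T')
    (ht : ∀ T T', red i T = red i T' → t T = t T')
    (hs' : ∀ T p, s T = some p → HasLetter IsOneTwo T p.1 ∧ IsOneTwo p.2)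
    (ht' : ∀ T p, t T = some p → HasLetter (fun x => ¬ IsOneTwo x) T p.1 ∧ ¬ IsOneTwo p.2)
    (T : Tableau m) :
    (applySelect s T).bind (applySelect t) = (applySelect t T).bind (applySelect s) := by
  refine applySelect_comm (fun p hp => ?_) (fun p hp => ?_) (fun p q hp hq => ?_)
  · obtain ⟨h1, h2⟩ := hs' T p hp
    exact ht _ _ (red_setBox (h1.mono fun x hx => hx.sgn_eq_zero hi) (h2.sgn_eq_zero hi))
  · obtain ⟨h1, h2⟩ := ht' T p hp
    exact hs _ _ (firstOneTwo_setBox h1 h2)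
  · exact (hs' T p hp).1.ne (ht' T q hq).1 fun x hx hx' => hx' hx

theorem selectE_congr {i : Fin (m + 1)} {T T' : Tableau m} (h : red i T = red i T') :
    selectE i T = selectE i T' := by rw [selectE, selectE, h]

theorem selectF_congr {i : Fin (m + 1)} {T T' : Tableau m} (h : red i T = red i T') :
    selectF i T = selectF i T' := by rw [selectF, selectF, h]

theorem selectEBar_congr {T T' : Tableau m} (h : firstOneTwo T = firstOneTwo T') :
    selectEBar T = selectEBar T' := by rw [selectEBar, selectEBar, h]

theorem selectFBar_congr {T T' : Tableau m} (h : firstOneTwo T = firstOneTwo T') :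
    selectFBar T = selectFBar T' := by rw [selectFBar, selectFBar, h]

theorem red_of_rawEBar {i : Fin (m + 1)} (hi : 2 ≤ i.val) {T T' : Tableau m}
    (h : rawEBar T = some T') : red i T' = red i T := by
  rw [rawEBar_eq_applySelect, applySelect, Option.map_eq_some_iff] at h
  obtain ⟨p, hp, rfl⟩ := h
  obtain ⟨h1, h2⟩ := selectEBar_spec hp
  exact red_setBox (h1.mono fun x hx => hx.sgn_eq_zero hi) (h2.sgn_eq_zero hi)

/-- Commutation of operators on tableaux passes to crystals of tableaux. -/
theorem bind_comm_of_raw {X : Type} {t : X → Tableau m}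
    {a b : X → Option X} {A B : Tableau m → Option (Tableau m)}
    (ha : ∀ x y, a x = some y ↔ A (t x) = some (t y))
    (hb : ∀ x y, b x = some y ↔ B (t x) = some (t y))
    (hA : ∀ x T, A (t x) = some T → ∃ y, t y = T) (hB : ∀ x T, B (t x) = some T → ∃ y, t y = T)
    (hAB : ∀ T, (A T).bind B = (B T).bind A) (x : X) : (a x).bind b = (b x).bind a := by
  have key : ∀ {a b : X → Option X} {A B : Tableau m → Option (Tableau m)},
      (∀ x y, a x = some y ↔ A (t x) = some (t y)) →
      (∀ x y, b x = some y ↔ B (t x) = some (t y)) →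
      (∀ x T, A (t x) = some T → ∃ y, t y = T) →
      ∀ z, (a x).bind b = some z ↔ (A (t x)).bind B = some (t z) := by
    intro a b A B ha hb hA z
    rw [Option.bind_eq_some_iff, Option.bind_eq_some_iff]
    constructor
    · rintro ⟨y, h1, h2⟩
      exact ⟨t y, (ha _ _).1 h1, (hb _ _).1 h2⟩
    · rintro ⟨T, h1, h2⟩
      obtain ⟨y, rfl⟩ := hA x T h1
      exact ⟨y, (ha _ _).2 h1, (hb _ _).2 h2⟩
  ext z
  rw [key ha hb hA, key hb ha hB, hAB]

theorem exists_tableauOf {lam : StrictShape m} {op : Tableau m → Option (Tableau m)}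
    (h : StableUnder (IsSDT lam) op) (b : (shiftedSDT lam).carrier) (T : Tableau m)
    (hT : op (tableauOf b) = some T) : ∃ b' : (shiftedSDT lam).carrier, tableauOf b' = T :=
  ⟨mkShifted T (h _ _ (isSDT_tableauOf b) hT), rfl⟩

theorem content_of_rawF {i : Fin (m + 1)} {T T' : Tableau m} (h : rawF i T = some T') :
    content T' = content T - simpleRoot i := by
  rw [(rawF_eq_some_iff.1 h).content, simpleRoot]
  abel

theorem content_of_rawFBar {T T' : Tableau m} (h : rawFBar T = some T') :
    content T' = content T - simpleRoot 0 := by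
  rw [(rawFBar_eq_some_iff.1 h).content, simpleRoot]
  abel

/-- Weights, ε_i and φ_i are computed for the lowering operators only; the raising operators follow
because they are the partial inverses. -/
theorem isQCrystal_shiftedSDT (lam : StrictShape m) : IsQCrystal (shiftedSDT lam) := by
  have hfe : ∀ (i : Fin (m + 1)) (b b' : (shiftedSDT lam).carrier),
      (shiftedSDT lam).f i b = some b' ↔ (shiftedSDT lam).e i b' = some b := by
    intro i b b'
    rw [shiftedSDT_f, shiftedSDT_e, rawE_eq_some_iff_rawF]
  have hfe' : ∀ (b b' : (shiftedSDT lam).carrier),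
      (shiftedSDT lam).fBar b = some b' ↔ (shiftedSDT lam).eBar b' = some b := by
    intro b b'
    rw [shiftedSDT_fBar, shiftedSDT_eBar, rawEBar_eq_some_iff_rawFBar]
  have hwt : ∀ (i : Fin (m + 1)) (b b' : (shiftedSDT lam).carrier),
      (shiftedSDT lam).f i b = some b' →
        (shiftedSDT lam).wt b' = (shiftedSDT lam).wt b - simpleRoot i := by
    intro i b b' h
    rw [shiftedSDT_wt, shiftedSDT_wt, content_of_rawF (shiftedSDT_f.1 h)]
    abel
  have hwt' : ∀ (b b' : (shiftedSDT lam).carrier), (shiftedSDT lam).fBar b = some b' →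
        (shiftedSDT lam).wt b' = (shiftedSDT lam).wt b - simpleRoot 0 := by
    intro b b' h
    rw [shiftedSDT_wt, shiftedSDT_wt, content_of_rawFBar (shiftedSDT_fBar.1 h)]
    abel
  have heps : ∀ (i : Fin (m + 1)) (b b' : (shiftedSDT lam).carrier),
      (shiftedSDT lam).f i b = some b' →
        (shiftedSDT lam).eps i b' = (shiftedSDT lam).eps i b + ((1 : ℤ) : WithBot ℤ) := by
    intro i b b' h
    obtain ⟨h1, h2⟩ := height_of_rawF (shiftedSDT_f.1 h)
    rw [shiftedSDT_eps, shiftedSDT_eps, redCount_succ, redCount_succ, h1, h2, ← WithBot.coe_add]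
    congr 1
    ring
  have hphi : ∀ (i : Fin (m + 1)) (b b' : (shiftedSDT lam).carrier),
      (shiftedSDT lam).f i b = some b' →
        (shiftedSDT lam).phi i b' = (shiftedSDT lam).phi i b + ((-1 : ℤ) : WithBot ℤ) := by
    intro i b b' h
    obtain ⟨h1, h2⟩ := height_of_rawF (shiftedSDT_f.1 h)
    rw [shiftedSDT_phi, shiftedSDT_phi, redCount_castSucc, redCount_castSucc, h1,
      ← WithBot.coe_add]
    rfl
  -- Values may formally be -∞, so equations are inverted by adding the opposite finite constant.
  have hcancel : ∀ (x : WithBot ℤ) (c : ℤ),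
      x = x + ((c : ℤ) : WithBot ℤ) + ((-c : ℤ) : WithBot ℤ) := by
    intro x c
    rw [add_assoc, ← WithBot.coe_add]
    simp
  refine
    { wt_e := fun i b b' h => ?_
      wt_f := hwt
      phi_eq := fun i b => ?_
      f_iff_e := hfe
      eps_e := fun i b b' h => ?_
      phi_e := fun i b b' h => ?_
      eps_f := heps
      phi_f := hphi
      of_phi_bot := fun i b h => ?_
      wt_eBar := fun b b' h => ?_
      wt_fBar := hwt'
      fBar_iff_eBar := hfe'
      eBar_e_comm := fun i hi => bind_comm_of_raw
        (fun _ _ => shiftedSDT_eBar) (fun _ _ => shiftedSDT_e)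
        (exists_tableauOf (stableUnder_rawEBar lam)) (exists_tableauOf (stableUnder_rawE lam i))
        fun T => ?_
      eBar_f_comm := fun i hi => bind_comm_of_raw
        (fun _ _ => shiftedSDT_eBar) (fun _ _ => shiftedSDT_f)
        (exists_tableauOf (stableUnder_rawEBar lam)) (exists_tableauOf (stableUnder_rawF lam i))
        fun T => ?_
      fBar_e_comm := fun i hi => bind_comm_of_raw
        (fun _ _ => shiftedSDT_fBar) (fun _ _ => shiftedSDT_e)
        (exists_tableauOf (stableUnder_rawFBar lam)) (exists_tableauOf (stableUnder_rawE lam i))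
        fun T => ?_
      fBar_f_comm := fun i hi => bind_comm_of_raw
        (fun _ _ => shiftedSDT_fBar) (fun _ _ => shiftedSDT_f)
        (exists_tableauOf (stableUnder_rawFBar lam)) (exists_tableauOf (stableUnder_rawF lam i))
        fun T => ?_
      eps_eBar := fun i hi b b' h => ?_
      phi_eBar := fun i hi b b' h => ?_ }
  · rw [hwt i b' b ((hfe i b' b).2 h)]; abel
  · rw [shiftedSDT_phi, shiftedSDT_eps, shiftedSDT_wt, redCount_castSucc, redCount_succ,
      ← wtDiff_content, ← WithBot.coe_add]
    congr 1
    simp only [wtDiff, Pi.sub_apply]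
    ring
  · rw [heps i b' b ((hfe i b' b).2 h)]; exact hcancel _ 1
  · rw [hphi i b' b ((hfe i b' b).2 h)]; simpa using hcancel _ (-1)
  · rw [shiftedSDT_phi] at h
    exact absurd h (WithBot.coe_ne_bot)
  · rw [hwt' b' b ((hfe' b' b).2 h)]; abel
  · rw [rawEBar_eq_applySelect, rawE_eq_applySelect]
    exact applySelect_comm_of_factor hi (fun _ _ => selectEBar_congr) (fun _ _ => selectE_congr)
      (fun _ _ => selectEBar_spec) (fun _ _ => selectE_spec hi) T
  · rw [rawEBar_eq_applySelect, rawF_eq_applySelect]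
    exact applySelect_comm_of_factor hi (fun _ _ => selectEBar_congr) (fun _ _ => selectF_congr)
      (fun _ _ => selectEBar_spec) (fun _ _ => selectF_spec hi) T
  · rw [rawFBar_eq_applySelect, rawE_eq_applySelect]
    exact applySelect_comm_of_factor hi (fun _ _ => selectFBar_congr) (fun _ _ => selectE_congr)
      (fun _ _ => selectFBar_spec) (fun _ _ => selectE_spec hi) T
  · rw [rawFBar_eq_applySelect, rawF_eq_applySelect]
    exact applySelect_comm_of_factor hi (fun _ _ => selectFBar_congr) (fun _ _ => selectF_congr)
      (fun _ _ => selectFBar_spec) (fun _ _ => selectF_spec hi) T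
  · rw [shiftedSDT_eps, shiftedSDT_eps, redCount, redCount,
      red_of_rawEBar hi (shiftedSDT_eBar.1 h)]
  · rw [shiftedSDT_phi, shiftedSDT_phi, redCount, redCount,
      red_of_rawEBar hi (shiftedSDT_eBar.1 h)]

/-! ### Direct limits and isomorphisms of crystals -/

namespace CrystalSystem

variable {J : Type} [Preorder J] {B : J → CrystalData m}

/-- The operators `op` commute with the maps of the system where they do not vanish. -/
def Compatible (S : CrystalSystem B) (op : ∀ j, (B j).carrier → Option (B j).carrier) : Prop :=
  ∀ ⦃j k : J⦄ (h : j ≤ k) (b b' : (B j).carrier),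
    op j b = some b' → op k (S.map h b) = some (S.map h b')

theorem compatible_e (S : CrystalSystem B) (i : Fin (m + 1)) :
    S.Compatible fun j => (B j).e i := fun _ _ h b b' => (S.isEmbedding h).e i b b'

theorem compatible_f (S : CrystalSystem B) (i : Fin (m + 1)) :
    S.Compatible fun j => (B j).f i := fun _ _ h b b' => (S.isEmbedding h).f i b b'

theorem compatible_eBar (S : CrystalSystem B) :
    S.Compatible fun j => (B j).eBar := fun _ _ h b b' => (S.isEmbedding h).eBar b b'

theorem compatible_fBar (S : CrystalSystem B) :
    S.Compatible fun j => (B j).fBar := fun _ _ h b b' => (S.isEmbedding h).fBar b b'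

variable [IsDirectedOrder J]

theorem exists_toLimit (S : CrystalSystem B) (x : S.LimitCarrier) :
    ∃ j b, S.toLimit j b = x := by
  obtain ⟨⟨j, b⟩, rfl⟩ := Quotient.exists_rep x
  exact ⟨j, b, rfl⟩

theorem exists_map_eq (S : CrystalSystem B) {j k : J} {b : (B j).carrier} {c : (B k).carrier}
    (h : S.toLimit j b = S.toLimit k c) :
    ∃ (l : J) (hj : j ≤ l) (hk : k ≤ l), S.map hj b = S.map hk c := by
  obtain ⟨l, hj, hk, hl⟩ := Quotient.exact h
  exact ⟨l, hj, hk, hl⟩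

theorem limitOp_eq_some_iff (S : CrystalSystem B)
    {op : ∀ j, (B j).carrier → Option (B j).carrier} (hop : S.Compatible op)
    {x y : S.LimitCarrier} : S.limitOp op x = some y ↔
      ∃ j b b', S.toLimit j b = x ∧ op j b = some b' ∧ S.toLimit j b' = y := by
  constructor
  · intro h
    unfold limitOp at h
    split_ifs at h with hex
    obtain rfl := Option.some.inj h
    exact hex.choose_spec
  · rintro ⟨j, b, b', rfl, h, rfl⟩
    exact S.limitOp_toLimit op hop j b b' h

theorem limitOp_bind_eq_some_iff (S : CrystalSystem B)
    {op op' : ∀ j, (B j).carrier → Option (B j).carrier} (hop : S.Compatible op)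
    (hop' : S.Compatible op') {x z : S.LimitCarrier} :
    (S.limitOp op x).bind (S.limitOp op') = some z ↔
      ∃ j b b', S.toLimit j b = x ∧ (op j b).bind (op' j) = some b' ∧ S.toLimit j b' = z := by
  rw [Option.bind_eq_some_iff]
  constructor
  · rintro ⟨y, h1, h2⟩
    obtain ⟨j, b, b', rfl, h3, rfl⟩ := (S.limitOp_eq_some_iff hop).1 h1
    obtain ⟨k, c, c', h4, h5, rfl⟩ := (S.limitOp_eq_some_iff hop').1 h2
    -- The two operators may use representatives at different stages; both are moved to a stage
    -- where these agree.
    obtain ⟨l, hk, hj, h6⟩ := S.exists_map_eq h4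
    refine ⟨l, S.map hj b, S.map hk c', S.toLimit_map hj b, ?_, S.toLimit_map hk c'⟩
    rw [hop hj b b' h3, Option.bind_some, ← h6]
    exact hop' hk c c' h5
  · rintro ⟨j, b, b', rfl, h, rfl⟩
    obtain ⟨c, h1, h2⟩ := Option.bind_eq_some_iff.1 h
    exact ⟨S.toLimit j c, (S.limitOp_eq_some_iff hop).2 ⟨j, b, c, rfl, h1, rfl⟩,
      (S.limitOp_eq_some_iff hop').2 ⟨j, c, b', rfl, h2, rfl⟩⟩

theorem limitOp_comm (S : CrystalSystem B)
    {op op' : ∀ j, (B j).carrier → Option (B j).carrier} (hop : S.Compatible op)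
    (hop' : S.Compatible op') (h : ∀ j b, (op j b).bind (op' j) = (op' j b).bind (op j))
    (x : S.LimitCarrier) :
    (S.limitOp op x).bind (S.limitOp op') = (S.limitOp op' x).bind (S.limitOp op) := by
  ext z
  rw [S.limitOp_bind_eq_some_iff hop hop', S.limitOp_bind_eq_some_iff hop' hop]
  simp only [h]

theorem limitOp_iff_of_iff (S : CrystalSystem B)
    {op op' : ∀ j, (B j).carrier → Option (B j).carrier} (hop : S.Compatible op)
    (hop' : S.Compatible op') (h : ∀ j b b', op j b = some b' ↔ op' j b' = some b)
    (x y : S.LimitCarrier) : S.limitOp op x = some y ↔ S.limitOp op' y = some x := by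
  rw [S.limitOp_eq_some_iff hop, S.limitOp_eq_some_iff hop']
  constructor
  · rintro ⟨j, b, b', h1, h2, h3⟩
    exact ⟨j, b', b, h3, (h j b b').1 h2, h1⟩
  · rintro ⟨j, b', b, h1, h2, h3⟩
    exact ⟨j, b, b', h3, (h j b b').2 h2, h1⟩

/-- A relation between an element and its image under an operator passes to the limit. -/
theorem limitOp_induction (S : CrystalSystem B)
    {op : ∀ j, (B j).carrier → Option (B j).carrier} (hop : S.Compatible op)
    {P : S.LimitCarrier → S.LimitCarrier → Prop}
    (h : ∀ j b b', op j b = some b' → P (S.toLimit j b) (S.toLimit j b'))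
    (x y : S.LimitCarrier) (hxy : S.limitOp op x = some y) : P x y := by
  obtain ⟨j, b, b', rfl, h1, rfl⟩ := (S.limitOp_eq_some_iff hop).1 hxy
  exact h j b b' h1

/-- Every nonzero value in the limit, also of a composite of two operators, is realised at one
stage, where the axiom is available. -/
theorem isQCrystal_limit (S : CrystalSystem B) : IsQCrystal S.limit where
  wt_e i := S.limitOp_induction (S.compatible_e i) fun j => (S.isQCrystal j).wt_e i
  wt_f i := S.limitOp_induction (S.compatible_f i) fun j => (S.isQCrystal j).wt_f i
  phi_eq i x := by
    obtain ⟨j, b, rfl⟩ := S.exists_toLimit x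
    exact (S.isQCrystal j).phi_eq i b
  f_iff_e i := S.limitOp_iff_of_iff (S.compatible_f i) (S.compatible_e i) fun j =>
    (S.isQCrystal j).f_iff_e i
  eps_e i := S.limitOp_induction (S.compatible_e i) fun j => (S.isQCrystal j).eps_e i
  phi_e i := S.limitOp_induction (S.compatible_e i) fun j => (S.isQCrystal j).phi_e i
  eps_f i := S.limitOp_induction (S.compatible_f i) fun j => (S.isQCrystal j).eps_f i
  phi_f i := S.limitOp_induction (S.compatible_f i) fun j => (S.isQCrystal j).phi_f i
  of_phi_bot i x h := by
    constructor
    · rw [Option.eq_none_iff_forall_ne_some]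
      intro y hy
      obtain ⟨j, b, b', rfl, h1, -⟩ := (S.limitOp_eq_some_iff (S.compatible_e i)).1 hy
      rw [((S.isQCrystal j).of_phi_bot i b h).1] at h1
      cases h1
    · rw [Option.eq_none_iff_forall_ne_some]
      intro y hy
      obtain ⟨j, b, b', rfl, h1, -⟩ := (S.limitOp_eq_some_iff (S.compatible_f i)).1 hy
      rw [((S.isQCrystal j).of_phi_bot i b h).2] at h1
      cases h1
  wt_eBar := S.limitOp_induction S.compatible_eBar fun j => (S.isQCrystal j).wt_eBar
  wt_fBar := S.limitOp_induction S.compatible_fBar fun j => (S.isQCrystal j).wt_fBar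
  fBar_iff_eBar := S.limitOp_iff_of_iff S.compatible_fBar S.compatible_eBar fun j =>
    (S.isQCrystal j).fBar_iff_eBar
  eBar_e_comm i hi := S.limitOp_comm S.compatible_eBar (S.compatible_e i) fun j =>
    (S.isQCrystal j).eBar_e_comm i hi
  eBar_f_comm i hi := S.limitOp_comm S.compatible_eBar (S.compatible_f i) fun j =>
    (S.isQCrystal j).eBar_f_comm i hi
  fBar_e_comm i hi := S.limitOp_comm S.compatible_fBar (S.compatible_e i) fun j =>
    (S.isQCrystal j).fBar_e_comm i hi
  fBar_f_comm i hi := S.limitOp_comm S.compatible_fBar (S.compatible_f i) fun j =>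
    (S.isQCrystal j).fBar_f_comm i hi
  eps_eBar i hi := S.limitOp_induction S.compatible_eBar fun j => (S.isQCrystal j).eps_eBar i hi
  phi_eBar i hi := S.limitOp_induction S.compatible_eBar fun j => (S.isQCrystal j).phi_eBar i hi

end CrystalSystem

theorem eq_some_iff_of_map {X Y : Type} (g : X ≃ Y) {a : X → Option X} {a' : Y → Option Y}
    (h : ∀ x, a' (g x) = (a x).map g) (x y : X) : a x = some y ↔ a' (g x) = some (g y) := by
  rw [h, Option.map_eq_some_iff]
  constructor
  · intro h; exact ⟨y, h, rfl⟩
  · rintro ⟨z, h1, h2⟩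
    rw [h1, g.injective h2]

theorem bind_comm_of_map {X Y : Type} (g : X ≃ Y) {a b : X → Option X} {a' b' : Y → Option Y}
    (ha : ∀ x, a' (g x) = (a x).map g) (hb : ∀ x, b' (g x) = (b x).map g)
    (h : ∀ y, (a' y).bind b' = (b' y).bind a') (x : X) : (a x).bind b = (b x).bind a := by
  have key : ∀ {a b : X → Option X} {a' b' : Y → Option Y},
      (∀ x, a' (g x) = (a x).map g) → (∀ x, b' (g x) = (b x).map g) →
      ((a x).bind b).map g = (a' (g x)).bind b' := by
    intro a b a' b' ha hb
    rw [ha]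
    cases a x with
    | none => rfl
    | some y => simp [hb]
  apply Option.map_injective g.injective
  rw [key ha hb, key hb ha, h]

theorem CrystalIso.isQCrystal {B C : CrystalData m} (g : CrystalIso B C) (h : IsQCrystal C) :
    IsQCrystal B := by
  have he := fun i => eq_some_iff_of_map g.toEquiv (g.e i)
  have hf := fun i => eq_some_iff_of_map g.toEquiv (g.f i)
  have heB := eq_some_iff_of_map g.toEquiv g.eBar
  have hfB := eq_some_iff_of_map g.toEquiv g.fBar
  constructor
  · constructor
    · intro i b b' hb
      rw [← g.wt, ← g.wt, h.wt_e i _ _ ((he i b b').1 hb)]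
    · intro i b b' hb
      rw [← g.wt, ← g.wt, h.wt_f i _ _ ((hf i b b').1 hb)]
    · intro i b
      rw [← g.wt, ← g.phi, ← g.eps, h.phi_eq]
    · intro i b b'
      rw [he, hf, h.f_iff_e]
    · intro i b b' hb
      rw [← g.eps, ← g.eps, h.eps_e i _ _ ((he i b b').1 hb)]
    · intro i b b' hb
      rw [← g.phi, ← g.phi, h.phi_e i _ _ ((he i b b').1 hb)]
    · intro i b b' hb
      rw [← g.eps, ← g.eps, h.eps_f i _ _ ((hf i b b').1 hb)]
    · intro i b b' hb
      rw [← g.phi, ← g.phi, h.phi_f i _ _ ((hf i b b').1 hb)]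
    · intro i b hb
      rw [← g.phi] at hb
      have := h.of_phi_bot i _ hb
      rwa [g.e, g.f, Option.map_eq_none_iff, Option.map_eq_none_iff] at this
  · intro b b' hb
    rw [← g.wt, ← g.wt, h.wt_eBar _ _ ((heB b b').1 hb)]
  · intro b b' hb
    rw [← g.wt, ← g.wt, h.wt_fBar _ _ ((hfB b b').1 hb)]
  · intro b b'
    rw [heB, hfB, h.fBar_iff_eBar]
  · intro i hi
    exact bind_comm_of_map g.toEquiv g.eBar (g.e i) (h.eBar_e_comm i hi)
  · intro i hi
    exact bind_comm_of_map g.toEquiv g.eBar (g.f i) (h.eBar_f_comm i hi)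
  · intro i hi
    exact bind_comm_of_map g.toEquiv g.fBar (g.e i) (h.fBar_e_comm i hi)
  · intro i hi
    exact bind_comm_of_map g.toEquiv g.fBar (g.f i) (h.fBar_f_comm i hi)
  · intro i hi b b' hb
    rw [← g.eps, ← g.eps, h.eps_eBar i hi _ _ ((heB b b').1 hb)]
  · intro i hi b b' hb
    rw [← g.phi, ← g.phi, h.phi_eBar i hi _ _ ((heB b b').1 hb)]

/-! ### The directed system of the crystals `SDT(λ) ⊗ T_{-λ}` -/

/-- Each letter is added in one row only, and the shift by the lowest weight compensates exactly
these boxes. -/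
theorem content_enlarge {lam mu : StrictShape m} (h : lam ≤ mu) (T : Tableau m) :
    content (enlarge lam mu T) - lowestWeight mu.parts = content T - lowestWeight lam.parts := by
  obtain ⟨nu, hnu⟩ := h
  funext a
  have h1 : ∀ k, ((enlarge lam mu T k).count a : ℤ) =
      (if k = a.rev then (nu.parts a.rev : ℤ) else 0) + (T k).count a := by
    intro k
    rw [enlarge, List.count_append, List.count_replicate, hnu]
    by_cases hk : k = a.rev
    · subst hk; simp
    · have : k.rev ≠ a := fun h => hk (by rw [← h, Fin.rev_rev])
      simp [hk, this]
  simp only [content, lowestWeight, Pi.sub_apply, h1, Finset.sum_add_distrib, hnu]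
  rw [Finset.sum_ite_eq' Finset.univ a.rev, if_pos (Finset.mem_univ _)]
  push_cast
  ring

/-- This expresses ε_i by the height and the shifted weight, both of which are invariant under
enlarging the shape. -/
theorem shiftedSDT_eps_eq {lam : StrictShape m} (i : Fin (m + 1))
    (b : (shiftedSDT lam).carrier) : (shiftedSDT lam).eps i b =
      ((height i (letters (tableauOf b)) -
        wtDiff i (content (tableauOf b) - lowestWeight lam.parts) : ℤ) : WithBot ℤ) := by
  rw [shiftedSDT_eps, redCount_succ, ← wtDiff_content]
  congr 1
  simp only [wtDiff, Pi.sub_apply]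
  ring

/-- The embedding that enlarges the shape. -/
def enlargeMap {lam mu : StrictShape m} (h : lam ≤ mu) (b : (shiftedSDT lam).carrier) :
    (shiftedSDT mu).carrier :=
  mkShifted (enlarge lam mu (tableauOf b)) (isSDT_enlarge h (isSDT_tableauOf b))

theorem eq_of_core_tableauOf {lam : StrictShape m} {b b' : (shiftedSDT lam).carrier}
    (h : core (tableauOf b) = core (tableauOf b')) : b = b' :=
  tableauOf_injective (eq_of_core_eq
    (fun k => by rw [(isSDT_tableauOf b).shape, (isSDT_tableauOf b').shape]) h)

theorem core_enlargeMap {lam mu : StrictShape m} (h : lam ≤ mu) (b : (shiftedSDT lam).carrier) :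
    core (tableauOf (enlargeMap h b)) = core (tableauOf b) :=
  core_enlarge lam mu (tableauOf b)

theorem isEmbedding_enlargeMap {lam mu : StrictShape m} (h : lam ≤ mu) :
    IsEmbedding (B := shiftedSDT lam) (C := shiftedSDT mu) (enlargeMap h) where
  injective b b' hb := by
    apply eq_of_core_tableauOf
    rw [← core_enlargeMap h, hb, core_enlargeMap]
  wt b := by
    rw [shiftedSDT_wt, shiftedSDT_wt]
    exact content_enlarge h _
  eps i b := by
    have h1 := height_letters_enlarge h (isSDT_tableauOf b) i
    have h2 := content_enlarge h (tableauOf b)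
    rw [shiftedSDT_eps_eq, shiftedSDT_eps_eq, ← h1, ← h2]
    rfl
  phi i b := by
    rw [shiftedSDT_phi, shiftedSDT_phi, redCount_castSucc, redCount_castSucc,
      ← height_letters_enlarge h (isSDT_tableauOf b) i]
    rfl
  e i b b' hb := shiftedSDT_e.2 (rawE_enlarge h (isSDT_tableauOf b) (shiftedSDT_e.1 hb))
  f i b b' hb := shiftedSDT_f.2 (rawF_enlarge h (isSDT_tableauOf b) (shiftedSDT_f.1 hb))
  eBar b b' hb := shiftedSDT_eBar.2 (rawEBar_enlarge (isSDT_tableauOf b) (shiftedSDT_eBar.1 hb))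
  fBar b b' hb := shiftedSDT_fBar.2 (rawFBar_enlarge (isSDT_tableauOf b) (shiftedSDT_fBar.1 hb))

/-- The directed system of the crystals `SDT(λ) ⊗ T_{-λ}`. -/
def sdtSystem (m : ℕ) : CrystalSystem (fun lam : StrictShape m => shiftedSDT lam) where
  map _ _ h := ⟨enlargeMap h, (isEmbedding_enlargeMap h).injective⟩
  isQCrystal := isQCrystal_shiftedSDT
  isEmbedding _ _ h := isEmbedding_enlargeMap h
  map_self lam b := eq_of_core_tableauOf (core_enlargeMap (le_refl lam) b)
  map_map _ _ _ h h' b := eq_of_core_tableauOf <| by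
    change core (tableauOf (enlargeMap h' (enlargeMap h b))) =
      core (tableauOf (enlargeMap (h.trans h') b))
    rw [core_enlargeMap, core_enlargeMap, core_enlargeMap]

theorem exists_enlarge_eq {lam mu : StrictShape m} {T T' : Tableau m} (hT : IsSDT lam T)
    (hT' : IsSDT mu T') (h : core T = core T') :
    ∃ (nu : StrictShape m) (_ : lam ≤ nu) (_ : mu ≤ nu),
      enlarge lam nu T = enlarge mu nu T' := by
  obtain ⟨nu, h1, h2⟩ := exists_ge_ge lam mu
  refine ⟨nu, h1, h2, eq_of_core_eq (fun k => ?_) ?_⟩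
  · rw [length_enlarge h1 hT, length_enlarge h2 hT']
  · rw [core_enlarge, core_enlarge, h]

/-- Enlarging preserves the core, and in a common larger shape the core determines the tableau. The
limit is thus the set of cores that occur. -/
theorem toLimit_eq_iff {lam mu : StrictShape m} {b : (shiftedSDT lam).carrier}
    {c : (shiftedSDT mu).carrier} : (sdtSystem m).toLimit lam b = (sdtSystem m).toLimit mu c ↔
      core (tableauOf b) = core (tableauOf c) := by
  constructor
  · intro h
    obtain ⟨nu, h1, h2, h3⟩ := (sdtSystem m).exists_map_eq h
    rw [← core_enlargeMap h1, ← core_enlargeMap h2]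
    exact congrArg (fun b => core (tableauOf b)) h3
  · intro h
    obtain ⟨nu, h1, h2⟩ := exists_ge_ge lam mu
    rw [← (sdtSystem m).toLimit_map h1 b, ← (sdtSystem m).toLimit_map h2 c]
    congr 1
    apply eq_of_core_tableauOf
    change core (tableauOf (enlargeMap h1 b)) = core (tableauOf (enlargeMap h2 c))
    rw [core_enlargeMap, core_enlargeMap, h]

/-! ### The isomorphism -/

/-- The map `T ↦ [T ⊗ t_{-λ}]`. -/
noncomputable def infToLimit (T : (sdtInf m).carrier) : (sdtSystem m).limit.carrier :=
  (sdtSystem m).toLimit T.2.1.choose (mkShifted T.1 T.2.1.choose_spec)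

/-- The class depends on the core alone, so the shape chosen in `infToLimit` is immaterial. -/
theorem infToLimit_eq {lam : StrictShape m} {b : (shiftedSDT lam).carrier}
    {T : (sdtInf m).carrier} (h : core T.1 = core (tableauOf b)) :
    infToLimit T = (sdtSystem m).toLimit lam b :=
  toLimit_eq_iff.2 h

theorem infToLimit_bijective : Function.Bijective (infToLimit (m := m)) := by
  constructor
  · intro T T' h
    exact Subtype.ext (T.2.2.eq_of_core T'.2.2 (toLimit_eq_iff.1 h))
  · intro x
    obtain ⟨lam, b, rfl⟩ := (sdtSystem m).exists_toLimit x
    exact ⟨⟨_, inSDTInf_marginalize (isSDT_tableauOf b)⟩, infToLimit_eq (core_marginalize _)⟩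

/-- A nonzero value is computed on the dual marginally large representative, and the column
correction preserves its core, hence its class. For the value zero, `hnone` is needed: the limit
operator is nonzero as soon as some representative has a nonzero image. -/
theorem limitOp_infToLimit
    {op : ∀ lam : StrictShape m, (shiftedSDT lam).carrier → Option (shiftedSDT lam).carrier}
    (hop : (sdtSystem m).Compatible op) {raw : Tableau m → Option (Tableau m)}
    {fix : Tableau m → Tableau m}
    (hraw : ∀ lam (b b' : (shiftedSDT lam).carrier),
      op lam b = some b' ↔ raw (tableauOf b) = some (tableauOf b'))
    (hst : ∀ lam : StrictShape m, StableUnder (IsSDT lam) raw)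
    (hfix : ∀ (lam : StrictShape m) (T T1 : Tableau m), IsSDT lam T → IsDualMarginallyLarge T →
      raw T = some T1 → InSDTInf (fix T1) ∧ core (fix T1) = core T1)
    (hnone : ∀ (lam mu : StrictShape m) (T T' : Tableau m), IsSDT lam T →
      IsDualMarginallyLarge T → IsSDT mu T' → core T = core T' → raw T = none → raw T' = none)
    (T : (sdtInf m).carrier) :
    (sdtSystem m).limitOp op (infToLimit T) =
      (restrict InSDTInf ((raw T.1).map fix)).map infToLimit := by
  obtain ⟨T, ⟨lam, hT⟩, hD⟩ := T
  have hΨ : infToLimit ⟨T, ⟨lam, hT⟩, hD⟩ = (sdtSystem m).toLimit lam (mkShifted T hT) :=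
    infToLimit_eq rfl
  rw [hΨ]
  rcases hr : raw T with - | T1
  · change _ = none
    rw [Option.eq_none_iff_forall_ne_some]
    intro y hy
    obtain ⟨mu, b, b', h1, h2, -⟩ := ((sdtSystem m).limitOp_eq_some_iff hop).1 hy
    have h3 := hnone lam mu T (tableauOf b) hT hD (isSDT_tableauOf b)
      (toLimit_eq_iff.1 h1).symm hr
    rw [(hraw mu b b').1 h2] at h3
    cases h3
  · have hT1 := hst lam T T1 hT hr
    obtain ⟨h1, h2⟩ := hfix lam T T1 hT hD hr
    rw [(sdtSystem m).limitOp_toLimit op hop lam (mkShifted T hT) (mkShifted T1 hT1)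
      ((hraw _ _ _).2 hr)]
    have h3 : restrict InSDTInf ((some T1).map fix) = some ⟨fix T1, h1⟩ :=
      restrict_eq_some_iff.2 rfl
    rw [h3]
    exact congrArg some (infToLimit_eq h2).symm

theorem rawF_eq_none_of_core {i : Fin (m + 1)} {lam mu : StrictShape m} {T T' : Tableau m}
    (hT : IsSDT lam T) (hT' : IsSDT mu T') (hc : core T = core T') (h : rawF i T = none) :
    rawF i T' = none := by
  obtain ⟨nu, h1, h2, h3⟩ := exists_enlarge_eq hT hT' hc
  rw [rawF_eq_none_iff] at h ⊢
  rw [← height_letters_enlarge h2 hT', ← h3, height_letters_enlarge h1 hT, h]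

/-- If this odd operator vanishes on a dual marginally large tableau, the opposite one does not, and
remains nonzero on a common enlargement. There the two cannot both be nonzero, so no representative
with this core has a nonzero image. -/
theorem rawEBar_eq_none_of_core {lam mu : StrictShape m} {T T' : Tableau m} (hT : IsSDT lam T)
    (hD : IsDualMarginallyLarge T) (hT' : IsSDT mu T') (hc : core T = core T')
    (h : rawEBar T = none) : rawEBar T' = none := by
  obtain ⟨nu, h1, h2, h3⟩ := exists_enlarge_eq hT hT' hc
  rcases rawEBar_or_rawFBar hD with ⟨T1, hT1⟩ | ⟨T1, hT1⟩
  · rw [hT1] at h; cases h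
  rw [Option.eq_none_iff_forall_ne_some]
  intro T2 hT2
  have h4 := rawEBar_eq_none_of_rawFBar (rawFBar_enlarge (mu := nu) hT hT1)
  rw [h3, rawEBar_enlarge hT' hT2] at h4
  cases h4

theorem rawFBar_eq_none_of_core {lam mu : StrictShape m} {T T' : Tableau m} (hT : IsSDT lam T)
    (hD : IsDualMarginallyLarge T) (hT' : IsSDT mu T') (hc : core T = core T')
    (h : rawFBar T = none) : rawFBar T' = none := by
  obtain ⟨nu, h1, h2, h3⟩ := exists_enlarge_eq hT hT' hc
  rcases rawEBar_or_rawFBar hD with ⟨T1, hT1⟩ | ⟨T1, hT1⟩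
  · rw [Option.eq_none_iff_forall_ne_some]
    intro T2 hT2
    have h4 := rawEBar_eq_none_of_rawFBar (rawFBar_enlarge (mu := nu) hT' hT2)
    rw [← h3, rawEBar_enlarge hT hT1] at h4
    cases h4
  · rw [hT1] at h; cases h

theorem isSDT_parts_eq {lam : StrictShape m} {T : Tableau m} (hT : IsSDT lam T) :
    (fun k => (T k).length) = lam.parts := funext hT.shape

/-- The isomorphism from `SDT(-∞)` to the direct limit. -/
noncomputable def infIso (m : ℕ) : CrystalIso (sdtInf m) (sdtSystem m).limit where
  toEquiv := Equiv.ofBijective infToLimit infToLimit_bijective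
  wt T := by
    refine (shiftedSDT_wt (mkShifted T.1 T.2.1.choose_spec)).trans ?_
    rw [← isSDT_parts_eq T.2.1.choose_spec]
    rfl
  eps i T := by
    refine (shiftedSDT_eps i (mkShifted T.1 T.2.1.choose_spec)).trans ?_
    rw [← isSDT_parts_eq T.2.1.choose_spec]
    rfl
  phi i T := shiftedSDT_phi i (mkShifted T.1 T.2.1.choose_spec)
  e i T := limitOp_infToLimit ((sdtSystem m).compatible_e i) (fun _ _ _ => shiftedSDT_e)
    (fun lam => stableUnder_rawE lam i) (fun _ _ _ => fixE_of_rawE)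
    (fun _ _ _ _ hT hD _ _ h => absurd h (rawE_ne_none hT hD i)) T
  f i T := limitOp_infToLimit ((sdtSystem m).compatible_f i) (fun _ _ _ => shiftedSDT_f)
    (fun lam => stableUnder_rawF lam i) (fun _ _ _ => fixF_of_rawF)
    (fun _ _ _ _ hT _ hT' hc h => rawF_eq_none_of_core hT hT' hc h) T
  eBar T := limitOp_infToLimit (sdtSystem m).compatible_eBar (fun _ _ _ => shiftedSDT_eBar)
    stableUnder_rawEBar (fun _ _ _ => fixE_of_rawEBar)
    (fun _ _ _ _ => rawEBar_eq_none_of_core) T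
  fBar T := limitOp_infToLimit (sdtSystem m).compatible_fBar (fun _ _ _ => shiftedSDT_fBar)
    stableUnder_rawFBar (fun _ _ _ => fixF_of_rawFBar)
    (fun _ _ _ _ => rawFBar_eq_none_of_core) T

theorem stableUnder_inSDTInf {raw : Tableau m → Option (Tableau m)} {fix : Tableau m → Tableau m}
    (hfix : ∀ (lam : StrictShape m) (T T1 : Tableau m), IsSDT lam T → IsDualMarginallyLarge T →
      raw T = some T1 → InSDTInf (fix T1) ∧ core (fix T1) = core T1) :
    StableUnder InSDTInf fun T => (raw T).map fix := by
  rintro T T' ⟨⟨lam, hT⟩, hD⟩ h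
  obtain ⟨T1, h1, rfl⟩ := Option.map_eq_some_iff.1 h
  exact (hfix lam T T1 hT hD h1).1

end QueerCrystal

/-! ### The theorem -/

theorem mainTheorem1 (m : ℕ) :
    -- The operators of `SDT(λ)` and the modified operators of `SDT(-∞)` are well defined.
    (∀ lam : QueerCrystal.StrictShape m,
      (∀ i, QueerCrystal.StableUnder (QueerCrystal.IsSDT lam) (QueerCrystal.rawE i)) ∧
      (∀ i, QueerCrystal.StableUnder (QueerCrystal.IsSDT lam) (QueerCrystal.rawF i)) ∧
      QueerCrystal.StableUnder (QueerCrystal.IsSDT lam) QueerCrystal.rawEBar ∧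
      QueerCrystal.StableUnder (QueerCrystal.IsSDT lam) QueerCrystal.rawFBar) ∧
    ((∀ i, QueerCrystal.StableUnder (m := m) QueerCrystal.InSDTInf (QueerCrystal.infE i)) ∧
      (∀ i, QueerCrystal.StableUnder (m := m) QueerCrystal.InSDTInf (QueerCrystal.infF i)) ∧
      QueerCrystal.StableUnder (m := m) QueerCrystal.InSDTInf QueerCrystal.infEBar ∧
      QueerCrystal.StableUnder (m := m) QueerCrystal.InSDTInf QueerCrystal.infFBar ∧
      (∀ (i : Fin (m + 1)) (T : QueerCrystal.Tableau m), QueerCrystal.InSDTInf T →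
        QueerCrystal.infE i T ≠ none)) ∧
    -- `SDT(-∞)` is an abstract crystal.
    QueerCrystal.IsQCrystal (QueerCrystal.sdtInf m) ∧
    -- The crystals `SDT(λ) ⊗ T_{-λ}` form a directed system under enlarging the shape, and
    -- `T ↦ [T ⊗ t_{-λ}]` is an isomorphism from `SDT(-∞)` to its direct limit.
    ∃ S : QueerCrystal.CrystalSystem
        (fun lam : QueerCrystal.StrictShape m => QueerCrystal.shiftedSDT lam),
      (∀ (lam mu : QueerCrystal.StrictShape m) (h : lam ≤ mu)
          (b : (QueerCrystal.shiftedSDT lam).carrier),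
        QueerCrystal.tableauOf (S.map h b) =
          QueerCrystal.enlarge lam mu (QueerCrystal.tableauOf b)) ∧
      ∃ Ψ : QueerCrystal.CrystalIso (QueerCrystal.sdtInf m) S.limit,
        ∀ (lam : QueerCrystal.StrictShape m) (T : QueerCrystal.Tableau m)
          (hT : QueerCrystal.InSDTInf T) (hlam : QueerCrystal.IsSDT lam T),
          Ψ.toEquiv ⟨T, hT⟩ = S.toLimit lam (QueerCrystal.mkShifted T hlam) := by
  refine ⟨fun lam => ⟨QueerCrystal.stableUnder_rawE lam, QueerCrystal.stableUnder_rawF lam,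
    QueerCrystal.stableUnder_rawEBar lam, QueerCrystal.stableUnder_rawFBar lam⟩,
    ⟨fun i => QueerCrystal.stableUnder_inSDTInf fun _ _ _ => QueerCrystal.fixE_of_rawE,
      fun i => QueerCrystal.stableUnder_inSDTInf fun _ _ _ => QueerCrystal.fixF_of_rawF,
      QueerCrystal.stableUnder_inSDTInf fun _ _ _ => QueerCrystal.fixE_of_rawEBar,
      QueerCrystal.stableUnder_inSDTInf fun _ _ _ => QueerCrystal.fixF_of_rawFBar, ?_⟩,
    -- The axioms for SDT(-∞) are inherited from the limit, which avoids any computation with the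
    -- column corrections.
    (QueerCrystal.infIso m).isQCrystal (QueerCrystal.sdtSystem m).isQCrystal_limit,
    QueerCrystal.sdtSystem m, fun _ _ _ _ => rfl, QueerCrystal.infIso m,
    fun lam T hT hlam => QueerCrystal.infToLimit_eq rfl⟩
  rintro i T ⟨⟨lam, hT⟩, hD⟩
  rw [QueerCrystal.infE, Ne, Option.map_eq_none_iff]
  exact QueerCrystal.rawE_ne_none hT hD i
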